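/- Let $\Omega\subset\mathbb R^2$ be a polygonal domain that does not touch itself (e.g. a Lipschitz polygon), decomposed into non-overlapping closed triangles $\mathfrak e$ (the mesh $\mathfrak M$). Hanging nodes are allowed: a vertex lying on an element is one of its vertices or the midpoint of one of its sides. The mesh is shape regular with constant $\sigma>0$: every $\mathfrak e$ contains a disc of radius $\operatorname{diam}(\mathfrak e)/\sigma$. The nodes $\mathfrak N$ are the non-hanging vertices, $\mathcal H_h$ is the space of continuous functions on $\overline\Omega$ that are affine on each element, with nodal basis $(\phi_p)_{p\in\mathfrak N}$ and nodal interpolation operator $I_h$. For $p\in\mathfrak N$ let $\omega_p$ be the interior of the union of the elements sharing $p$, $h_p=\operatorname{diam}\omega_p$, $\gamma_p^I$ the union of the sides inside $\omega_p$, $\gamma_p^\Gamma=\partial\Omega\cap\partial\omega_p$ for boundary nodes $p$, and $\tilde\omega_p$ the patch of $p$ after two uniform red refinements (that is, $\omega_p$ scaled by $1/4$ about $p$). On the common side of two elements $\mathfrak e,\tilde{\mathfrak e}$ let $[\nabla v]=\nabla v|_{\tilde{\mathfrak e}}\cdot n_{\mathfrak e}-\nabla v|_{\mathfrak e}\cdot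 n_{\mathfrak e}$, with $n_{\mathfrak e}$ the unit outward normal of $\mathfrak e$. Let $G_c,\epsilon,\mu,\lambda>0$, $0<\kappa<1$, let $u_h$ be a continuous piecewise affine vector field (the discrete displacement), $E=\frac12(\nabla u_h+\nabla u_h^T)$ with positive spectral part $E^+$, $\sigma^+=2\mu E^++\lambda\max\{0,\operatorname{tr}E\}I$, $X:=(1-\kappa)\,\sigma^+:E\ge0$, and $$a(\zeta,\psi)=\int_\Omega\Big(\tfrac{G_c}{\epsilon}+X\Big)\zeta\psi+G_c\epsilon\int_\Omega\nabla\zeta\cdot\nabla\psi,\qquad \|\psi\|_{\epsilon,\omega}^2=\int_\omega\Big(\tfrac{G_c}{\epsilon}+X\Big)\psi^2+G_c\epsilon\int_\omega|\nabla\psi|^2,\qquad \|\cdot\|_\epsilon=\|\cdot\|_{\epsilon,\Omega}.$$ Let $\chi=I_h\varphi_h^{old}$ be the obstacle given by the phase field of the previous time step. Let $\varphi_h\in\mathcal H_h$ with $\varphi_h\le\chi$ at all nodes satisfy $a(\varphi_h,\psi_h-\varphi_h)\ge\int_\Omega\frac{G_c}{\epsilon}(\psi_h-\varphi_h)$ for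 all $\psi_h\in\mathcal H_h$ with $\psi_h\le\chi$ at all nodes, and let $\hat\varphi\in H^1(\Omega)$ with $\hat\varphi\le\chi$ a.e. satisfy $a(\hat\varphi,\psi-\hat\varphi)\ge\int_\Omega\frac{G_c}{\epsilon}(\psi-\hat\varphi)$ for all $\psi\in H^1(\Omega)$ with $\psi\le\chi$ a.e. Put $\langle\hat\Lambda,\psi\rangle=\int_\Omega\frac{G_c}{\epsilon}\psi-a(\hat\varphi,\psi)$ and $\langle\mathcal R,\psi\rangle=\int_\Omega\frac{G_c}{\epsilon}\psi-a(\varphi_h,\psi)$ for $\psi\in H^1(\Omega)$, and, elementwise, $r(\varphi_h)=\frac{G_c}{\epsilon}+G_c\epsilon\Delta\varphi_h-\frac{G_c}{\epsilon}\varphi_h-X\varphi_h$. A node $p$ is a full-contact node ($p\in\mathfrak N^{fC}$) if $\varphi_h=\chi$ on $\omega_p$ and $\langle\mathcal R,\psi\rangle\ge0$ for all $0\le\psi\in H^1_0(\omega_p)$, and a semi-contact node ($p\in\mathfrak N^{sC}$) if $\varphi_h(p)=\chi(p)$ and $p\notin\mathfrak N^{fC}$. With $c_p(\psi)=\int_{\tilde\omega_p}\psi\phi_p\big/\int_{\tilde\omega_p}\phi_p$,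 the quasi-discrete constraining force $\tilde\Lambda_h$ is $$\langle\tilde\Lambda_h,\psi\rangle=\sum_{p\in\mathfrak N^{sC}}\Big(\int_{\gamma_p^I}G_c\epsilon[\nabla\varphi_h]c_p(\psi)\phi_p+\int_{\omega_p}r(\varphi_h)c_p(\psi)\phi_p\Big)+\sum_{p\in\mathfrak N^{fC}}\Big(\int_{\gamma_p^I}G_c\epsilon[\nabla\varphi_h]\psi\phi_p+\int_{\omega_p}r(\varphi_h)\psi\phi_p\Big).$$ For a functional $F$ on $H^1(\Omega)$ let $\|F\|_{*,\epsilon,\omega_p}$ be the supremum of $\langle F,\psi\rangle/\|\psi\|_\epsilon$ over the nonzero $\psi\in H^1(\Omega)$ that vanish outside $\omega_p$ and, if $p$ is an interior node, on $\partial\Omega$ (so over $H^1_0(\omega_p)$ for interior nodes). Let $\alpha_p=\min_{\omega_p}\{\frac{G_c}{\epsilon}+X\}$, $m_p=\min\{h_p/\sqrt{G_c\epsilon},\,\alpha_p^{-1/2}\}$ and $$\eta_{1,p}=m_p\|r(\varphi_h)\|_{L^2(\omega_p)},\quad \eta_{2,p}=m_p^{1/2}(G_c\epsilon)^{-1/4}\|G_c\epsilon[\nabla\varphi_h]\|_{L^2(\gamma_p^I)},\quad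 \eta_{3,p}=m_p^{1/2}(G_c\epsilon)^{-1/4}\|G_c\epsilon\nabla\varphi_h\cdot n\|_{L^2(\gamma_p^\Gamma)}.$$ **Theorem.** For all $\sigma>0$ and $K$ there is a constant $C>0$, depending only on $\sigma$ and $K$, and in particular not on $\epsilon$ (robustness), such that in the above situation, for every node $p\in\mathfrak N\setminus\mathfrak N^{fC}$ with $h_p\,(\max_{\omega_p}X-\min_{\omega_p}X)\le K\,G_c$, $$\eta_{k,p}\le C\,\big(\|\hat\varphi-\varphi_h\|_{\epsilon,\omega_p}+\|\hat\Lambda-\tilde\Lambda_h\|_{*,\epsilon,\omega_p}\big)$$ holds for $k=1,2$, and, if $p$ is a boundary node, also for $k=3$. (The bound $K$ involves only the mesh, $G_c$, $\kappa$, $\mu$, $\lambda$ and $u_h$, not $\epsilon$; every configuration has such a $K$.) -/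

import Mathlib

open MeasureTheory Set Filter Topology
open scoped ENNReal ContDiff Gradient Laplacian RealInnerProductSpace

noncomputable section

namespace PhaseField

/-- The plane with its Euclidean structure. -/
abbrev Plane := EuclideanSpace ℝ (Fin 2)

/-! ### Triangular meshes -/

/-- The closed triangle spanned by the three vertices. -/
def carrier (T : Affine.Triangle ℝ Plane) : Set Plane := convexHull ℝ (range T.points)

/-- The closed side of `T` opposite to the vertex with number `i`. -/
def side (T : Affine.Triangle ℝ Plane) (i : Fin 3) : Set Plane :=
  convexHull ℝ (T.points '' {i}ᶜ)

/-- The outward unit normal of `T` on the side opposite to the vertex with number `i`: the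
normalized vector from that vertex to the foot of its altitude. -/
def outerNormal (T : Affine.Triangle ℝ Plane) (i : Fin 3) : Plane :=
  (T.height i)⁻¹ • (T.altitudeFoot i - T.points i)

/-- A triangular mesh of a polygonal domain, possibly with hanging nodes: the elements do not
overlap, a vertex that lies on another element is one of its vertices or the midpoint of one of
its sides (so that a side carries at most one hanging node), and any two elements that meet at a
point `x` are joined by a chain of elements containing `x`, consecutive ones having in common a
segment that issues from `x` (the domain does not touch itself at `x`, as is the case for a
Lipschitz domain). -/
structure TriMesh where
  elems : Finset (Affine.Triangle ℝ Plane)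
  disjoint_interior : ∀ S ∈ elems, ∀ T ∈ elems, S ≠ T →
    Disjoint (interior (carrier S)) (interior (carrier T))
  vertex_mem : ∀ S ∈ elems, ∀ T ∈ elems, ∀ i, S.points i ∈ carrier T →
    (∃ j, S.points i = T.points j) ∨
      ∃ j k, j ≠ k ∧ S.points i = midpoint ℝ (T.points j) (T.points k)
  chain : ∀ x, ∀ S ∈ elems, ∀ T ∈ elems, x ∈ carrier S → x ∈ carrier T →
    Relation.ReflTransGen
      (fun A B => B ∈ elems ∧ x ∈ carrier B ∧ ∃ y, y ≠ x ∧ y ∈ carrier A ∧ y ∈ carrier B) S T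

namespace TriMesh

variable (M : TriMesh)

/-- The polygonal domain `Ω` that is decomposed by the mesh. -/
def domain : Set Plane := interior (⋃ T ∈ M.elems, carrier T)

/-- Shape regularity with constant `σ`: each element contains a disc whose radius is the diameter
of the element divided by `σ`. -/
def ShapeRegular (σ : ℝ) : Prop :=
  ∀ T ∈ M.elems, ∃ c, Metric.ball c (Metric.diam (carrier T) / σ) ⊆ carrier T

/-- The nodes: the vertices of elements that are not hanging, i.e. that are a vertex of every
element they belong to. -/
def IsNode (p : Plane) : Prop :=
  (∃ T ∈ M.elems, p ∈ range T.points) ∧ ∀ T ∈ M.elems, p ∈ carrier T → p ∈ range T.points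

open Classical in
/-- The finite set of all nodes. -/
def nodes : Finset Plane :=
  (M.elems.biUnion fun T => Finset.univ.image T.points).filter M.IsNode

open Classical in
/-- The elements sharing the node `p`. -/
def star (p : Plane) : Finset (Affine.Triangle ℝ Plane) :=
  M.elems.filter fun T => p ∈ range T.points

/-- The patch `ω_p`: the interior of the union of all elements sharing `p`. -/
def patch (p : Plane) : Set Plane := interior (⋃ T ∈ M.star p, carrier T)

/-- `h_p`, the diameter of the patch. -/
def patchDiam (p : Plane) : ℝ := Metric.diam (M.patch p)

/-- The union of the open elements of the patch. -/
def openElems (p : Plane) : Set Plane := ⋃ T ∈ M.star p, interior (carrier T)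

/-- `γ_p^I`, the union of all sides in the interior of the patch. -/
def innerSides (p : Plane) : Set Plane := M.patch p ∩ ⋃ T ∈ M.star p, frontier (carrier T)

/-- `γ_p^Γ`, the intersection of the boundary of the domain with the boundary of the patch. -/
def boundarySides (p : Plane) : Set Plane := frontier M.domain ∩ frontier (M.patch p)

/-- The patch around `p` with respect to two uniform red refinements of the mesh. Red refinement
halves all sides, so this is the patch `ω_p` scaled by `1/4` about `p`. -/
def smallPatch (p : Plane) : Set Plane := AffineMap.homothety p (1 / 4 : ℝ) '' M.patch p

/-- Continuous piecewise linear finite element functions with values in `V`. Values at hanging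
nodes are determined by continuity. -/
def IsP1 {V : Type*} [NormedAddCommGroup V] [NormedSpace ℝ V] (f : Plane → V) : Prop :=
  ContinuousOn f (closure M.domain) ∧
    ∀ T ∈ M.elems, ∃ A : Plane →ᵃ[ℝ] V, EqOn f A (carrier T)

/-- `φ` is the nodal basis of the scalar finite element space. -/
def IsNodalBasis (φ : Plane → Plane → ℝ) : Prop :=
  ∀ p ∈ M.nodes, M.IsP1 (φ p) ∧ φ p p = 1 ∧ ∀ q ∈ M.nodes, q ≠ p → φ p q = 0

/-- The nodal interpolation operator `I_h`. -/
def interp (φ : Plane → Plane → ℝ) (f : Plane → ℝ) : Plane → ℝ :=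
  fun x => ∑ p ∈ M.nodes, f p * φ p x

open Classical in
/-- The sum of the outward normal derivatives of `v` at `x` over the elements that have a side
containing `x`, where the gradient is taken from within the element. At a relatively interior point
of a boundary side this is the outward normal derivative `∇v · n`. -/
def normalFlux (v : Plane → ℝ) (x : Plane) : ℝ :=
  ∑ T ∈ M.elems, ∑ i : Fin 3,
    if x ∈ side T i then ⟪gradientWithin v (carrier T) x, outerNormal T i⟫ else 0

/-- The jump of the normal derivative across the common side of two elements `e` and `e'`, namely
`∇v|_e' · n_e - ∇v|_e · n_e` with the outward normal `n_e` of `e`; as `n_e' = - n_e`, this is minus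
the sum of the two outward normal derivatives. The sign is the one with which elementwise
integration by parts gives `- ∫ ∇v · ∇ψ = ∑ ∫_e Δv ψ + ∑ ∫_s [∇v] ψ` for `ψ` vanishing on the
boundary. -/
def jump (v : Plane → ℝ) (x : Plane) : ℝ := - M.normalFlux v x

end TriMesh

/-! ### Sobolev functions -/

/-- `G` is the weak gradient of `v` in the open set `Ω`. -/
def IsWeakGradient (Ω : Set Plane) (v : Plane → ℝ) (G : Plane → Plane) : Prop :=
  ∀ η : Plane → ℝ, ContDiff ℝ ∞ η → HasCompactSupport η → tsupport η ⊆ Ω →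
    ∀ w : Plane, ∫ x in Ω, v x * fderiv ℝ η x w = - ∫ x in Ω, ⟪G x, w⟫ * η x

/-- A function in `H¹(Ω)` together with its weak gradient. -/
structure H1 (Ω : Set Plane) where
  toFun : Plane → ℝ
  grad : Plane → Plane
  memLp_toFun : MemLp toFun 2 (volume.restrict Ω)
  memLp_grad : MemLp grad 2 (volume.restrict Ω)
  weak : IsWeakGradient Ω toFun grad

namespace H1

variable {Ω : Set Plane}

/-- The trace of a Sobolev function at a point of a side, as the limit of the mean values over
small discs intersected with the domain; for `ψ ∈ H¹(Ω)` it exists at almost every point of each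
side with respect to length, and is the usual trace. -/
def trace (ψ : H1 Ω) (x : Plane) : ℝ :=
  limUnder (𝓝[>] (0 : ℝ)) fun ρ => ⨍ y in Metric.ball x ρ ∩ Ω, ψ.toFun y

/-- `ψ` vanishes outside `U`. -/
def VanishesOutside (ψ : H1 Ω) (U : Set Plane) : Prop :=
  ∀ᵐ x ∂(volume.restrict (Ω \ U)), ψ.toFun x = 0

/-- `ψ` vanishes on the boundary of `Ω`: its extension by zero is weakly differentiable in the
whole plane. -/
def ZeroBoundary (ψ : H1 Ω) : Prop :=
  IsWeakGradient univ (Ω.indicator ψ.toFun) (Ω.indicator ψ.grad)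

/-- `ψ ∈ H¹₀(U)` for a patch `U ⊆ Ω`. -/
def MemH10 (ψ : H1 Ω) (U : Set Plane) : Prop := ψ.VanishesOutside U ∧ ψ.ZeroBoundary

end H1

/-! ### The phase-field problem in one time step -/

/-- The parameters of the model. -/
structure Params where
  (Gc eps kappa mu lam : ℝ)
  Gc_pos : 0 < Gc
  eps_pos : 0 < eps
  kappa_pos : 0 < kappa
  kappa_lt_one : kappa < 1
  mu_pos : 0 < mu
  lam_pos : 0 < lam

/-- The linearized strain tensor `(∇u + ∇uᵀ) / 2`. -/
def strain (u : Plane → Plane) (x : Plane) : Matrix (Fin 2) (Fin 2) ℝ :=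
  Matrix.of fun i j =>
    (fderiv ℝ u x (EuclideanSpace.single j 1) i + fderiv ℝ u x (EuclideanSpace.single i 1) j) / 2

theorem strain_isHermitian (u : Plane → Plane) (x : Plane) : (strain u x).IsHermitian := by
  ext i j
  simp [strain, add_comm]

/-- The tensile part `Q D⁺ Qᵀ` of the strain tensor. -/
def strainPos (u : Plane → Plane) (x : Plane) : Matrix (Fin 2) (Fin 2) ℝ :=
  (strain_isHermitian u x).cfc fun t => max t 0

variable (P : Params) (M : TriMesh) (u : Plane → Plane)

/-- The tensile stress `σ⁺(u) = 2 μ E⁺ + λ max(0, tr E) I`. -/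
def stressPos (x : Plane) : Matrix (Fin 2) (Fin 2) ℝ :=
  (2 * P.mu) • strainPos u x + (P.lam * max 0 (strain u x).trace) • 1

/-- The density `σ⁺(u) : E_lin(u)` (Frobenius product). -/
def energyDensity (x : Plane) : ℝ := ∑ i, ∑ j, stressPos P u x i j * strain u x i j

/-- The reaction coefficient `G_c / ε + (1 - κ) σ⁺(u) : E_lin(u)`. -/
def coef (x : Plane) : ℝ := P.Gc / P.eps + (1 - P.kappa) * energyDensity P u x

/-- The bilinear form `a_{h,ε}(ζ, ψ)`, where `Dζ`, `Dψ` are the gradients of `ζ`, `ψ`. -/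
def form (ζ : Plane → ℝ) (Dζ : Plane → Plane) (ψ : Plane → ℝ) (Dψ : Plane → Plane) : ℝ :=
  (∫ x in M.domain, coef P u x * ζ x * ψ x) +
    P.Gc * P.eps * ∫ x in M.domain, ⟪Dζ x, Dψ x⟫

/-- The functional `⟨G_c / ε, ψ⟩`. -/
def load (ψ : Plane → ℝ) : ℝ := ∫ x in M.domain, P.Gc / P.eps * ψ x

/-- The energy norm `‖·‖_{ε,U}` over `U` of a function `v` with gradient `Dv`. -/
def energyNorm (U : Set Plane) (v : Plane → ℝ) (Dv : Plane → Plane) : ℝ :=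
  √(P.Gc * P.eps * (∫ x in U, ‖Dv x‖ ^ 2) + ∫ x in U, coef P u x * v x ^ 2)

/-- `φh` solves the discrete variational inequality of the phase field for the obstacle `χ`. -/
def IsDiscreteSolution (χ φh : Plane → ℝ) : Prop :=
  M.IsP1 φh ∧ (∀ p ∈ M.nodes, φh p ≤ χ p) ∧
    ∀ ψ : Plane → ℝ, M.IsP1 ψ → (∀ p ∈ M.nodes, ψ p ≤ χ p) →
      load P M (ψ - φh) ≤ form P M u φh (∇ φh) (ψ - φh) (∇ (ψ - φh))

/-- `φ` solves the auxiliary variational inequality in `H¹(Ω)` for the obstacle `χ`. -/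
def IsAuxSolution (χ : Plane → ℝ) (φ : H1 M.domain) : Prop :=
  (∀ᵐ x ∂(volume.restrict M.domain), φ.toFun x ≤ χ x) ∧
    ∀ ψ : H1 M.domain, (∀ᵐ x ∂(volume.restrict M.domain), ψ.toFun x ≤ χ x) →
      load P M (ψ.toFun - φ.toFun) ≤
        form P M u φ.toFun φ.grad (ψ.toFun - φ.toFun) (ψ.grad - φ.grad)

/-- The constraining force density `Λ̂` of the auxiliary solution `φ`. -/
def force (φ ψ : H1 M.domain) : ℝ :=
  load P M ψ.toFun - form P M u φ.toFun φ.grad ψ.toFun ψ.grad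

/-- The linear residual of the discrete solution, as a functional on `H¹(Ω)`. -/
def linResidual (φh : Plane → ℝ) (ψ : H1 M.domain) : ℝ :=
  load P M ψ.toFun - form P M u φh (∇ φh) ψ.toFun ψ.grad

/-- Full-contact nodes. -/
def IsFullContact (χ φh : Plane → ℝ) (p : Plane) : Prop :=
  p ∈ M.nodes ∧ EqOn φh χ (M.patch p) ∧
    ∀ ψ : H1 M.domain, ψ.MemH10 (M.patch p) →
      (∀ᵐ x ∂(volume.restrict M.domain), 0 ≤ ψ.toFun x) → 0 ≤ linResidual P M u φh ψ

/-- Semi-contact nodes. -/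
def IsSemiContact (χ φh : Plane → ℝ) (p : Plane) : Prop :=
  p ∈ M.nodes ∧ φh p = χ p ∧ ¬ IsFullContact P M u χ φh p

/-- The element residual `r(φ_h)`, at points in the interior of elements. -/
def elemResidual (φh : Plane → ℝ) (x : Plane) : ℝ :=
  P.Gc / P.eps + P.Gc * P.eps * Δ φh x - P.Gc / P.eps * φh x
    - (1 - P.kappa) * energyDensity P u x * φh x

/-- The weighted mean value `c_p(ψ)`, with the nodal basis function `φp` of `p`. -/
def wmean (φp : Plane → ℝ) (p : Plane) (ψ : Plane → ℝ) : ℝ :=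
  (∫ x in M.smallPatch p, ψ x * φp x) / ∫ x in M.smallPatch p, φp x

/-- The contribution of a semi-contact node `p` to the quasi-discrete constraining force. -/
def semiPart (φp φh : Plane → ℝ) (p : Plane) (ψ : H1 M.domain) : ℝ :=
  (∫ x in M.innerSides p, P.Gc * P.eps * M.jump φh x * wmean M φp p ψ.toFun * φp x ∂μH[1]) +
    ∫ x in M.patch p, elemResidual P u φh x * wmean M φp p ψ.toFun * φp x

/-- The contribution of a full-contact node `p` to the quasi-discrete constraining force. -/
def fullPart (φp φh : Plane → ℝ) (p : Plane) (ψ : H1 M.domain) : ℝ :=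
  (∫ x in M.innerSides p, P.Gc * P.eps * M.jump φh x * ψ.trace x * φp x ∂μH[1]) +
    ∫ x in M.patch p, elemResidual P u φh x * ψ.toFun x * φp x

open Classical in
/-- The quasi-discrete constraining force `Λ̃_h`. -/
def quasiForce (φ : Plane → Plane → ℝ) (χ φh : Plane → ℝ) (ψ : H1 M.domain) : ℝ :=
  (∑ p ∈ M.nodes.filter (IsSemiContact P M u χ φh), semiPart P M u (φ p) φh p ψ) +
    ∑ p ∈ M.nodes.filter (IsFullContact P M u χ φh), fullPart P M u (φ p) φh p ψ

/-- The test functions of the local dual norm on `ω_p`: functions in `H¹(Ω)` that vanish outside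
`ω_p` and, if `p` is an interior node, on the boundary of `Ω` (so `H¹₀(ω_p)` for interior nodes). -/
def IsLocalTest (p : Plane) (ψ : H1 M.domain) : Prop :=
  ψ.VanishesOutside (M.patch p) ∧ (p ∈ M.domain → ψ.ZeroBoundary)

/-- The local dual norm `‖F‖_{*,ε,ω_p}`. -/
def localDualNorm (p : Plane) (F : H1 M.domain → ℝ) : ℝ≥0∞ :=
  ⨆ (ψ : H1 M.domain) (_ : IsLocalTest M p ψ),
    ENNReal.ofReal |F ψ| / ENNReal.ofReal (energyNorm P u M.domain ψ.toFun ψ.grad)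

/-- The local error measure `‖φ̂ - φ_h‖_{ε,ω_p} + ‖Λ̂ - Λ̃_h‖_{*,ε,ω_p}`. -/
def localError (φ : Plane → Plane → ℝ) (χ φh : Plane → ℝ) (φhat : H1 M.domain) (p : Plane) :
    ℝ≥0∞ :=
  ENNReal.ofReal (energyNorm P u (M.patch p) (φhat.toFun - φh) (φhat.grad - ∇ φh)) +
    localDualNorm P M u p fun ψ => force P M u φhat ψ - quasiForce P M u φ χ φh ψ

/-- `α_p`, the minimum of the (elementwise constant) reaction coefficient over the patch. -/
def alpha (p : Plane) : ℝ := sInf (coef P u '' M.openElems p)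

/-- The weight `min {h_p / √(G_c ε), α_p^{-1/2}}`. -/
def weight (p : Plane) : ℝ :=
  min (M.patchDiam p / √(P.Gc * P.eps)) (alpha P M u p ^ (-(1 / 2) : ℝ))

/-- The element residual contribution `η_{1,p}`. -/
def eta1 (φh : Plane → ℝ) (p : Plane) : ℝ :=
  weight P M u p * √(∫ x in M.patch p, elemResidual P u φh x ^ 2)

/-- The interior gradient jump contribution `η_{2,p}`. -/
def eta2 (φh : Plane → ℝ) (p : Plane) : ℝ :=
  weight P M u p ^ (1 / 2 : ℝ) * (P.Gc * P.eps) ^ (-(1 / 4) : ℝ) *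
    √(∫ x in M.innerSides p, (P.Gc * P.eps * M.jump φh x) ^ 2 ∂μH[1])

/-- The boundary normal derivative contribution `η_{3,p}`. -/
def eta3 (φh : Plane → ℝ) (p : Plane) : ℝ :=
  weight P M u p ^ (1 / 2 : ℝ) * (P.Gc * P.eps) ^ (-(1 / 4) : ℝ) *
    √(∫ x in M.boundarySides p, (P.Gc * P.eps * M.normalFlux φh x) ^ 2 ∂μH[1])

end PhaseField

end

open MeasureTheory Set Filter Topology
open scoped ENNReal ContDiff Gradient Laplacian RealInnerProductSpace

noncomputable section

namespace PhaseField

/-! ### Barycentric coordinates of a triangle -/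

/-! The bounds come from one residual identity, tested with bumps adapted to the mesh. For ψ ∈
H¹(Ω), ⟨R, ψ⟩ − ⟨Λ̃_h, ψ⟩ = a(φ̂ − φ_h, ψ) + ⟨Λ̂ − Λ̃_h, ψ⟩, so for an admissible ψ living on ω_p
the left side is at most the local error times ‖ψ‖_ε (`abs_residual_le`). If ψ also vanishes on
every small patch ω̃_q, all means c_q(ψ) are zero and the semi-contact part of Λ̃_h disappears.
Subtracting the full-contact part changes the weight of the element and jump terms of R from 1 to 1
− ∑ φ_q, with q running over the full-contact nodes. By the partition of unity this weight is at
least φ_p, since p is not a full-contact node (`freeWeight_bounds`). In turn φ_p dominates the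
barycentric coordinate of p (`bary_le_nodalBasis`), which exceeds 1/4 on the supports used for
element residuals and jumps. Hence the contact set costs only a fixed factor.

The bumps are products of two one-dimensional cut-offs in a rotated box (`ridge`), truncated to a
closed union D of elements (`cutoffTest`). On their supports all barycentric coordinates are below
3/4, whereas each point of a small patch has a coordinate of at least 3/4. An element residual is
affine, so it keeps its sign and size on a small square inside the element (`exists_large_value`,
`volume_residual_le`). The gradient of φ_h is elementwise constant, so integrating it against the
gradient of a bump centred on a side yields the jump or the normal derivative by Fubini
(`jump_residual_le`, `boundary_residual_le`); no elementwise Green formula is needed.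

Robustness lies in the height of the bump across a side, a fixed multiple of m_p √(G_c ε)
(`flux_le_of_residual_le`): its gradient energy is then of order m_p⁻² times its area. For the
reaction energy to be of that order, the coefficient must be at most (1 + K) m_p⁻² on all of ω_p.
This follows from m_p² α_p ≤ 1, the oscillation hypothesis, and m_p² G_c ≤ h_p
(`weight_sq_mul_Gc_le`), in which ε has cancelled.

The constants depend on σ only because a patch has at most σ² elements (`card_star_le`) of
comparable diameters (`diam_le_pow_card`, `patchDiam_le`); comparability rests on the rule for
hanging nodes and on the chains of elements around p. -/

/-- The affine basis formed by the vertices of a triangle. -/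
def vertexBasis (T : Affine.Triangle ℝ Plane) : AffineBasis (Fin 3) ℝ Plane where
  toFun := T.points
  ind' := T.independent
  tot' := by
    rw [T.independent.affineSpan_eq_top_iff_card_eq_finrank_add_one]
    simp

/-- The barycentric coordinate of a triangle belonging to the vertex with number `i`. -/
def bary (T : Affine.Triangle ℝ Plane) (i : Fin 3) : Plane →ᵃ[ℝ] ℝ := (vertexBasis T).coord i

variable (T : Affine.Triangle ℝ Plane)

theorem bary_self (i : Fin 3) : bary T i (T.points i) = 1 :=
  (vertexBasis T).coord_apply_eq i

theorem bary_ne {i j : Fin 3} (h : i ≠ j) : bary T i (T.points j) = 0 :=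
  (vertexBasis T).coord_apply_ne h

theorem bary_points (i j : Fin 3) : bary T i (T.points j) = if i = j then 1 else 0 :=
  (vertexBasis T).coord_apply i j

theorem sum_bary (x : Plane) : ∑ i, bary T i x = 1 := (vertexBasis T).sum_coord_apply_eq_one x

theorem sum_bary_smul (x : Plane) : ∑ i, bary T i x • T.points i = x :=
  (vertexBasis T).linear_combination_coord_eq_self x

theorem bary_ext {x y : Plane} (h : ∀ i, bary T i x = bary T i y) : x = y :=
  (vertexBasis T).ext_elem h

theorem mem_carrier_iff {x : Plane} : x ∈ carrier T ↔ ∀ i, 0 ≤ bary T i x := by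
  have := (vertexBasis T).convexHull_eq_nonneg_coord
  exact Set.ext_iff.1 this x

theorem mem_interior_iff {x : Plane} : x ∈ interior (carrier T) ↔ ∀ i, 0 < bary T i x := by
  have := (vertexBasis T).interior_convexHull
  exact Set.ext_iff.1 this x

theorem bary_le_one {x : Plane} (hx : x ∈ carrier T) (i : Fin 3) : bary T i x ≤ 1 := by
  rw [← sum_bary T x]
  exact Finset.single_le_sum (f := fun i => bary T i x)
    (fun j _ => (mem_carrier_iff T).1 hx j) (Finset.mem_univ i)

theorem affine_eq_sum_bary {V : Type*} [NormedAddCommGroup V] [NormedSpace ℝ V]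
    (A : Plane →ᵃ[ℝ] V) (x : Plane) : A x = ∑ i, bary T i x • A (T.points i) := by
  have h := Finset.univ.map_affineCombination (vertexBasis T) (fun i => bary T i x) (sum_bary T x) A
  rw [show Finset.univ.affineCombination ℝ (vertexBasis T) (fun i => bary T i x) = x from
    (vertexBasis T).affineCombination_coord_eq_self x] at h
  rw [h, Finset.affineCombination_eq_linear_combination _ _ _ (sum_bary T x)]
  rfl

theorem points_mem_carrier (i : Fin 3) : T.points i ∈ carrier T :=
  subset_convexHull _ _ (mem_range_self i)

theorem convex_carrier : Convex ℝ (carrier T) := convex_convexHull _ _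

theorem isCompact_carrier : IsCompact (carrier T) := (finite_range _).isCompact_convexHull ℝ

theorem isClosed_carrier : IsClosed (carrier T) := (isCompact_carrier T).isClosed

/-- The barycentric coordinates are continuous. -/
theorem continuous_affineMap {V : Type*} [NormedAddCommGroup V] [NormedSpace ℝ V]
    (A : Plane →ᵃ[ℝ] V) : Continuous A := A.continuous_of_finiteDimensional

theorem exists_bary (c : Fin 3 → ℝ) (hc : ∑ i, c i = 1) : ∃ z, ∀ i, bary T i z = c i :=
  ⟨Finset.univ.affineCombination ℝ (vertexBasis T) c, fun i =>
    (vertexBasis T).coord_apply_combination_of_mem (Finset.mem_univ i) hc⟩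

theorem interior_nonempty : (interior (carrier T)).Nonempty := by
  obtain ⟨z, hz⟩ := exists_bary T (fun _ => 1 / 3) (by norm_num [Fin.sum_univ_three])
  exact ⟨z, (mem_interior_iff T).2 fun i => by rw [hz]; norm_num⟩

theorem closure_interior_carrier : closure (interior (carrier T)) = carrier T := by
  rw [(convex_carrier T).closure_interior_eq_closure_of_nonempty_interior (interior_nonempty T),
    (isClosed_carrier T).closure_eq]

theorem volume_frontier_carrier : volume (frontier (carrier T)) = 0 :=
  (convex_carrier T).addHaar_frontier volume

theorem exists_bary_eq_zero_of_mem_frontier {x : Plane} (hx : x ∈ frontier (carrier T)) :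
    ∃ i, bary T i x = 0 := by
  rw [(isClosed_carrier T).frontier_eq] at hx
  by_contra! h
  exact hx.2 ((mem_interior_iff T).2 fun i =>
    lt_of_le_of_ne ((mem_carrier_iff T).1 hx.1 i) (h i).symm)

theorem eq_points_of_bary {x : Plane} {i j k : Fin 3} (hij : i ≠ j) (hik : i ≠ k) (hjk : j ≠ k)
    (hi : bary T i x = 0) (hj : bary T j x = 0) : x = T.points k := by
  have hs := sum_bary T x
  have hk : bary T k x = 1 := by
    fin_cases i <;> fin_cases j <;> fin_cases k <;> simp_all [Fin.sum_univ_three]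
  apply bary_ext T
  intro l
  rw [bary_points]
  fin_cases i <;> fin_cases j <;> fin_cases k <;> fin_cases l <;> simp_all

theorem mem_side_iff {x : Plane} {i : Fin 3} :
    x ∈ side T i ↔ x ∈ carrier T ∧ bary T i x = 0 := by
  constructor
  · intro hx
    have h1 : side T i ⊆ carrier T := convexHull_mono (image_subset_range _ _)
    refine ⟨h1 hx, ?_⟩
    have h2 : side T i ⊆ {y | bary T i y = 0} := by
      apply convexHull_min
      · rintro _ ⟨j, hj, rfl⟩
        exact bary_ne T (fun h => hj h.symm)
      · exact (convex_singleton (0 : ℝ)).affine_preimage (bary T i)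
    exact h2 hx
  · rintro ⟨hx, hi⟩
    rw [mem_carrier_iff] at hx
    rw [← sum_bary_smul T x]
    have hs := sum_bary T x
    rw [← Finset.sum_erase_add _ _ (Finset.mem_univ i), hi, zero_smul, add_zero]
    rw [← Finset.sum_erase_add _ _ (Finset.mem_univ i), hi, add_zero] at hs
    apply (convex_convexHull ℝ _).sum_mem (fun j _ => hx j) hs
    intro j hj
    exact subset_convexHull _ _ ⟨j, by simpa using hj, rfl⟩

/-! ### Shape regularity -/

theorem diam_carrier_pos : 0 < Metric.diam (carrier T) := by
  have hb := (isCompact_carrier T).isBounded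
  have hne : T.points 0 ≠ T.points 1 := T.independent.injective.ne (by decide)
  exact (dist_pos.2 hne).trans_le
    (Metric.dist_le_diam_of_mem hb (points_mem_carrier T 0) (points_mem_carrier T 1))

theorem dist_le_diam_carrier {x y : Plane} (hx : x ∈ carrier T) (hy : y ∈ carrier T) :
    dist x y ≤ Metric.diam (carrier T) :=
  Metric.dist_le_diam_of_mem (isCompact_carrier T).isBounded hx hy

/-- The coordinate takes values in [0, 1] on the inscribed disc. Comparing its values at c + v and c
− v bounds its linear part by 1/2 on vectors shorter than diam / σ, and homogeneity gives the
Lipschitz constant. -/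
theorem abs_bary_sub_le {σ : ℝ} (hσ : 0 < σ)
    (hT : ∃ c, Metric.ball c (Metric.diam (carrier T) / σ) ⊆ carrier T) (i : Fin 3) (x y : Plane) :
    |bary T i x - bary T i y| ≤ σ / (2 * Metric.diam (carrier T)) * dist x y := by
  obtain ⟨c, hc⟩ := hT
  have hd := diam_carrier_pos T
  set d := Metric.diam (carrier T)
  set L := (bary T i).linear
  have key : ∀ v : Plane, ‖v‖ < d / σ → L v ≤ 1 / 2 := by
    intro v hv
    have h1 : c + v ∈ carrier T := hc (by simpa using hv)
    have h2 : c - v ∈ carrier T := hc (by simpa [dist_eq_norm] using hv)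
    have e1 := bary_le_one T h1 i
    have e2 := (mem_carrier_iff T).1 h2 i
    have e3 : bary T i (c + v) = L v + bary T i c := by
      simpa [add_comm] using (bary T i).map_vadd c v
    have e4 : bary T i (c - v) = - L v + bary T i c := by
      simpa [add_comm, sub_eq_add_neg] using (bary T i).map_vadd c (-v)
    linarith
  have key2 : ∀ v : Plane, L v ≤ σ / (2 * d) * ‖v‖ := by
    intro v
    by_contra! h
    have hL : 0 < L v := lt_of_le_of_lt (by positivity) h
    obtain ⟨s, hs1, hs2⟩ : ∃ s, 1 / 2 / L v < s ∧ s * ‖v‖ < d / σ := by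
      rcases eq_or_ne v 0 with rfl | hv
      · simp at hL
      have hv' : 0 < ‖v‖ := norm_pos_iff.2 hv
      have : 1 / 2 / L v < d / σ / ‖v‖ := by
        rw [div_lt_div_iff₀ hL hv']
        have : σ / (2 * d) * ‖v‖ = (1 / 2 * ‖v‖) / (d / σ) := by field_simp
        rw [this, div_lt_iff₀ (by positivity)] at h
        linarith
      obtain ⟨s, h1, h2⟩ := exists_between this
      exact ⟨s, h1, by rwa [lt_div_iff₀ hv'] at h2⟩
    have hs0 : 0 < s := lt_trans (by positivity) hs1
    have := key (s • v) (by rw [norm_smul, Real.norm_of_nonneg hs0.le]; exact hs2)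
    rw [map_smul, smul_eq_mul] at this
    rw [div_lt_iff₀ hL] at hs1
    linarith
  have e : bary T i x - bary T i y = L (x - y) := ((bary T i).linearMap_vsub x y).symm
  rw [e, abs_le, dist_eq_norm]
  refine ⟨?_, key2 _⟩
  have := key2 (-(x - y))
  rw [norm_neg, map_neg] at this
  linarith

theorem diam_le_mul_dist_points {σ : ℝ} (hσ : 0 < σ)
    (hT : ∃ c, Metric.ball c (Metric.diam (carrier T) / σ) ⊆ carrier T) {i j : Fin 3}
    (hij : i ≠ j) : 2 * Metric.diam (carrier T) ≤ σ * dist (T.points i) (T.points j) := by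
  have h := abs_bary_sub_le T hσ hT i (T.points i) (T.points j)
  have hd := diam_carrier_pos T
  rw [bary_self, bary_ne T hij, div_mul_eq_mul_div, le_div_iff₀ (by positivity)] at h
  simpa using h

theorem two_le_of_shapeRegular {σ : ℝ} (hσ : 0 < σ)
    (hT : ∃ c, Metric.ball c (Metric.diam (carrier T) / σ) ⊆ carrier T) : 2 ≤ σ := by
  have h := diam_le_mul_dist_points T hσ hT (i := 0) (j := 1) (by decide)
  have h2 := dist_le_diam_carrier T (points_mem_carrier T 0) (points_mem_carrier T 1)
  have hd := diam_carrier_pos T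
  nlinarith

/-! ### Outer normals and gradients -/

theorem norm_outerNormal (i : Fin 3) : ‖outerNormal T i‖ = 1 := by
  have h := T.height_pos i
  rw [outerNormal, norm_smul, norm_inv, Real.norm_of_nonneg h.le, ← dist_eq_norm, dist_comm]
  exact inv_mul_cancel₀ h.ne'

/-- Distances from a side are proportional to the barycentric coordinate. -/
theorem inner_outerNormal_eq (i : Fin 3) (x y : Plane) :
    ⟪outerNormal T i, x - y⟫ = - (T.height i * (bary T i x - bary T i y)) := by
  have hh := T.height_pos i
  have hp : ∀ j, ⟪outerNormal T i, T.points j⟫ =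
      ⟪outerNormal T i, T.points i⟫ + T.height i * (1 - bary T i (T.points j)) := by
    intro j
    rcases eq_or_ne j i with rfl | hj
    · simp [bary_self]
    have h0 := T.inner_vsub_vsub_altitudeFoot_eq_height_sq hj.symm
    rw [bary_ne T hj.symm, sub_zero, mul_one, ← sub_eq_iff_eq_add', ← inner_sub_right, outerNormal,
      inner_smul_left, ← neg_sub (T.points i) (T.points j), ← neg_sub (T.points i) (T.altitudeFoot i),
      inner_neg_neg, real_inner_comm]
    simp only [vsub_eq_sub] at h0
    rw [h0]
    simp [pow_two, hh.ne']
  have hB : ∀ x, ⟪outerNormal T i, x⟫ =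
      ⟪outerNormal T i, T.points i⟫ + T.height i * (1 - bary T i x) := by
    intro x
    conv_lhs => rw [← sum_bary_smul T x]
    rw [inner_sum]
    have hj : ∀ j, ⟪outerNormal T i, bary T j x • T.points j⟫ =
        (⟪outerNormal T i, T.points i⟫ + T.height i) * bary T j x -
          T.height i * if i = j then bary T j x else 0 := by
      intro j
      rw [inner_smul_right, hp, bary_points]
      split_ifs <;> ring
    rw [Finset.sum_congr rfl fun j _ => hj j, Finset.sum_sub_distrib, ← Finset.mul_sum,
      ← Finset.mul_sum, sum_bary, Finset.sum_ite_eq, if_pos (Finset.mem_univ i)]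
    ring
  rw [inner_sub_right, hB x, hB y]
  ring

/-- The gradient of an affine function. -/
def affGrad (A : Plane →ᵃ[ℝ] ℝ) : Plane :=
  (InnerProductSpace.toDual ℝ Plane).symm (LinearMap.toContinuousLinearMap A.linear)

theorem hasFDerivAt_affineMap {V : Type*} [NormedAddCommGroup V] [NormedSpace ℝ V]
    (A : Plane →ᵃ[ℝ] V) (x : Plane) :
    HasFDerivAt A (LinearMap.toContinuousLinearMap A.linear) x := by
  have h : (A : Plane → V) = fun y => LinearMap.toContinuousLinearMap A.linear y + A 0 := by
    ext y
    have := A.map_vadd 0 y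
    simpa using this
  rw [h]
  exact ((LinearMap.toContinuousLinearMap A.linear).hasFDerivAt).add_const _

theorem gradientWithin_carrier {v : Plane → ℝ} {A : Plane →ᵃ[ℝ] ℝ} (h : EqOn v A (carrier T))
    {x : Plane} (hx : x ∈ carrier T) : gradientWithin v (carrier T) x = affGrad A := by
  have hu : UniqueDiffWithinAt ℝ (carrier T) x :=
    (uniqueDiffOn_convex (convex_carrier T) (interior_nonempty T)) x hx
  rw [gradientWithin, affGrad]
  congr 1
  exact (((hasFDerivAt_affineMap A x).hasFDerivWithinAt).congr h (h hx)).fderivWithin hu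

theorem eventuallyEq_of_mem_interior {V : Type*} {v A : Plane → V} (h : EqOn v A (carrier T))
    {x : Plane} (hx : x ∈ interior (carrier T)) : v =ᶠ[𝓝 x] A :=
  h.eventuallyEq_of_mem (mem_interior_iff_mem_nhds.1 hx)

theorem gradient_of_mem_interior {v : Plane → ℝ} {A : Plane →ᵃ[ℝ] ℝ} (h : EqOn v A (carrier T))
    {x : Plane} (hx : x ∈ interior (carrier T)) : ∇ v x = affGrad A := by
  rw [gradient, (eventuallyEq_of_mem_interior T h hx).fderiv_eq, (hasFDerivAt_affineMap A x).fderiv,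
    affGrad]

theorem laplacian_of_mem_interior {v : Plane → ℝ} {A : Plane →ᵃ[ℝ] ℝ} (h : EqOn v A (carrier T))
    {x : Plane} (hx : x ∈ interior (carrier T)) : Δ v x = 0 := by
  rw [(InnerProductSpace.laplacian_congr_nhds (eventuallyEq_of_mem_interior T h hx)).eq_of_nhds,
    InnerProductSpace.laplacian_eq_iteratedFDeriv_stdOrthonormalBasis]
  have h1 : fderiv ℝ A = fun _ => LinearMap.toContinuousLinearMap A.linear := by
    ext1 y
    exact (hasFDerivAt_affineMap A y).fderiv
  simp [iteratedFDeriv_two_apply, h1]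

/-! ### Finite element functions and the partition of unity -/

section Mesh

variable {M : TriMesh} {S T : Affine.Triangle ℝ Plane} {p x y z : Plane}

/-- An open set disjoint from the interior of a triangle is disjoint from its closure, which is the
whole closed triangle. -/
theorem notMem_of_mem_interior (hS : S ∈ M.elems) (hT : T ∈ M.elems) (hne : S ≠ T)
    (hx : x ∈ interior (carrier T)) : x ∉ carrier S := by
  have h := ((M.disjoint_interior S hS T hT hne).symm).closure_right isOpen_interior
  rw [closure_interior_carrier] at h
  exact Set.disjoint_left.1 h hx

/-- Minimum principle: an elementwise affine function that is nonnegative at the nodes is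
nonnegative, because among the vertices with the minimal value the one of largest norm cannot be
a midpoint of two others. -/
theorem nonneg_of_nonneg_nodes {v : Plane → ℝ}
    (hv : ∀ T ∈ M.elems, ∃ A : Plane →ᵃ[ℝ] ℝ, EqOn v A (carrier T))
    (hn : ∀ q ∈ M.nodes, 0 ≤ v q) (hT : T ∈ M.elems) (hx : x ∈ carrier T) : 0 ≤ v x := by
  classical
  set V : Finset Plane := M.elems.biUnion fun T => Finset.univ.image T.points with hV
  have memV : ∀ S ∈ M.elems, ∀ i, S.points i ∈ V := fun S hS i =>
    Finset.mem_biUnion.2 ⟨S, hS, Finset.mem_image_of_mem _ (Finset.mem_univ i)⟩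
  obtain ⟨m, hm, hmin⟩ := V.exists_min_image v ⟨_, memV T hT 0⟩
  have hpos : 0 ≤ v m := by
    by_contra! hneg
    obtain ⟨w, hw, hmax⟩ := (V.filter fun q => v q = v m).exists_max_image (‖·‖)
      ⟨m, Finset.mem_filter.2 ⟨hm, rfl⟩⟩
    rw [Finset.mem_filter] at hw
    obtain ⟨S, hS, hwS⟩ := Finset.mem_biUnion.1 hw.1
    obtain ⟨i, -, rfl⟩ := Finset.mem_image.1 hwS
    have hnode : ¬ M.IsNode (S.points i) := by
      intro h
      have : S.points i ∈ M.nodes := by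
        rw [TriMesh.nodes, Finset.mem_filter]
        refine ⟨?_, h⟩
        rw [Finset.mem_biUnion]
        exact ⟨S, hS, Finset.mem_image.2 ⟨i, Finset.mem_univ i, rfl⟩⟩
      have := hn _ this
      linarith [hw.2]
    obtain ⟨R, hR, hRc, hRv⟩ : ∃ R ∈ M.elems, S.points i ∈ carrier R ∧
        S.points i ∉ range R.points := by
      by_contra! h
      exact hnode ⟨⟨S, hS, mem_range_self i⟩, h⟩
    rcases M.vertex_mem S hS R hR i hRc with ⟨j, hj⟩ | ⟨j, k, hjk, hmid⟩
    · exact hRv ⟨j, hj.symm⟩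
    obtain ⟨A, hA⟩ := hv R hR
    have e1 : v (S.points i) = (v (R.points j) + v (R.points k)) / 2 := by
      rw [hA hRc, hmid, A.map_midpoint, hA (points_mem_carrier R j), hA (points_mem_carrier R k),
        midpoint_eq_smul_add, smul_eq_mul, invOf_eq_inv]
      ring
    -- Both endpoint values are at least the minimum and average to it, so both endpoints are
    -- minimisers and `hmax` bounds their norms. The parallelogram law then makes the midpoint
    -- strictly shorter than allowed.
    have hj := hmin _ (memV R hR j)
    have hk := hmin _ (memV R hR k)
    have nj := hmax (R.points j) (Finset.mem_filter.2 ⟨memV R hR j, by linarith [hw.2]⟩)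
    have nk := hmax (R.points k) (Finset.mem_filter.2 ⟨memV R hR k, by linarith [hw.2]⟩)
    have hpl := parallelogram_law_with_norm ℝ (R.points j) (R.points k)
    have hs : ‖R.points j + R.points k‖ = 2 * ‖S.points i‖ := by
      rw [hmid, midpoint_eq_smul_add, norm_smul, invOf_eq_inv]
      norm_num
      ring
    have hne : 0 < ‖R.points j - R.points k‖ := by
      rw [norm_pos_iff, sub_ne_zero]
      exact R.independent.injective.ne hjk
    have := norm_nonneg (R.points j)
    have := norm_nonneg (R.points k)
    rw [hs] at hpl
    nlinarith
  obtain ⟨A, hA⟩ := hv T hT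
  rw [hA hx, affine_eq_sum_bary T A x]
  refine Finset.sum_nonneg fun i _ => ?_
  rw [← hA (points_mem_carrier T i)]
  exact mul_nonneg ((mem_carrier_iff T).1 hx i) (hpos.trans (hmin _ (memV T hT i)))

theorem nodalBasis_nonneg {φ : Plane → Plane → ℝ} (hφ : M.IsNodalBasis φ) {q : Plane}
    (hq : q ∈ M.nodes) (hT : T ∈ M.elems) (hx : x ∈ carrier T) : 0 ≤ φ q x := by
  obtain ⟨h1, h2, h3⟩ := hφ q hq
  refine nonneg_of_nonneg_nodes h1.2 (fun r hr => ?_) hT hx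
  rcases eq_or_ne r q with rfl | hne
  · rw [h2]; exact zero_le_one
  · rw [h3 r hr hne]

/-- At hanging vertices the values are not prescribed, so the sum is compared with 1 by applying the
minimum principle to the difference with both signs. -/
theorem sum_nodalBasis {φ : Plane → Plane → ℝ} (hφ : M.IsNodalBasis φ)
    (hT : T ∈ M.elems) (hx : x ∈ carrier T) : ∑ q ∈ M.nodes, φ q x = 1 := by
  classical
  have haff : ∀ T ∈ M.elems, ∃ A : Plane →ᵃ[ℝ] ℝ,
      EqOn (fun x => ∑ q ∈ M.nodes, φ q x) A (carrier T) := by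
    intro T hT
    choose! A hA using fun q (hq : q ∈ M.nodes) => (hφ q hq).1.2 T hT
    refine ⟨∑ q ∈ M.nodes, A q, fun x hx => ?_⟩
    have : (∑ q ∈ M.nodes, A q) x = ∑ q ∈ M.nodes, A q x := by
      exact map_sum (AddMonoidHom.mk' (fun B : Plane →ᵃ[ℝ] ℝ => B x) fun _ _ => rfl) A M.nodes
    rw [this]
    exact Finset.sum_congr rfl fun q hq => hA q hq hx
  have hval : ∀ r ∈ M.nodes, ∑ q ∈ M.nodes, φ q r = 1 := by
    intro r hr
    rw [Finset.sum_eq_single_of_mem r hr, (hφ r hr).2.1]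
    intro q hq hne
    exact (hφ q hq).2.2 r hr hne.symm
  apply le_antisymm
  · have := nonneg_of_nonneg_nodes (M := M) (v := fun x => 1 - ∑ q ∈ M.nodes, φ q x) ?_ ?_ hT hx
    · linarith
    · intro T hT
      obtain ⟨A, hA⟩ := haff T hT
      refine ⟨AffineMap.const ℝ Plane 1 - A, fun x hx => ?_⟩
      simpa using hA hx
    · intro r hr
      rw [hval r hr, sub_self]
  · have := nonneg_of_nonneg_nodes (M := M) (v := fun x => (∑ q ∈ M.nodes, φ q x) - 1) ?_ ?_ hT hx
    · linarith
    · intro T hT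
      obtain ⟨A, hA⟩ := haff T hT
      refine ⟨A - AffineMap.const ℝ Plane 1, fun x hx => ?_⟩
      simpa using hA hx
    · intro r hr
      rw [hval r hr, sub_self]

/-- Only an inequality can hold: φ_p may be positive at a hanging vertex of the element.
Nonnegativity at the other vertices suffices. -/
theorem bary_le_nodalBasis {φ : Plane → Plane → ℝ} (hφ : M.IsNodalBasis φ)
    (hp : p ∈ M.nodes) (hT : T ∈ M.elems) {k : Fin 3} (hk : T.points k = p)
    (hx : x ∈ carrier T) : bary T k x ≤ φ p x := by
  obtain ⟨A, hA⟩ := (hφ p hp).1.2 T hT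
  rw [hA hx, affine_eq_sum_bary T A x, ← Finset.sum_erase_add _ _ (Finset.mem_univ k)]
  have h1 : A (T.points k) = 1 := by
    rw [← hA (points_mem_carrier T k), hk, (hφ p hp).2.1]
  rw [h1, smul_eq_mul, mul_one]
  refine le_add_of_nonneg_left (Finset.sum_nonneg fun i _ => ?_)
  rw [← hA (points_mem_carrier T i)]
  exact mul_nonneg ((mem_carrier_iff T).1 hx i)
    (nodalBasis_nonneg hφ hp hT (points_mem_carrier T i))

/-! ### Patches -/

theorem mem_star : T ∈ M.star p ↔ T ∈ M.elems ∧ p ∈ range T.points := by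
  simp [TriMesh.star]

theorem mem_nodes : p ∈ M.nodes ↔ M.IsNode p := by
  classical
  rw [TriMesh.nodes, Finset.mem_filter, and_iff_right_iff_imp]
  rintro ⟨⟨T, hT, i, rfl⟩, -⟩
  exact Finset.mem_biUnion.2 ⟨T, hT, Finset.mem_image_of_mem _ (Finset.mem_univ i)⟩

theorem mem_star_of_mem_carrier (hp : p ∈ M.nodes) (hT : T ∈ M.elems) (h : p ∈ carrier T) :
    T ∈ M.star p := mem_star.2 ⟨hT, (mem_nodes.1 hp).2 T hT h⟩

theorem star_nonempty (hp : p ∈ M.nodes) : (M.star p).Nonempty := by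
  obtain ⟨T, hT, h⟩ := (mem_nodes.1 hp).1
  exact ⟨T, mem_star.2 ⟨hT, h⟩⟩

theorem interior_subset_domain (hT : T ∈ M.elems) : interior (carrier T) ⊆ M.domain :=
  interior_mono (subset_biUnion_of_mem (u := fun T => carrier T) hT)

theorem interior_subset_patch (hT : T ∈ M.star p) : interior (carrier T) ⊆ M.patch p :=
  interior_mono (subset_biUnion_of_mem (u := fun T => carrier T) (show T ∈ M.star p from hT))

theorem patch_subset_domain : M.patch p ⊆ M.domain :=
  interior_mono (biUnion_subset_biUnion_left fun _ hT => (mem_star.1 hT).1)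

theorem isClosed_union (s : Finset (Affine.Triangle ℝ Plane)) :
    IsClosed (⋃ T ∈ s, carrier T) :=
  s.finite_toSet.isClosed_biUnion fun T _ => isClosed_carrier T

theorem isCompact_union (s : Finset (Affine.Triangle ℝ Plane)) :
    IsCompact (⋃ T ∈ s, carrier T) :=
  s.finite_toSet.isCompact_biUnion fun T _ => isCompact_carrier T

theorem closure_patch_subset : closure (M.patch p) ⊆ ⋃ T ∈ M.star p, carrier T :=
  closure_minimal interior_subset (isClosed_union _)

/-- The two sets differ only by points on the boundaries of triangles, which are null sets. -/
theorem ae_interior_union (s : Finset (Affine.Triangle ℝ Plane)) :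
    (interior (⋃ T ∈ s, carrier T) : Set Plane) =ᵐ[volume] ⋃ T ∈ s, interior (carrier T) := by
  have hsub : (⋃ T ∈ s, interior (carrier T)) ⊆ interior (⋃ T ∈ s, carrier T) :=
    iUnion₂_subset fun T hT =>
      interior_mono (subset_biUnion_of_mem (u := fun T => carrier T) (show T ∈ s from hT))
  have hnull : volume (⋃ T ∈ s, frontier (carrier T)) = 0 :=
    (measure_biUnion_null_iff s.countable_toSet).2 fun T _ => volume_frontier_carrier T
  refine Filter.EventuallyLE.antisymm ?_ hsub.eventuallyLE
  rw [ae_le_set]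
  refine measure_mono_null ?_ hnull
  rintro x ⟨hx, hx'⟩
  obtain ⟨T, hT, hxT⟩ := mem_iUnion₂.1 (interior_subset hx)
  refine mem_iUnion₂.2 ⟨T, hT, subset_closure hxT, fun h => hx' (mem_iUnion₂.2 ⟨T, hT, h⟩)⟩

theorem restrict_domain :
    volume.restrict M.domain = volume.restrict (⋃ T ∈ M.elems, interior (carrier T)) :=
  Measure.restrict_congr_set (ae_interior_union M.elems)

theorem restrict_patch : volume.restrict (M.patch p) = volume.restrict (M.openElems p) :=
  Measure.restrict_congr_set (ae_interior_union (M.star p))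

theorem isOpen_domain : IsOpen M.domain := isOpen_interior

theorem isOpen_patch : IsOpen (M.patch p) := isOpen_interior

theorem isBounded_patch : Bornology.IsBounded (M.patch p) :=
  (isCompact_union (M.star p)).isBounded.subset interior_subset

theorem diam_le_patchDiam (hT : T ∈ M.star p) :
    Metric.diam (carrier T) ≤ M.patchDiam p := by
  rw [TriMesh.patchDiam, ← closure_interior_carrier, Metric.diam_closure]
  exact Metric.diam_mono (interior_subset_patch hT) isBounded_patch

theorem patchDiam_pos (hp : p ∈ M.nodes) : 0 < M.patchDiam p := by
  obtain ⟨T, hT⟩ := star_nonempty hp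
  exact (diam_carrier_pos T).trans_le (diam_le_patchDiam hT)

/-- A packing argument. Shrink each element about p until its diameter is δ, that of the smallest
element. By convexity it stays inside itself, and the shrunken inscribed disc has radius δ / σ.
These discs are disjoint and lie in the disc of radius δ about p, so comparing areas gives the
count. -/
theorem card_star_le {σ : ℝ} (hσ : 0 < σ) (hM : M.ShapeRegular σ) :
    ((M.star p).card : ℝ) ≤ σ ^ 2 := by
  classical
  rcases (M.star p).eq_empty_or_nonempty with he | hne
  · rw [he]; simp; positivity
  obtain ⟨T₀, hT₀, hmin⟩ := (M.star p).exists_min_image (fun T => Metric.diam (carrier T)) hne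
  set δ := Metric.diam (carrier T₀)
  have hδ : 0 < δ := diam_carrier_pos T₀
  choose! c hc using hM
  set b : Affine.Triangle ℝ Plane → Set Plane := fun T =>
    Metric.ball (p + (δ / Metric.diam (carrier T)) • (c T - p)) (δ / σ)
  have hb : ∀ T ∈ M.star p, b T ⊆ carrier T ∩ Metric.closedBall p δ := by
    intro T hT x hx
    obtain ⟨hTM, k, hk⟩ := mem_star.1 hT
    have hd := diam_carrier_pos T
    set d := Metric.diam (carrier T)
    have hp : p ∈ carrier T := hk ▸ points_mem_carrier T k
    have hy : p + (d / δ) • (x - p) ∈ carrier T := by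
      apply hc T hTM
      rw [Metric.mem_ball, dist_eq_norm] at hx ⊢
      have e : p + (d / δ) • (x - p) - c T = (d / δ) • (x - (p + (δ / d) • (c T - p))) := by
        rw [← sub_sub, smul_sub (d / δ) (x - p), smul_smul]
        rw [show d / δ * (δ / d) = 1 by field_simp, one_smul]
        abel
      rw [e, norm_smul, Real.norm_of_nonneg (by positivity)]
      calc d / δ * ‖_‖ < d / δ * (δ / σ) := by gcongr
        _ = d / σ := by field_simp
    have hx2 : x = p + (δ / d) • ((p + (d / δ) • (x - p)) - p) := by
      rw [add_sub_cancel_left, smul_smul, show δ / d * (d / δ) = 1 by field_simp, one_smul]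
      abel
    have hle : δ / d ≤ 1 := (div_le_one hd).2 (hmin T hT)
    refine ⟨?_, ?_⟩
    · rw [hx2]
      exact (convex_carrier T).add_smul_sub_mem hp hy ⟨by positivity, hle⟩
    · rw [Metric.mem_closedBall, dist_eq_norm, hx2, add_sub_cancel_left, norm_smul,
        Real.norm_of_nonneg (by positivity), ← dist_eq_norm]
      calc δ / d * dist _ p ≤ δ / d * d := by gcongr; exact dist_le_diam_carrier T hy hp
        _ = δ := by field_simp
  have hdisj : (M.star p : Set (Affine.Triangle ℝ Plane)).PairwiseDisjoint b := by
    intro T hT R hR hTR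
    refine (M.disjoint_interior T (mem_star.1 hT).1 R (mem_star.1 hR).1 hTR).mono ?_ ?_
    · exact interior_maximal ((hb T hT).trans inter_subset_left) Metric.isOpen_ball
    · exact interior_maximal ((hb R hR).trans inter_subset_left) Metric.isOpen_ball
  have hvol : ∑ T ∈ M.star p, volume (b T) ≤ volume (Metric.closedBall p δ) := by
    rw [← measure_biUnion_finset hdisj fun T _ => Metric.isOpen_ball.measurableSet]
    exact measure_mono (iUnion₂_subset fun T hT => (hb T hT).trans inter_subset_right)
  have hball : ∀ T, volume (b T) = ENNReal.ofReal ((δ / σ) ^ 2 * Real.pi) := by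
    intro T
    rw [EuclideanSpace.volume_ball_fin_two, ENNReal.ofReal_mul (by positivity),
      ENNReal.ofReal_pow (by positivity)]
  have hcb : volume (Metric.closedBall p δ) = ENNReal.ofReal (δ ^ 2 * Real.pi) := by
    rw [EuclideanSpace.volume_closedBall_fin_two, ENNReal.ofReal_mul (by positivity),
      ENNReal.ofReal_pow (by positivity)]
  simp_rw [hball] at hvol
  rw [hcb, Finset.sum_const, nsmul_eq_mul, ← ENNReal.ofReal_natCast,
    ← ENNReal.ofReal_mul (by positivity), ENNReal.ofReal_le_ofReal_iff (by positivity)] at hvol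
  have hpi := Real.pi_pos
  have : ((M.star p).card : ℝ) * (1 / σ ^ 2) * (δ ^ 2 * Real.pi) ≤ 1 * (δ ^ 2 * Real.pi) := by
    calc _ = ((M.star p).card : ℝ) * ((δ / σ) ^ 2 * Real.pi) := by field_simp
      _ ≤ _ := by linarith
  have := le_of_mul_le_mul_right this (by positivity)
  rwa [mul_one_div, div_le_one (by positivity)] at this

end Mesh

/-! ### Points on sides -/

/-- `x` is a relatively interior point of the side of `T` opposite to the vertex with number `i`. -/
def OnSide (T : Affine.Triangle ℝ Plane) (i : Fin 3) (x : Plane) : Prop :=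
  bary T i x = 0 ∧ ∀ j, j ≠ i → 0 < bary T j x

section Sides

variable {M : TriMesh} {S T R : Affine.Triangle ℝ Plane} {p x y z : Plane} {i i' j k : Fin 3}

theorem OnSide.mem_carrier (h : OnSide T i z) : z ∈ carrier T :=
  (mem_carrier_iff T).2 fun j => by
    rcases eq_or_ne j i with rfl | hj
    · exact h.1.ge
    · exact (h.2 j hj).le

theorem OnSide.bary_eq_zero_iff (h : OnSide T i z) : bary T j z = 0 ↔ j = i := by
  refine ⟨fun hj => ?_, fun hj => hj ▸ h.1⟩
  by_contra hne
  exact (h.2 j hne).ne' hj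

theorem OnSide.mem_side_iff (h : OnSide T i z) : z ∈ side T j ↔ j = i := by
  rw [PhaseField.mem_side_iff, h.bary_eq_zero_iff, and_iff_right h.mem_carrier]

theorem exists_onSide (hx : x ∈ carrier T) (hi : x ∉ interior (carrier T))
    (hv : x ∉ range T.points) : ∃ i, OnSide T i x := by
  have hf : x ∈ frontier (carrier T) := by
    rw [(isClosed_carrier T).frontier_eq]; exact ⟨hx, hi⟩
  obtain ⟨i, h0⟩ := exists_bary_eq_zero_of_mem_frontier T hf
  refine ⟨i, h0, fun j hj => lt_of_le_of_ne ((mem_carrier_iff T).1 hx j) fun hj0 => hv ?_⟩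
  obtain ⟨k, hk1, hk2⟩ : ∃ k, i ≠ k ∧ j ≠ k := by
    revert i j; intro i _ j _ _; fin_cases i <;> fin_cases j <;> decide
  exact ⟨k, (eq_points_of_bary T hj.symm hk1 hk2 h0 hj0.symm).symm⟩

/-- Near a relatively interior point of a side the other two coordinates stay positive, so the
triangle looks like a half plane. -/
theorem OnSide.eventually_mem (h : OnSide T i z) :
    ∀ᶠ x in 𝓝 z, (x ∈ carrier T ↔ ⟪outerNormal T i, x - z⟫ ≤ 0) ∧
      (x ∈ interior (carrier T) ↔ ⟪outerNormal T i, x - z⟫ < 0) := by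
  have hpos : ∀ j, j ≠ i → ∀ᶠ x in 𝓝 z, 0 < bary T j x := fun j hj =>
    (continuous_affineMap (bary T j)).continuousAt.eventually_const_lt (h.2 j hj)
  have hall : ∀ᶠ x in 𝓝 z, ∀ j, j ≠ i → 0 < bary T j x :=
    eventually_all.2 fun j => by
      by_cases hj : j = i
      · exact Eventually.of_forall fun x hx => (hx hj).elim
      · exact (hpos j hj).mono fun x hx _ => hx
  filter_upwards [hall] with x hx
  have hh := T.height_pos i
  rw [inner_outerNormal_eq, h.1, sub_zero, mem_carrier_iff, mem_interior_iff]
  constructor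
  · rw [neg_nonpos, mul_nonneg_iff_of_pos_left hh]
    refine ⟨fun h => h i, fun h j => ?_⟩
    rcases eq_or_ne j i with rfl | hj
    exacts [h, (hx j hj).le]
  · rw [neg_lt_zero, mul_pos_iff_of_pos_left hh]
    refine ⟨fun h => h i, fun h j => ?_⟩
    rcases eq_or_ne j i with rfl | hj
    exacts [h, hx j hj]

/-- Unless the unit normals n and n' are opposite, the direction −(n + n') points strictly into both
half planes, and the two open elements would overlap. -/
theorem OnSide.outerNormal_eq_neg (hT : T ∈ M.elems) (hS : S ∈ M.elems) (hne : T ≠ S)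
    (h : OnSide T i z) (h' : OnSide S i' z) : outerNormal S i' = - outerNormal T i := by
  by_contra hcon
  set n := outerNormal T i
  set n' := outerNormal S i'
  have hn : ‖n‖ = 1 := norm_outerNormal T i
  have hn' : ‖n'‖ = 1 := norm_outerNormal S i'
  have hlt : -1 < ⟪n, n'⟫ := by
    have h1 : 0 < ‖n + n'‖ ^ 2 := by
      have : n + n' ≠ 0 := fun h0 => hcon (eq_neg_of_add_eq_zero_right h0)
      positivity
    rw [norm_add_sq_real, hn, hn'] at h1
    linarith
  have hlim : Tendsto (fun θ : ℝ => z + θ • (-(n + n'))) (𝓝[>] 0) (𝓝 z) := by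
    have : ContinuousAt (fun θ : ℝ => z + θ • (-(n + n'))) 0 := by fun_prop
    have h2 := this.tendsto
    simp only [zero_smul, add_zero] at h2
    exact h2.mono_left nhdsWithin_le_nhds
  obtain ⟨θ, ⟨hθ, hθ1, hθ2⟩⟩ := ((hlim.eventually h.eventually_mem).and
    ((hlim.eventually h'.eventually_mem).and self_mem_nhdsWithin)).exists
  have hθ0 : (0 : ℝ) < θ := hθ2
  have e1 : z + θ • (-(n + n')) ∈ interior (carrier T) := by
    rw [hθ.2, add_sub_cancel_left, inner_smul_right, inner_neg_right, inner_add_right,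
      real_inner_self_eq_norm_sq]
    rw [hn]
    nlinarith
  have e2 : z + θ • (-(n + n')) ∈ interior (carrier S) := by
    rw [hθ1.2, add_sub_cancel_left, inner_smul_right, inner_neg_right, inner_add_right,
      real_inner_self_eq_norm_sq, real_inner_comm]
    rw [hn']
    nlinarith
  exact Set.disjoint_left.1 (M.disjoint_interior T hT S hS hne) e1 e2

/-- Near a relatively interior point of a common side there are only the two elements. -/
theorem OnSide.eventually_mem_or (hT : T ∈ M.elems) (hS : S ∈ M.elems) (hne : T ≠ S)
    (h : OnSide T i z) (h' : OnSide S i' z) :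
    ∀ᶠ x in 𝓝 z, x ∈ carrier T ∨ x ∈ carrier S := by
  filter_upwards [h.eventually_mem, h'.eventually_mem] with x hx hx'
  rw [hx.1, hx'.1, h.outerNormal_eq_neg hT hS hne h', inner_neg_left, neg_nonpos]
  exact le_total _ _

/-- An element containing z has interior points arbitrarily close to z. Those lie in an element of s
as well, and distinct elements do not overlap. -/
theorem eq_or_eq_of_eventually {s : Finset (Affine.Triangle ℝ Plane)} (hs : s ⊆ M.elems)
    (hz : ∀ᶠ x in 𝓝 z, ∃ T ∈ s, x ∈ carrier T) (hR : R ∈ M.elems)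
    (hzR : z ∈ carrier R) : R ∈ s := by
  rw [← closure_interior_carrier, mem_closure_iff_frequently] at hzR
  obtain ⟨x, hx, T, hT, hxT⟩ := (hzR.and_eventually hz).exists
  by_contra hcon
  exact notMem_of_mem_interior (hs hT) hR (fun h => hcon (h ▸ hT)) hx hxT

theorem OnSide.eq_or_eq (hT : T ∈ M.elems) (hS : S ∈ M.elems) (hne : T ≠ S)
    (h : OnSide T i z) (h' : OnSide S i' z) (hR : R ∈ M.elems) (hzR : z ∈ carrier R) :
    R = T ∨ R = S := by
  classical
  have := eq_or_eq_of_eventually (M := M) (s := {T, S}) (by simp [Finset.insert_subset_iff, hT, hS])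
    ((h.eventually_mem_or hT hS hne h').mono fun x hx => by simpa using hx) hR hzR
  simpa using this

theorem OnSide.mem_domain (hT : T ∈ M.elems) (hS : S ∈ M.elems) (hne : T ≠ S)
    (h : OnSide T i z) (h' : OnSide S i' z) : z ∈ M.domain := by
  rw [TriMesh.domain, mem_interior_iff_mem_nhds]
  filter_upwards [h.eventually_mem_or hT hS hne h'] with x hx
  rcases hx with hx | hx
  exacts [mem_iUnion₂.2 ⟨T, hT, hx⟩, mem_iUnion₂.2 ⟨S, hS, hx⟩]

theorem OnSide.notMem_vertices (hT : T ∈ M.elems) (h : OnSide T i z)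
    (hmid : ∀ j k, j ≠ k → z ≠ midpoint ℝ (T.points j) (T.points k)) (hS : S ∈ M.elems) :
    z ∉ range S.points := by
  rintro ⟨l, rfl⟩
  rcases M.vertex_mem S hS T hT l h.mem_carrier with ⟨j, hj⟩ | ⟨j, k, hjk, hm⟩
  · obtain ⟨m, hm1, hm2⟩ : ∃ m, m ≠ i ∧ m ≠ j := by
      fin_cases i <;> fin_cases j <;> decide
    have := h.2 m hm1
    rw [hj, bary_ne T hm2] at this
    exact lt_irrefl _ this
  · exact hmid j k hjk hm

theorem OnSide.notMem_interior (hT : T ∈ M.elems) (h : OnSide T i z) (hS : S ∈ M.elems) :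
    z ∉ interior (carrier S) := by
  intro hz
  rcases eq_or_ne T S with rfl | hne
  · exact ((mem_interior_iff T).1 hz i).ne' h.1
  · exact notMem_of_mem_interior hT hS hne hz h.mem_carrier

/-! ### Fluxes through sides -/

open Classical in
theorem OnSide.sum_flux (h : OnSide T i z) {v : Plane → ℝ} {A : Plane →ᵃ[ℝ] ℝ}
    (hA : EqOn v A (carrier T)) :
    (∑ m : Fin 3, if z ∈ side T m then ⟪gradientWithin v (carrier T) z, outerNormal T m⟫ else 0) =
      ⟪affGrad A, outerNormal T i⟫ := by
  simp_rw [h.mem_side_iff, gradientWithin_carrier T hA h.mem_carrier]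
  simp

open Classical in
theorem sum_flux_of_notMem (h : z ∉ carrier T) (v : Plane → ℝ) :
    (∑ m : Fin 3, if z ∈ side T m then ⟪gradientWithin v (carrier T) z, outerNormal T m⟫ else 0) =
      0 :=
  Finset.sum_eq_zero fun _ _ => if_neg fun hm => h ((mem_side_iff T).1 hm).1

theorem OnSide.normalFlux_eq (hT : T ∈ M.elems) (hS : S ∈ M.elems) (hne : T ≠ S)
    (h : OnSide T i z) (h' : OnSide S i' z) {v : Plane → ℝ} {A B : Plane →ᵃ[ℝ] ℝ}
    (hA : EqOn v A (carrier T)) (hB : EqOn v B (carrier S)) :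
    M.normalFlux v z = ⟪affGrad A, outerNormal T i⟫ - ⟪affGrad B, outerNormal T i⟫ := by
  classical
  have e : M.normalFlux v z = ⟪affGrad A, outerNormal T i⟫ + ⟪affGrad B, outerNormal S i'⟫ := by
    rw [← h.sum_flux hA, ← h'.sum_flux hB, TriMesh.normalFlux]
    convert! Finset.sum_eq_add_of_mem T S hT hS hne ?_
    intro R hR hRTS
    convert! sum_flux_of_notMem ?_ v
    intro hz
    rcases h.eq_or_eq hT hS hne h' hR hz with rfl | rfl
    exacts [hRTS.1 rfl, hRTS.2 rfl]
  rw [e, h.outerNormal_eq_neg hT hS hne h', inner_neg_right, sub_eq_add_neg]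

theorem OnSide.normalFlux_eq_of_notMem (hT : T ∈ M.elems) (h : OnSide T i z)
    (hz : ∀ S ∈ M.elems, S ≠ T → z ∉ carrier S) {v : Plane → ℝ} {A : Plane →ᵃ[ℝ] ℝ}
    (hA : EqOn v A (carrier T)) : M.normalFlux v z = ⟪affGrad A, outerNormal T i⟫ := by
  classical
  rw [← h.sum_flux hA, TriMesh.normalFlux]
  convert! Finset.sum_eq_single_of_mem T hT ?_
  intro R hR hne
  convert! sum_flux_of_notMem (hz R hR hne) v

/-! ### Boundary sides -/

/-- Every point of the domain on the side of an element belongs to another element. -/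
theorem exists_ne_of_mem_interior_union {s : Finset (Affine.Triangle ℝ Plane)}
    (hz : z ∈ interior (⋃ T ∈ s, carrier T)) (hT : z ∉ interior (carrier T)) :
    ∃ S ∈ s, S ≠ T ∧ z ∈ carrier S := by
  classical
  by_contra! hcon
  apply hT
  have hc : IsClosed (⋃ S ∈ s.erase T, carrier S) := isClosed_union _
  have hzc : z ∉ ⋃ S ∈ s.erase T, carrier S := by
    intro h
    obtain ⟨S, hS, hzS⟩ := mem_iUnion₂.1 h
    rw [Finset.mem_erase] at hS
    exact hcon S hS.2 hS.1 hzS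
  rw [mem_interior_iff_mem_nhds] at hz ⊢
  filter_upwards [hz, hc.isOpen_compl.mem_nhds hzc] with x hx hx'
  obtain ⟨S, hS, hxS⟩ := mem_iUnion₂.1 hx
  rcases eq_or_ne S T with rfl | hne
  · exact hxS
  · exact (hx' (mem_iUnion₂.2 ⟨S, Finset.mem_erase.2 ⟨hne, hS⟩, hxS⟩)).elim

/-- The point z is not a vertex of any element: by the rule for hanging nodes, a vertex in the
relative interior of a side is its midpoint. So the element on the other side meets z in the
relative interior of one of its own sides. -/
theorem OnSide.exists_onSide_of_mem_interior {s : Finset (Affine.Triangle ℝ Plane)}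
    (hs : s ⊆ M.elems) (hT : T ∈ M.elems) (h : OnSide T i z)
    (hmid : ∀ j k, j ≠ k → z ≠ midpoint ℝ (T.points j) (T.points k))
    (hz : z ∈ interior (⋃ T ∈ s, carrier T)) : ∃ S ∈ s, S ≠ T ∧ ∃ i', OnSide S i' z := by
  obtain ⟨S, hS, hne, hzS⟩ := exists_ne_of_mem_interior_union hz (h.notMem_interior hT hT)
  obtain ⟨i', hi'⟩ := exists_onSide hzS (h.notMem_interior hT (hs hS))
    (h.notMem_vertices hT hmid (hs hS))
  exact ⟨S, hS, hne, i', hi'⟩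

theorem bary_lineMap (T : Affine.Triangle ℝ Plane) (i : Fin 3) (x y : Plane) (θ : ℝ) :
    bary T i (AffineMap.lineMap x y θ) = bary T i x + θ * (bary T i y - bary T i x) := by
  rw [AffineMap.apply_lineMap, AffineMap.lineMap_apply]
  simp [add_comm]

theorem lt_lineMap {c u v θ : ℝ} (hu : c < u) (hv : c < v) (hθ : θ ∈ Icc (0 : ℝ) 1) :
    c < u + θ * (v - u) := by
  rcases le_total u v with h | h
  · nlinarith [mul_nonneg hθ.1 (sub_nonneg.2 h)]
  · nlinarith [mul_nonneg (sub_nonneg.2 hθ.2) (sub_nonneg.2 h)]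

/-- The coordinates of vertices and side midpoints are 0, 1/2 or 1. Restricting to the half of a
side where one coordinate exceeds 1/2 therefore avoids the possible hanging node. -/
theorem ne_midpoint_of_half_lt (ha : 1 / 2 < bary T j x) (h1 : bary T j x ≠ 1) (k l : Fin 3) :
    x ≠ midpoint ℝ (T.points k) (T.points l) := by
  rintro rfl
  rw [AffineMap.map_midpoint, midpoint_eq_smul_add, bary_points, bary_points, smul_eq_mul,
    invOf_eq_inv] at ha h1
  split_ifs at ha h1
  · norm_num at h1
  all_goals norm_num at ha

theorem OnSide.bary_ne_one (h : OnSide T i x) (a : Fin 3) : bary T a x ≠ 1 := by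
  intro h1
  obtain ⟨m, hm1, hm2⟩ : ∃ m, m ≠ i ∧ m ≠ a := by fin_cases i <;> fin_cases a <;> decide
  have hs := sum_bary T x
  have hm := h.2 m hm1
  have hc := (mem_carrier_iff T).1 h.mem_carrier
  have : bary T a x + bary T m x ≤ 1 := by
    rw [← hs, ← Finset.sum_pair (f := fun l => bary T l x) hm2.symm]
    exact Finset.sum_le_sum_of_subset_of_nonneg (Finset.subset_univ _) fun j _ _ => hc j
  linarith

/-- A half of a side that carries one point of the domain consists of points of the domain. -/
theorem OnSide.mem_domain_of_half (hT : T ∈ M.elems) (hx : OnSide T i x) (hy : OnSide T i y)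
    {a : Fin 3} (hax : 1 / 2 < bary T a x) (hay : 1 / 2 < bary T a y) (hyΩ : y ∈ M.domain) :
    x ∈ M.domain := by
  have hmid : ∀ w, OnSide T i w → 1 / 2 < bary T a w →
      ∀ k l, k ≠ l → w ≠ midpoint ℝ (T.points k) (T.points l) := fun w hw haw k l _ =>
    ne_midpoint_of_half_lt haw (hw.bary_ne_one a) k l
  obtain ⟨S, hS, hne, i', hi'⟩ := hy.exists_onSide_of_mem_interior subset_rfl hT (hmid y hy hay) hyΩ
  refine hx.mem_domain hT hS hne.symm (i' := i') ⟨?_, ?_⟩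
  · have h1 := inner_outerNormal_eq S i' x y
    rw [hy.outerNormal_eq_neg hT hS hne.symm hi', inner_neg_left, inner_outerNormal_eq, hx.1, hy.1,
      hi'.1, sub_zero, sub_zero, mul_zero, neg_zero, neg_zero, eq_comm, neg_eq_zero, mul_eq_zero] at h1
    exact h1.resolve_left (S.height_pos i').ne'
  · have hseg : ∀ θ ∈ Icc (0 : ℝ) 1, OnSide T i (AffineMap.lineMap y x θ) ∧
        1 / 2 < bary T a (AffineMap.lineMap y x θ) := by
      intro θ hθ
      refine ⟨⟨?_, fun j hj => ?_⟩, ?_⟩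
      · rw [bary_lineMap, hx.1, hy.1]; simp
      · rw [bary_lineMap]
        exact lt_lineMap (hy.2 j hj) (hx.2 j hj) hθ
      · rw [bary_lineMap]
        exact lt_lineMap hay hax hθ
    intro j hj
    by_contra! hneg
    have hyj := hi'.2 j hj
    -- If x were beyond the end of the side of S, the segment from y to x would pass, at this
    -- parameter, through a vertex of S. The whole segment lies in one open half of the side of T,
    -- where no vertices occur.
    set θ := bary S j y / (bary S j y - bary S j x)
    have hd : 0 < bary S j y - bary S j x := by linarith
    have hθ : θ ∈ Icc (0 : ℝ) 1 := ⟨by positivity, (div_le_one hd).2 (by linarith)⟩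
    obtain ⟨hw, haw⟩ := hseg θ hθ
    set w : Plane := AffineMap.lineMap y x θ
    have hjw : bary S j w = 0 := by
      rw [bary_lineMap]
      have : θ * (bary S j y - bary S j x) = bary S j y := div_mul_cancel₀ _ hd.ne'
      linarith
    have hiw : bary S i' w = 0 := by
      have h1 := inner_outerNormal_eq S i' w y
      rw [hy.outerNormal_eq_neg hT hS hne.symm hi', inner_neg_left, inner_outerNormal_eq, hw.1,
        hy.1, hi'.1, sub_zero, sub_zero, mul_zero, neg_zero, neg_zero, eq_comm, neg_eq_zero,
        mul_eq_zero] at h1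
      exact h1.resolve_left (S.height_pos i').ne'
    obtain ⟨m, hm1, hm2⟩ : ∃ m, i' ≠ m ∧ j ≠ m := by fin_cases i' <;> fin_cases j <;> decide
    exact hw.notMem_vertices hT (hmid w hw haw) hS
      ⟨m, (eq_points_of_bary S hj.symm hm1 hm2 hiw hjw).symm⟩

/-! ### Elements sharing a node -/

/-- If y were on neither side of T issuing from p, the midpoint of p and y would be interior to T;
yet by convexity it belongs to S. So y lies on such a side, away from p. -/
theorem exists_radial (hTM : T ∈ M.elems) (hS : S ∈ M.elems) (hne : T ≠ S) (hk : T.points k = p)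
    (hpS : p ∈ carrier S) (hyp : y ≠ p) (hyT : y ∈ carrier T) (hyS : y ∈ carrier S) :
    ∃ i j, i ≠ k ∧ i ≠ j ∧ j ≠ k ∧ bary T i y = 0 ∧ 0 < bary T j y ∧
      y - p = bary T j y • (T.points j - p) := by
  have hc := (mem_carrier_iff T).1 hyT
  obtain ⟨i, hik, hi⟩ : ∃ i, i ≠ k ∧ bary T i y = 0 := by
    by_contra! hcon
    have hm : midpoint ℝ p y ∈ interior (carrier T) := by
      rw [mem_interior_iff]
      intro i
      rw [AffineMap.map_midpoint, midpoint_eq_smul_add, smul_eq_mul, invOf_eq_inv, ← hk]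
      rcases eq_or_ne i k with rfl | hik
      · rw [bary_self]
        have := hc i
        positivity
      · rw [bary_ne T hik]
        have := (hc i).lt_of_ne (hcon i hik).symm
        positivity
    exact notMem_of_mem_interior hS hTM hne.symm hm
      ((convex_carrier S).midpoint_mem hpS hyS)
  obtain ⟨j, hij, hjk⟩ : ∃ j, i ≠ j ∧ j ≠ k := by fin_cases i <;> fin_cases k <;> decide
  refine ⟨i, j, hik, hij, hjk, hi, (hc j).lt_of_ne fun h0 => hyp ?_, ?_⟩
  · rw [← hk]
    exact eq_points_of_bary T hij hik hjk hi h0.symm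
  · have h1 := sum_bary_smul T y
    have h2 := sum_bary T y
    have e : ∀ f : Fin 3 → ℝ, ∑ l, f l = f i + f j + f k := by
      intro f; rw [Fin.sum_univ_three]
      fin_cases i <;> fin_cases j <;> fin_cases k <;> simp_all <;> ring
    have e' : ∀ f : Fin 3 → Plane, ∑ l, f l = f i + f j + f k := by
      intro f; rw [Fin.sum_univ_three]
      fin_cases i <;> fin_cases j <;> fin_cases k <;> simp_all <;> abel
    rw [e', hi, zero_smul, zero_add, hk] at h1
    rw [e, hi, zero_add] at h2
    have hk' : bary T k y = 1 - bary T j y := by linarith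
    rw [hk'] at h1
    nth_rw 1 [← h1]
    module

/-- Two elements that share a side issuing from `p`: their sides agree, or one is half of the
other. -/
theorem exists_radial_pair (hT : T ∈ M.elems) (hS : S ∈ M.elems) (hne : T ≠ S) {k k' : Fin 3}
    (hk : T.points k = p) (hk' : S.points k' = p) (hyp : y ≠ p) (hyT : y ∈ carrier T)
    (hyS : y ∈ carrier S) :
    ∃ i j i' j', i ≠ k ∧ i ≠ j ∧ j ≠ k ∧ i' ≠ k' ∧ i' ≠ j' ∧ j' ≠ k' ∧
      bary T i y = 0 ∧ bary S i' y = 0 ∧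
      ∃ s : ℝ, (s = 1 / 2 ∨ s = 1 ∨ s = 2) ∧ T.points j - p = s • (S.points j' - p) := by
  have hpT : p ∈ carrier T := hk ▸ points_mem_carrier T k
  have hpS : p ∈ carrier S := hk' ▸ points_mem_carrier S k'
  obtain ⟨i, j, hik, hij, hjk, hi, hj, hy⟩ := exists_radial hT hS hne hk hpS hyp hyT hyS
  obtain ⟨i', j', hik', hij', hjk', hi', hj', hy'⟩ :=
    exists_radial hS hT hne.symm hk' hpT hyp hyS hyT
  refine ⟨i, j, i', j', hik, hij, hjk, hik', hij', hjk', hi, hi', ?_⟩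
  -- The end of the shorter side lies on the longer side of the other element, hence is an end or
  -- the midpoint of it. This is where the restriction to one hanging node per side enters.
  have key : ∀ (T S : Affine.Triangle ℝ Plane) (j k j' k' : Fin 3), T ∈ M.elems → S ∈ M.elems →
      S.points k' = p → T.points k = p → j ≠ k → j' ≠ k' → ∀ s : ℝ, 0 < s → s ≤ 1 →
      T.points j - p = s • (S.points j' - p) → s = 1 ∨ s = 1 / 2 := by
    intro T S j k j' k' hT hS hk' hk hjk hjk' s hs0 hs1 hs
    have hl : T.points j = AffineMap.lineMap p (S.points j') s := by
      rw [AffineMap.lineMap_apply, vsub_eq_sub, vadd_eq_add, ← hs, sub_add_cancel]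
    have hb : ∀ m, bary S m (T.points j) =
        (if m = k' then 1 else 0) + s * ((if m = j' then 1 else 0) - if m = k' then 1 else 0) := by
      intro m
      rw [hl, bary_lineMap, ← hk', bary_points, bary_points]
    have hmem : T.points j ∈ carrier S := by
      rw [mem_carrier_iff]
      intro m
      rw [hb]
      split_ifs <;> linarith
    rcases M.vertex_mem T hT S hS j hmem with ⟨l, hl⟩ | ⟨l, m, hlm, hmid⟩
    · left
      have h1 := hb j'
      rw [if_pos rfl, if_neg hjk', hl, bary_points] at h1
      split_ifs at h1 <;> linarith
    · have h1 := hb j'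
      rw [if_pos rfl, if_neg hjk', hmid, AffineMap.map_midpoint, midpoint_eq_smul_add, bary_points,
        bary_points, smul_eq_mul, invOf_eq_inv] at h1
      split_ifs at h1 with h2 h3 h3
      · exact (hlm (h2 ▸ h3 ▸ rfl)).elim
      · right; linarith
      · right; linarith
      · norm_num at h1
        linarith
  set t := bary T j y
  set t' := bary S j' y
  have hr : T.points j - p = (t' / t) • (S.points j' - p) := by
    rw [div_eq_inv_mul, mul_smul, ← hy', hy, smul_smul, inv_mul_cancel₀ hj.ne', one_smul]
  have hr' : S.points j' - p = (t / t') • (T.points j - p) := by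
    rw [div_eq_inv_mul, mul_smul, ← hy, hy', smul_smul, inv_mul_cancel₀ hj'.ne', one_smul]
  refine ⟨t' / t, ?_, hr⟩
  rcases le_total t' t with hle | hle
  · rcases key T S j k j' k' hT hS hk' hk hjk hjk' (t' / t) (by positivity)
      ((div_le_one hj).2 hle) hr with h | h <;> simp [h]
  · rcases key S T j' k' j k hS hT hk hk' hjk' hjk (t / t') (by positivity)
      ((div_le_one hj').2 hle) hr' with h | h
    · right; left
      rw [← inv_div, h, inv_one]
    · right; right
      rw [← inv_div, h]; norm_num

/-- The sides of the two elements issuing from p along the common segment have length ratio 1/2, 1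
or 2, and by shape regularity a side is at least 2 / σ times the diameter of its element. -/
theorem diam_le_of_common {σ : ℝ} (hσ : 0 < σ) (hM : M.ShapeRegular σ) (hT : T ∈ M.star p)
    (hS : S ∈ M.star p) (hyp : y ≠ p) (hyT : y ∈ carrier T) (hyS : y ∈ carrier S) :
    Metric.diam (carrier S) ≤ σ * Metric.diam (carrier T) := by
  obtain ⟨hTM, k, hk⟩ := mem_star.1 hT
  obtain ⟨hSM, k', hk'⟩ := mem_star.1 hS
  have h2 := two_le_of_shapeRegular T hσ (hM T hTM)
  have hd := diam_carrier_pos T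
  rcases eq_or_ne T S with rfl | hne
  · nlinarith
  obtain ⟨i, j, i', j', -, -, -, -, -, hjk', -, -, s, hs, hr⟩ :=
    exists_radial_pair hTM hSM hne hk hk' hyp hyT hyS
  have h3 := diam_le_mul_dist_points S hσ (hM S hSM) hjk'
  have h4 := dist_le_diam_carrier T (points_mem_carrier T j) (points_mem_carrier T k)
  rw [hk, dist_eq_norm, hr, norm_smul] at h4
  rw [hk', dist_eq_norm] at h3
  have hs2 : 1 / 2 ≤ ‖s‖ := by rcases hs with rfl | rfl | rfl <;> norm_num
  have hnn := norm_nonneg (S.points j' - p)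
  have : 1 / 2 * ‖S.points j' - p‖ ≤ Metric.diam (carrier T) :=
    (mul_le_mul_of_nonneg_right hs2 hnn).trans h4
  nlinarith

/-- Let F n collect the elements of the star with diameter at most σⁿ diam T. A neighbour along a
chain loses at most one factor σ, so if F n = F (n + 1), this set is closed under passing to
neighbours and is the whole star. Until then F n grows strictly, which can happen at most as often
as there are elements. -/
theorem diam_le_pow_card {σ : ℝ} (hσ : 0 < σ) (hM : M.ShapeRegular σ) (hp : p ∈ M.nodes)
    (hT : T ∈ M.star p) (hS : S ∈ M.star p) :
    Metric.diam (carrier S) ≤ σ ^ (M.star p).card * Metric.diam (carrier T) := by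
  classical
  have h2 := two_le_of_shapeRegular T hσ (hM T (mem_star.1 hT).1)
  have hd := diam_carrier_pos T
  set d := Metric.diam (carrier T)
  set F : ℕ → Finset (Affine.Triangle ℝ Plane) := fun n =>
    (M.star p).filter fun R => Metric.diam (carrier R) ≤ σ ^ n * d with hF
  have hmono : ∀ n, F n ⊆ F (n + 1) := by
    intro n R hR
    rw [hF, Finset.mem_filter] at hR ⊢
    refine ⟨hR.1, hR.2.trans ?_⟩
    gcongr <;> [linarith; omega]
  have hclosed : ∀ n, F n = F (n + 1) → F n = M.star p := by
    intro n hn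
    refine Finset.Subset.antisymm (Finset.filter_subset _ _) fun R hR => ?_
    have hpT : p ∈ carrier T := by
      obtain ⟨-, k, hk⟩ := mem_star.1 hT
      exact hk ▸ points_mem_carrier T k
    have hpR : p ∈ carrier R := by
      obtain ⟨-, k, hk⟩ := mem_star.1 hR
      exact hk ▸ points_mem_carrier R k
    have hch := M.chain p T (mem_star.1 hT).1 R (mem_star.1 hR).1 hpT hpR
    clear hR hpR
    induction hch with
    | refl =>
      rw [hF, Finset.mem_filter]
      refine ⟨hT, ?_⟩
      nlinarith [one_le_pow₀ (by linarith : 1 ≤ σ) (n := n)]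
    | tail _ hbc ih =>
      obtain ⟨hc, hpc, y, hy, hy1, hy2⟩ := hbc
      rw [hn, hF, Finset.mem_filter]
      rw [hF, Finset.mem_filter] at ih
      have hcs := mem_star_of_mem_carrier hp hc hpc
      refine ⟨hcs, (diam_le_of_common hσ hM ih.1 hcs hy hy1 hy2).trans ?_⟩
      rw [pow_succ]
      nlinarith [ih.2]
  have hcard : ∀ n, n + 1 ≤ (F n).card ∨ F n = M.star p := by
    intro n
    induction n with
    | zero =>
      left
      rw [Nat.zero_add, Finset.one_le_card]
      exact ⟨T, Finset.mem_filter.2 ⟨hT, by simp [d]⟩⟩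
    | succ n ih =>
      by_cases h : F n = F (n + 1)
      · right; rw [← h]; exact hclosed n h
      · rcases ih with ih | ih
        · left
          exact lt_of_le_of_lt ih (Finset.card_lt_card ((hmono n).ssubset_of_ne h))
        · exact (h (Finset.Subset.antisymm (hmono n)
            (by rw [ih]; exact Finset.filter_subset _ _))).elim
  rcases hcard (M.star p).card with h | h
  · have := Finset.card_le_card (Finset.filter_subset
      (fun R => Metric.diam (carrier R) ≤ σ ^ (M.star p).card * d) (M.star p))
    exact absurd (h.trans this) (by omega)
  · have hSF : S ∈ F (M.star p).card := by rw [h]; exact hS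
    exact (Finset.mem_filter.1 hSF).2

/-- The ratio of the diameters of a patch and of its elements is at most this. -/
def patchRatio (σ : ℝ) : ℝ := 2 * σ ^ ⌈σ ^ 2⌉₊

theorem patchDiam_le {σ : ℝ} (hσ : 0 < σ) (hM : M.ShapeRegular σ) (hp : p ∈ M.nodes)
    (hT : T ∈ M.star p) : M.patchDiam p ≤ patchRatio σ * Metric.diam (carrier T) := by
  have h2 := two_le_of_shapeRegular T hσ (hM T (mem_star.1 hT).1)
  have hd := diam_carrier_pos T
  have hcard : (M.star p).card ≤ ⌈σ ^ 2⌉₊ :=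
    Nat.cast_le.1 ((card_star_le hσ hM).trans (Nat.le_ceil _))
  have hx : ∀ x ∈ M.patch p, dist x p ≤ σ ^ ⌈σ ^ 2⌉₊ * Metric.diam (carrier T) := by
    intro x hx
    obtain ⟨S, hS, hxS⟩ := mem_iUnion₂.1 (interior_subset hx)
    obtain ⟨-, k, hk⟩ := mem_star.1 hS
    refine (dist_le_diam_carrier S hxS (hk ▸ points_mem_carrier S k)).trans
      ((diam_le_pow_card hσ hM hp hT hS).trans ?_)
    gcongr
    linarith
  rw [TriMesh.patchDiam]
  refine Metric.diam_le_of_forall_dist_le (by rw [patchRatio]; positivity) fun x hx' y hy' => ?_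
  have h3 := dist_triangle_right x y p
  have := hx x hx'
  have := hx y hy'
  rw [patchRatio]
  linarith

end Sides

/-! ### Cut-off functions on the line -/

/-- A smooth bump function on the line: one on `[-1/2, 1/2]` and zero outside `[-1, 1]`. -/
def lineBump : ContDiffBump (0 : ℝ) where
  rIn := 1 / 2
  rOut := 1
  rIn_pos := by norm_num
  rIn_lt_rOut := by norm_num

/-- The bump function scaled to the interval `[-r, r]`. -/
def cut (r a : ℝ) : ℝ := lineBump (a / r)

theorem exists_slope_bound : ∃ A : ℝ, 1 ≤ A ∧ ∀ a, |deriv lineBump a| ≤ A := by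
  have hc : Continuous (deriv lineBump) :=
    (lineBump.contDiff (n := 1)).continuous_deriv le_rfl
  have hs : HasCompactSupport (deriv lineBump) := lineBump.hasCompactSupport.deriv
  obtain ⟨A, hA⟩ := hc.bounded_above_of_compact_support hs
  exact ⟨max A 1, le_max_right _ _, fun a => (hA a).trans (le_max_left _ _)⟩

/-- A bound for the slope of the bump function. -/
def bumpSlope : ℝ := exists_slope_bound.choose

theorem one_le_bumpSlope : 1 ≤ bumpSlope := exists_slope_bound.choose_spec.1

theorem abs_deriv_lineBump_le (a : ℝ) : |deriv lineBump a| ≤ bumpSlope :=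
  exists_slope_bound.choose_spec.2 a

section Cut

variable {r : ℝ}

theorem cut_nonneg (r a : ℝ) : 0 ≤ cut r a := lineBump.nonneg

theorem cut_le_one (r a : ℝ) : cut r a ≤ 1 := lineBump.le_one

theorem cut_zero (r : ℝ) : cut r 0 = 1 := by
  rw [cut, zero_div]
  exact lineBump.one_of_mem_closedBall (by simp [lineBump])

theorem contDiff_cut (r : ℝ) : ContDiff ℝ ∞ (cut r) :=
  lineBump.contDiff.comp (contDiff_id.div_const r)

theorem cut_eq_zero (hr : 0 < r) {a : ℝ} (ha : r ≤ |a|) : cut r a = 0 := by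
  apply lineBump.zero_of_le_dist
  rw [dist_zero_right, Real.norm_eq_abs, abs_div, abs_of_pos hr]
  exact (one_le_div hr).2 ha

theorem hasCompactSupport_cut (hr : 0 < r) : HasCompactSupport (cut r) :=
  HasCompactSupport.intro (isCompact_Icc (a := -r) (b := r)) fun a ha =>
    cut_eq_zero hr (by
      by_contra! h
      exact ha ⟨(abs_lt.1 h).1.le, (abs_lt.1 h).2.le⟩)

theorem hasDerivAt_cut (r a : ℝ) : HasDerivAt (cut r) (deriv (cut r) a) a :=
  ((contDiff_cut r).differentiable (by simp)).differentiableAt.hasDerivAt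

theorem deriv_cut (r a : ℝ) : deriv (cut r) a = deriv lineBump (a / r) / r := by
  have h1 : HasDerivAt lineBump (deriv lineBump (a / r)) (a / r) :=
    ((lineBump.contDiff (n := 1)).differentiable (by simp)).differentiableAt.hasDerivAt
  have h2 := h1.comp a ((hasDerivAt_id a).div_const r)
  rw [mul_one_div] at h2
  exact h2.deriv

theorem abs_deriv_cut_le (hr : 0 < r) (a : ℝ) : |deriv (cut r) a| ≤ bumpSlope / r := by
  rw [deriv_cut, abs_div, abs_of_pos hr]
  gcongr
  exact abs_deriv_lineBump_le _

theorem integrable_cut (hr : 0 < r) : Integrable (cut r) :=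
  (contDiff_cut r).continuous.integrable_of_hasCompactSupport (hasCompactSupport_cut hr)

theorem continuous_deriv_cut (r : ℝ) : Continuous (deriv (cut r)) :=
  (contDiff_cut r).continuous_deriv (by simp)

theorem integrable_deriv_cut (hr : 0 < r) : Integrable (deriv (cut r)) :=
  (continuous_deriv_cut r).integrable_of_hasCompactSupport (hasCompactSupport_cut hr).deriv

theorem integral_Iio_deriv_cut (hr : 0 < r) : ∫ a in Iio (0 : ℝ), deriv (cut r) a = 1 := by
  rw [← integral_Iic_eq_integral_Iio, (hasCompactSupport_cut hr).integral_Iic_deriv_eq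
    ((contDiff_cut r).of_le (by simp)), cut_zero]

theorem integral_Ioi_deriv_cut (hr : 0 < r) : ∫ a in Ioi (0 : ℝ), deriv (cut r) a = -1 := by
  rw [(hasCompactSupport_cut hr).integral_Ioi_deriv_eq ((contDiff_cut r).of_le (by simp)), cut_zero]

theorem integral_deriv_cut (hr : 0 < r) : ∫ a, deriv (cut r) a = 0 := by
  have h := intervalIntegral.integral_Iic_add_Ioi (b := (0 : ℝ)) (μ := volume)
    (integrable_deriv_cut hr).integrableOn (integrable_deriv_cut hr).integrableOn
  rw [← h, integral_Iic_eq_integral_Iio, integral_Iio_deriv_cut hr, integral_Ioi_deriv_cut hr]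
  norm_num

theorem le_integral_cut (hr : 0 < r) : r ≤ ∫ a, cut r a := by
  have h1 : ∫ a in Icc (-(r / 2)) (r / 2), (1 : ℝ) ≤ ∫ a in Icc (-(r / 2)) (r / 2), cut r a := by
    refine setIntegral_mono_on (by simp) (integrable_cut hr).integrableOn measurableSet_Icc ?_
    intro a ha
    rw [cut, lineBump.one_of_mem_closedBall]
    rw [Metric.mem_closedBall, dist_zero_right, Real.norm_eq_abs, abs_div, abs_of_pos hr]
    rw [div_le_iff₀ hr, abs_le]
    change -(1 / 2 * r) ≤ a ∧ a ≤ 1 / 2 * r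
    exact ⟨by linarith [ha.1], by linarith [ha.2]⟩
  have h2 : ∫ a in Icc (-(r / 2)) (r / 2), cut r a ≤ ∫ a, cut r a :=
    setIntegral_le_integral (integrable_cut hr) (Eventually.of_forall fun a => cut_nonneg r a)
  have h3 : ∫ a in Icc (-(r / 2)) (r / 2), (1 : ℝ) = r := by
    rw [setIntegral_const, smul_eq_mul, mul_one, Measure.real, Real.volume_Icc,
      ENNReal.toReal_ofReal (by linarith)]
    ring
  linarith

end Cut

/-! ### Orthonormal frames -/

/-- The unit vector `n` rotated by a right angle. -/
def rot (n : Plane) : Plane := !₂[-n 1, n 0]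

section Frame

variable {n : Plane}

theorem inner_rot_self (n : Plane) : ⟪rot n, n⟫ = 0 := by
  simp [rot, PiLp.inner_apply, Fin.sum_univ_two]
  ring

theorem norm_rot (n : Plane) : ‖rot n‖ = ‖n‖ := by
  simp [rot, EuclideanSpace.norm_eq, Fin.sum_univ_two, add_comm]

theorem orthonormal_frame (hn : ‖n‖ = 1) : Orthonormal ℝ ![rot n, n] := by
  rw [orthonormal_iff_ite]
  intro i j
  fin_cases i <;> fin_cases j <;>
    simp [inner_rot_self, real_inner_comm (rot n) n, norm_rot, hn]

/-- The orthonormal basis consisting of `rot n` and `n`. -/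
def frameBasis (hn : ‖n‖ = 1) : OrthonormalBasis (Fin 2) ℝ Plane :=
  basisOfOrthonormalOfCardEqFinrank (orthonormal_frame hn) (by simp) |>.toOrthonormalBasis
    (by simpa using orthonormal_frame hn)

theorem frameBasis_apply (hn : ‖n‖ = 1) : ⇑(frameBasis hn) = ![rot n, n] := by
  simp [frameBasis]

/-- Orthonormal coordinates centred at `z` with second axis `n`. -/
def frame (z : Plane) (hn : ‖n‖ = 1) : ℝ × ℝ ≃ᵐ Plane :=
  (MeasurableEquiv.finTwoArrow (α := ℝ)).symm.trans <|
    (MeasurableEquiv.toLp 2 (Fin 2 → ℝ)).trans <|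
      (frameBasis hn).repr.symm.toHomeomorph.toMeasurableEquiv.trans (MeasurableEquiv.addLeft z)

theorem frame_apply (z : Plane) (hn : ‖n‖ = 1) (q : ℝ × ℝ) :
    frame z hn q = z + (q.1 • rot n + q.2 • n) := by
  have : (frameBasis hn).repr.symm (WithLp.toLp 2 ![q.1, q.2]) = q.1 • rot n + q.2 • n := by
    rw [← (frameBasis hn).sum_repr_symm]
    simp [frameBasis_apply, Fin.sum_univ_two]
  rw [← this]
  rfl

theorem measurePreserving_frame (z : Plane) (hn : ‖n‖ = 1) :
    MeasurePreserving (frame z hn) := by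
  have h1 := (volume_preserving_finTwoArrow ℝ).symm
  have h2 := (PiLp.volume_preserving_toLp (Fin 2)).comp h1
  have h3 := ((frameBasis hn).measurePreserving_repr_symm).comp h2
  exact (measurePreserving_add_left volume z).comp h3

theorem eq_add_frame (hn : ‖n‖ = 1) (x : Plane) : ⟪rot n, x⟫ • rot n + ⟪n, x⟫ • n = x := by
  have h := (frameBasis hn).sum_repr' x
  simpa [frameBasis_apply, Fin.sum_univ_two] using h

theorem inner_rot_frame (z : Plane) (hn : ‖n‖ = 1) (a b : ℝ) :
    ⟪rot n, frame z hn (a, b) - z⟫ = a := by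
  rw [frame_apply, add_sub_cancel_left, inner_add_right, inner_smul_right, inner_smul_right,
    inner_rot_self, real_inner_self_eq_norm_sq, norm_rot, hn]
  ring

theorem inner_frame (z : Plane) (hn : ‖n‖ = 1) (a b : ℝ) :
    ⟪n, frame z hn (a, b) - z⟫ = b := by
  rw [frame_apply, add_sub_cancel_left, inner_add_right, inner_smul_right, inner_smul_right,
    real_inner_comm, inner_rot_self, real_inner_self_eq_norm_sq, hn]
  ring

theorem setIntegral_frame (z : Plane) (hn : ‖n‖ = 1) (s : Set Plane) (F : Plane → ℝ) :
    ∫ x in s, F x = ∫ q in frame z hn ⁻¹' s, F (frame z hn q) :=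
  ((measurePreserving_frame z hn).setIntegral_preimage_emb
    (frame z hn).measurableEmbedding F s).symm

/-- The box with half side lengths `l` and `t` in orthonormal coordinates. -/
def box (z n : Plane) (l t : ℝ) : Set Plane :=
  {x | ⟪rot n, x - z⟫ ∈ Icc (-l) l ∧ ⟪n, x - z⟫ ∈ Icc (-t) t}

theorem isClosed_box (z n : Plane) (l t : ℝ) : IsClosed (box z n l t) :=
  (isClosed_Icc.preimage (by fun_prop)).inter (isClosed_Icc.preimage (by fun_prop))

theorem volume_box (z : Plane) (hn : ‖n‖ = 1) {l t : ℝ} (hl : 0 ≤ l) :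
    volume (box z n l t) = ENNReal.ofReal (4 * (l * t)) := by
  have hpre : frame z hn ⁻¹' box z n l t = Icc (-l) l ×ˢ Icc (-t) t := by
    ext ⟨a, b⟩
    simp only [box, mem_preimage, mem_ofPred_eq, inner_rot_frame, inner_frame, mem_prod]
  rw [← (measurePreserving_frame z hn).measure_preimage
    (isClosed_box z n l t).measurableSet.nullMeasurableSet, hpre, Measure.volume_eq_prod,
    Measure.prod_prod, Real.volume_Icc, Real.volume_Icc, ← ENNReal.ofReal_mul (by linarith)]
  congr 1
  ring

theorem box_subset_closedBall (z : Plane) (hn : ‖n‖ = 1) {l t : ℝ} (htl : t ≤ l) :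
    box z n l t ⊆ Metric.closedBall z (2 * l) := by
  rintro x ⟨h1, h2⟩
  rw [Metric.mem_closedBall, dist_eq_norm, ← eq_add_frame hn (x - z)]
  refine (norm_add_le _ _).trans ?_
  rw [norm_smul, norm_smul, norm_rot, hn, mul_one, mul_one]
  have := abs_le.2 h1
  have := abs_le.2 h2
  simp only [Real.norm_eq_abs]
  linarith

theorem abs_setIntegral_le_box (z : Plane) (hn : ‖n‖ = 1) {l t C : ℝ} (hl : 0 ≤ l) (ht : 0 ≤ t)
    (hC : 0 ≤ C) {F : Plane → ℝ} (s : Set Plane) (hs : MeasurableSet s)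
    (hF : ∀ x ∈ s, x ∈ box z n l t → |F x| ≤ C) (h0 : ∀ x ∈ s, x ∉ box z n l t → F x = 0) :
    |∫ x in s, F x| ≤ C * (4 * (l * t)) := by
  have hb := (isClosed_box z n l t).measurableSet
  have hv := volume_box (t := t) z hn hl
  have hle : volume (s ∩ box z n l t) ≤ ENNReal.ofReal (4 * (l * t)) := by
    rw [← hv]; exact measure_mono inter_subset_right
  rw [setIntegral_eq_of_subset_of_forall_sdiff_eq_zero (t := s) (s := s ∩ box z n l t) hs
    inter_subset_left fun x hx => h0 x hx.1 fun hxb => hx.2 ⟨hx.1, hxb⟩]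
  refine (norm_setIntegral_le_of_norm_le_const (f := F) (C := C)
    (hle.trans_lt ENNReal.ofReal_lt_top) fun x hx => hF x hx.1 hx.2).trans ?_
  gcongr
  rw [Measure.real]
  exact ENNReal.toReal_le_of_le_ofReal (by positivity) hle

/-! ### Smooth test functions concentrated along a segment -/

/-- A smooth bump in the box with half side lengths `l` along `rot n` and `t` along `n`. -/
def ridge (z n : Plane) (l t : ℝ) (x : Plane) : ℝ :=
  cut l ⟪rot n, x - z⟫ * cut t ⟪n, x - z⟫

/-- The gradient of `ridge`. -/
def ridgeGrad (z n : Plane) (l t : ℝ) (x : Plane) : Plane :=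
  (deriv (cut l) ⟪rot n, x - z⟫ * cut t ⟪n, x - z⟫) • rot n +
    (cut l ⟪rot n, x - z⟫ * deriv (cut t) ⟪n, x - z⟫) • n

variable {l t : ℝ} {z : Plane}

theorem contDiff_ridge (z n : Plane) (l t : ℝ) : ContDiff ℝ ∞ (ridge z n l t) := by
  refine ContDiff.mul ((contDiff_cut l).comp ?_) ((contDiff_cut t).comp ?_)
  · exact contDiff_const.inner ℝ (contDiff_id.sub contDiff_const)
  · exact contDiff_const.inner ℝ (contDiff_id.sub contDiff_const)

theorem hasGradientAt_ridge (z n : Plane) (l t : ℝ) (x : Plane) :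
    HasGradientAt (ridge z n l t) (ridgeGrad z n l t x) x := by
  have hi : ∀ m : Plane, HasFDerivAt (fun y : Plane => ⟪m, y - z⟫) (innerSL ℝ m) x := fun m =>
    (innerSL ℝ m).hasFDerivAt.comp (g := innerSL ℝ m) x ((hasFDerivAt_id x).sub_const z)
  have h1 := (hasDerivAt_cut l ⟪rot n, x - z⟫).comp_hasFDerivAt x (hi (rot n))
  have h2 := (hasDerivAt_cut t ⟪n, x - z⟫).comp_hasFDerivAt x (hi n)
  rw [hasGradientAt_iff_hasFDerivAt]
  refine (h1.mul h2).congr_fderiv ?_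
  ext w
  simp [ridgeGrad]
  ring

theorem continuous_ridgeGrad (z n : Plane) (l t : ℝ) : Continuous (ridgeGrad z n l t) := by
  have := continuous_deriv_cut l
  have := continuous_deriv_cut t
  have := (contDiff_cut l).continuous
  have := (contDiff_cut t).continuous
  unfold ridgeGrad
  fun_prop

theorem ridge_nonneg (z n : Plane) (l t : ℝ) (x : Plane) : 0 ≤ ridge z n l t x :=
  mul_nonneg (cut_nonneg _ _) (cut_nonneg _ _)

theorem ridge_le_one (z n : Plane) (l t : ℝ) (x : Plane) : ridge z n l t x ≤ 1 :=
  mul_le_one₀ (cut_le_one _ _) (cut_nonneg _ _) (cut_le_one _ _)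

theorem ridge_eq_zero (hl : 0 < l) (ht : 0 < t) {x : Plane} (hx : x ∉ box z n l t) :
    ridge z n l t x = 0 := by
  rw [box, mem_ofPred_eq, not_and_or] at hx
  rw [ridge, mul_eq_zero]
  refine hx.imp (fun h => cut_eq_zero hl ?_) fun h => cut_eq_zero ht ?_ <;>
  · by_contra! hlt
    exact h (abs_le.1 hlt.le)

theorem tsupport_ridge_subset (hl : 0 < l) (ht : 0 < t) :
    tsupport (ridge z n l t) ⊆ box z n l t :=
  closure_minimal (fun _ hx => by_contra fun h => hx (ridge_eq_zero hl ht h)) (isClosed_box _ _ _ _)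

theorem ridgeGrad_eq_zero (hl : 0 < l) (ht : 0 < t) {x : Plane} (hx : x ∉ box z n l t) :
    ridgeGrad z n l t x = 0 := by
  have h0 : ridge z n l t =ᶠ[𝓝 x] fun _ => 0 := by
    filter_upwards [(isClosed_box z n l t).isOpen_compl.mem_nhds hx] with y hy
    exact ridge_eq_zero hl ht hy
  have h1 := (hasGradientAt_ridge z n l t x).congr_of_eventuallyEq h0.symm
  exact h1.unique (hasGradientAt_const x (0 : ℝ))

theorem hasCompactSupport_ridge (hn : ‖n‖ = 1) (hl : 0 < l) (ht : 0 < t) (htl : t ≤ l) :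
    HasCompactSupport (ridge z n l t) :=
  (isCompact_closedBall z (2 * l)).of_isClosed_subset (isClosed_tsupport _)
    ((tsupport_ridge_subset hl ht).trans (box_subset_closedBall z hn htl))

theorem norm_ridgeGrad_le (hn : ‖n‖ = 1) (ht : 0 < t) (htl : t ≤ l) (x : Plane) :
    ‖ridgeGrad z n l t x‖ ≤ 2 * bumpSlope / t := by
  have hl := ht.trans_le htl
  have hA : 0 < bumpSlope := lt_of_lt_of_le one_pos one_le_bumpSlope
  have hc : ∀ r a, |cut r a| ≤ 1 := fun r a => by
    rw [abs_of_nonneg (cut_nonneg r a)]; exact cut_le_one r a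
  have h1 : |deriv (cut l) ⟪rot n, x - z⟫| ≤ bumpSlope / t :=
    (abs_deriv_cut_le hl _).trans (by gcongr)
  have h2 := abs_deriv_cut_le ht ⟪n, x - z⟫
  refine (norm_add_le _ _).trans ?_
  rw [norm_smul, norm_smul, norm_rot, hn, mul_one, mul_one, Real.norm_eq_abs, Real.norm_eq_abs,
    abs_mul, abs_mul, two_mul, add_div]
  gcongr
  · exact (mul_le_of_le_one_right (abs_nonneg _) (hc _ _)).trans h1
  · exact (mul_le_of_le_one_left (abs_nonneg _) (hc _ _)).trans h2

theorem ridge_line (hn : ‖n‖ = 1) (a : ℝ) : ridge z n l t (z + a • rot n) = cut l a := by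
  have h := frame_apply z hn (a, 0)
  simp only [zero_smul, add_zero] at h
  rw [ridge, ← h, inner_rot_frame, inner_frame, cut_zero, mul_one]

theorem le_integral_ridge (hn : ‖n‖ = 1) (hl : 0 < l) (ht : 0 < t) :
    l * t ≤ ∫ x, ridge z n l t x := by
  rw [← setIntegral_univ, setIntegral_frame z hn, preimage_univ, setIntegral_univ]
  simp_rw [ridge]
  have : ∀ q : ℝ × ℝ, cut l ⟪rot n, frame z hn q - z⟫ * cut t ⟪n, frame z hn q - z⟫ =
      cut l q.1 * cut t q.2 := by
    rintro ⟨a, b⟩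
    rw [inner_rot_frame, inner_frame]
  simp_rw [this]
  rw [Measure.volume_eq_prod, integral_prod_mul]
  exact mul_le_mul (le_integral_cut hl) (le_integral_cut ht) ht.le
    (hl.le.trans (le_integral_cut hl))

/-- By Fubini the tangential part vanishes, as the derivative of a cut-off has integral zero on the
line. For J the whole line, the negative and the positive half line, the remaining factor is 0, 1
and −1; the last two values produce normal derivatives and jumps. -/
theorem setIntegral_inner_ridgeGrad (hn : ‖n‖ = 1) (hl : 0 < l) (ht : 0 < t) (g : Plane)
    (J : Set ℝ) : ∫ x in {x | ⟪n, x - z⟫ ∈ J}, ⟪g, ridgeGrad z n l t x⟫ =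
      (∫ a, cut l a) * (⟪g, n⟫ * ∫ b in J, deriv (cut t) b) := by
  have hpre : frame z hn ⁻¹' {x | ⟪n, x - z⟫ ∈ J} = univ ×ˢ J := by
    ext ⟨a, b⟩
    simp [inner_frame]
  rw [setIntegral_frame z hn, hpre]
  have : ∀ q : ℝ × ℝ, ⟪g, ridgeGrad z n l t (frame z hn q)⟫ =
      ⟪g, rot n⟫ * (deriv (cut l) q.1 * cut t q.2) +
        ⟪g, n⟫ * (cut l q.1 * deriv (cut t) q.2) := by
    rintro ⟨a, b⟩
    rw [ridgeGrad, inner_rot_frame, inner_frame, inner_add_right, inner_smul_right,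
      inner_smul_right]
    ring
  simp_rw [this]
  have i1 : Integrable (fun q : ℝ × ℝ => deriv (cut l) q.1 * cut t q.2) (volume.prod volume) :=
    (integrable_deriv_cut hl).mul_prod (integrable_cut ht)
  have i2 : Integrable (fun q : ℝ × ℝ => cut l q.1 * deriv (cut t) q.2) (volume.prod volume) :=
    (integrable_cut hl).mul_prod (integrable_deriv_cut ht)
  rw [Measure.volume_eq_prod, integral_add (i1.integrableOn.const_mul _)
    (i2.integrableOn.const_mul _), integral_const_mul, integral_const_mul, setIntegral_prod_mul,
    setIntegral_prod_mul, setIntegral_univ, setIntegral_univ, integral_deriv_cut hl]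
  ring

/-! ### Integrals along a line -/

theorem isometry_line (hn : ‖n‖ = 1) (z : Plane) : Isometry fun a : ℝ => z + a • rot n := by
  refine Isometry.of_dist_eq fun a b => ?_
  rw [dist_add_left, dist_eq_norm, ← sub_smul, norm_smul, norm_rot, hn, mul_one, Real.dist_eq,
    Real.norm_eq_abs]

theorem mem_range_line (hn : ‖n‖ = 1) {x : Plane} (hx : ⟪n, x - z⟫ = 0) :
    z + ⟪rot n, x - z⟫ • rot n = x := by
  have h := eq_add_frame hn (x - z)
  rw [hx, zero_smul, add_zero] at h
  rw [h, add_sub_cancel]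

/-- The arc-length parametrisation of a line is an isometry, so it carries Lebesgue measure to the
one-dimensional Hausdorff measure on the line. Off the line the integrand is zero on s. -/
theorem setIntegral_hausdorff_line (hn : ‖n‖ = 1) {s : Set Plane} (hs : MeasurableSet s)
    {F : Plane → ℝ} (hF : ∀ x ∈ s, ⟪n, x - z⟫ ≠ 0 → F x = 0) :
    ∫ x in s, F x ∂μH[1] = ∫ a : ℝ, s.indicator F (z + a • rot n) := by
  have hiso := isometry_line hn z
  rw [← integral_indicator hs, ← setIntegral_eq_integral_of_forall_compl_eq_zero
    (s := range fun a : ℝ => z + a • rot n), ← hiso.map_hausdorffMeasure (Or.inl zero_le_one),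
    hiso.isClosedEmbedding.measurableEmbedding.integral_map, hausdorffMeasure_real]
  intro x hx
  by_cases hxs : x ∈ s
  · rw [indicator_of_mem hxs]
    exact hF x hxs fun h0 => hx ⟨_, mem_range_line hn h0⟩
  · exact indicator_of_notMem hxs F

theorem hausdorff_line_le (hn : ‖n‖ = 1) {s : Set Plane} {d : ℝ}
    (hs : ∀ x ∈ s, ⟪n, x - z⟫ = 0 ∧ dist x z ≤ d) : μH[1] s ≤ ENNReal.ofReal (2 * d) := by
  have hsub : s ⊆ (fun a : ℝ => z + a • rot n) '' Icc (-d) d := by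
    intro x hx
    obtain ⟨h1, h2⟩ := hs x hx
    refine ⟨_, ?_, mem_range_line hn h1⟩
    rw [← mem_range_line hn h1, dist_eq_norm, add_sub_cancel_left, norm_smul, norm_rot, hn,
      mul_one] at h2
    exact abs_le.1 h2
  refine (measure_mono hsub).trans ?_
  rw [(isometry_line hn z).hausdorffMeasure_image (Or.inl zero_le_one),
    hausdorffMeasure_real, Real.volume_Icc]
  exact ENNReal.ofReal_le_ofReal (by linarith)

end Frame

/-! ### The reaction coefficient -/

/-- In an eigenbasis the trace is the sum of the products max(λ, 0) λ over the eigenvalues λ. -/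
theorem trace_cfc_mul_nonneg {A : Matrix (Fin 2) (Fin 2) ℝ} (hA : A.IsHermitian) :
    0 ≤ (hA.cfc (fun t => max t 0) * A).trace := by
  have h := hA.spectral_theorem
  have e : hA.cfc (fun t => max t 0) * A = Unitary.conjStarAlgAut ℝ _ hA.eigenvectorUnitary
      (Matrix.diagonal fun i => max (hA.eigenvalues i) 0 * hA.eigenvalues i) := by
    refine (congrArg (hA.cfc (fun t => max t 0) * ·) h).trans ?_
    simp only [Matrix.IsHermitian.cfc]
    rw [← map_mul, Matrix.diagonal_mul_diagonal]
    rfl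
  rw [e, Unitary.conjStarAlgAut_apply, Matrix.trace_mul_comm, ← mul_assoc,
    Unitary.coe_star_mul_self, one_mul, Matrix.trace_diagonal]
  refine Finset.sum_nonneg fun i _ => ?_
  rcases le_total 0 (hA.eigenvalues i) with hi | hi
  · rw [max_eq_left hi]; positivity
  · rw [max_eq_right hi, zero_mul]

variable (P : Params) (M : TriMesh) (u : Plane → Plane)

theorem energyDensity_nonneg (x : Plane) : 0 ≤ energyDensity P u x := by
  have hsym : ∀ i j, strain u x i j = strain u x j i := fun i j => by
    simp [strain, add_comm]
  have h1 : ∑ i, ∑ j, strainPos u x i j * strain u x i j =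
      (strainPos u x * strain u x).trace := by
    simp only [Matrix.trace, Matrix.diag, Matrix.mul_apply]
    exact Finset.sum_congr rfl fun i _ => Finset.sum_congr rfl fun j _ => by rw [hsym i j]
  have h2 : energyDensity P u x = 2 * P.mu * (strainPos u x * strain u x).trace +
      P.lam * (max 0 (strain u x).trace * (strain u x).trace) := by
    rw [← h1, energyDensity]
    simp [stressPos, Matrix.add_apply, Fin.sum_univ_two, Matrix.trace]
    ring
  have h3 : 0 ≤ max 0 (strain u x).trace * (strain u x).trace := by
    rcases le_total 0 (strain u x).trace with h | h
    · rw [max_eq_right h]; positivity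
    · rw [max_eq_left h]; simp
  have h4 : 0 ≤ (strainPos u x * strain u x).trace := trace_cfc_mul_nonneg (strain_isHermitian u x)
  have := P.mu_pos
  have := P.lam_pos
  rw [h2]
  positivity

theorem energyDensity_congr {x y : Plane} (h : fderiv ℝ u x = fderiv ℝ u y) :
    energyDensity P u x = energyDensity P u y := by
  have h1 : strain u x = strain u y := by
    ext i j; simp [strain, h]
  have h2 : strainPos u x = strainPos u y := by
    -- The functional calculus takes the proof of symmetry as an argument, so the matrix is
    -- generalised before substituting.
    have : ∀ (A B : Matrix (Fin 2) (Fin 2) ℝ) (hA : A.IsHermitian) (hB : B.IsHermitian), A = B →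
        hA.cfc (fun t => max t 0) = hB.cfc fun t => max t 0 := by
      rintro A B hA hB rfl; rfl
    exact this _ _ _ _ h1
  rw [energyDensity, energyDensity, stressPos, stressPos, h1, h2]

theorem le_coef (x : Plane) : P.Gc / P.eps ≤ coef P u x := by
  rw [coef, le_add_iff_nonneg_right]
  exact mul_nonneg (sub_nonneg.2 P.kappa_lt_one.le) (energyDensity_nonneg P u x)

theorem Gc_div_eps_pos : 0 < P.Gc / P.eps := div_pos P.Gc_pos P.eps_pos

theorem coef_pos (x : Plane) : 0 < coef P u x := (Gc_div_eps_pos P).trans_le (le_coef P u x)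

variable {P M u}

theorem exists_coef_eq (hu : M.IsP1 u) {T : Affine.Triangle ℝ Plane} (hT : T ∈ M.elems) :
    ∃ c, ∀ x ∈ interior (carrier T), coef P u x = c := by
  obtain ⟨A, hA⟩ := hu.2 T hT
  obtain ⟨x₀, hx₀⟩ := interior_nonempty T
  have hf : ∀ x ∈ interior (carrier T), fderiv ℝ u x = LinearMap.toContinuousLinearMap A.linear :=
    fun x hx => by
      rw [(eventuallyEq_of_mem_interior T hA hx).fderiv_eq, (hasFDerivAt_affineMap A x).fderiv]
  refine ⟨coef P u x₀, fun x hx => ?_⟩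
  rw [coef, coef, energyDensity_congr P u ((hf x hx).trans (hf x₀ hx₀).symm)]

/-- The Laplacian of an affine function vanishes. As the coefficient is constant on an element, the
residual is affine there. -/
theorem elemResidual_eq {φh : Plane → ℝ} (hφ : M.IsP1 φh) {T : Affine.Triangle ℝ Plane}
    (hT : T ∈ M.elems) {x : Plane} (hx : x ∈ interior (carrier T)) :
    elemResidual P u φh x = P.Gc / P.eps - coef P u x * φh x := by
  obtain ⟨A, hA⟩ := hφ.2 T hT
  rw [elemResidual, laplacian_of_mem_interior T hA hx, coef]
  ring

/-! ### Elementwise continuous functions -/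

/-- `F` has on each open element a continuous extension to the plane. -/
def ElemContinuous (M : TriMesh) {V : Type*} [TopologicalSpace V] (F : Plane → V) : Prop :=
  ∀ T ∈ M.elems, ∃ A : Plane → V, Continuous A ∧ EqOn F A (interior (carrier T))

section ElemContinuous

variable {V : Type*} [NormedAddCommGroup V] {F : Plane → V} {f g : Plane → ℝ}

theorem volume_domain_lt_top : volume M.domain < ⊤ :=
  (measure_mono interior_subset).trans_lt (isCompact_union M.elems).measure_lt_top

instance isFiniteMeasure_domain : IsFiniteMeasure (volume.restrict M.domain) :=
  ⟨by rw [Measure.restrict_apply_univ]; exact volume_domain_lt_top⟩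

theorem ae_domain_mem : ∀ᵐ x ∂(volume.restrict M.domain),
    ∃ T ∈ M.elems, x ∈ interior (carrier T) := by
  rw [restrict_domain]
  filter_upwards [ae_restrict_mem (M.elems.measurableSet_biUnion
    fun T _ => isOpen_interior.measurableSet)] with x hx
  simpa using hx

theorem ElemContinuous.memLp_top [SecondCountableTopology V] (hF : ElemContinuous M F) :
    MemLp F ⊤ (volume.restrict M.domain) := by
  have hmeas : AEStronglyMeasurable F (volume.restrict M.domain) := by
    rw [restrict_domain]
    refine ContinuousOn.aestronglyMeasurable ?_ (M.elems.measurableSet_biUnion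
      fun T _ => isOpen_interior.measurableSet)
    intro x hx
    obtain ⟨T, hT, hxT⟩ := mem_iUnion₂.1 hx
    obtain ⟨A, hA, hFA⟩ := hF T hT
    have : F =ᶠ[𝓝 x] A := hFA.eventuallyEq_of_mem (isOpen_interior.mem_nhds hxT)
    exact (hA.continuousAt.congr this.symm).continuousWithinAt
  have hb : ∀ T, ∃ C, T ∈ M.elems → ∀ x ∈ interior (carrier T), ‖F x‖ ≤ C := by
    intro T
    by_cases hT : T ∈ M.elems
    · obtain ⟨A, hA, hFA⟩ := hF T hT
      obtain ⟨C, hC⟩ := (isCompact_carrier T).exists_bound_of_continuousOn hA.continuousOn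
      exact ⟨C, fun _ x hx => by rw [hFA hx]; exact hC x (interior_subset hx)⟩
    · exact ⟨0, fun h => (hT h).elim⟩
  choose C hC using hb
  refine memLp_top_of_bound hmeas (∑ T ∈ M.elems, |C T|) ?_
  filter_upwards [ae_domain_mem] with x hx
  obtain ⟨T, hT, hxT⟩ := hx
  exact (hC T hT x hxT).trans ((le_abs_self _).trans
    (Finset.single_le_sum (f := fun T => |C T|) (fun _ _ => abs_nonneg _) hT))

theorem Continuous.elemContinuous {F : Plane → V} (hF : Continuous F) : ElemContinuous M F :=
  fun _ _ => ⟨F, hF, fun _ _ => rfl⟩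

theorem ElemContinuous.mul (hf : ElemContinuous M f) (hg : ElemContinuous M g) :
    ElemContinuous M fun x => f x * g x := fun T hT => by
  obtain ⟨A, hA, hfA⟩ := hf T hT
  obtain ⟨B, hB, hgB⟩ := hg T hT
  exact ⟨fun x => A x * B x, hA.mul hB, fun x hx => by simp only [hfA hx, hgB hx]⟩

theorem ElemContinuous.sub (hf : ElemContinuous M f) (hg : ElemContinuous M g) :
    ElemContinuous M fun x => f x - g x := fun T hT => by
  obtain ⟨A, hA, hfA⟩ := hf T hT
  obtain ⟨B, hB, hgB⟩ := hg T hT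
  exact ⟨fun x => A x - B x, hA.sub hB, fun x hx => by simp only [hfA hx, hgB hx]⟩

theorem elemContinuous_const (c : V) : ElemContinuous M fun _ => c :=
  Continuous.elemContinuous continuous_const

theorem elemContinuous_coef (hu : M.IsP1 u) : ElemContinuous M (coef P u) := fun T hT => by
  obtain ⟨c, hc⟩ := exists_coef_eq hu hT
  exact ⟨fun _ => c, continuous_const, hc⟩

theorem elemContinuous_of_isP1 (hf : M.IsP1 f) : ElemContinuous M f := fun T hT => by
  obtain ⟨A, hA⟩ := hf.2 T hT
  exact ⟨A, continuous_affineMap A, hA.mono interior_subset⟩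

theorem elemContinuous_gradient (hf : M.IsP1 f) : ElemContinuous M (∇ f) := fun T hT => by
  obtain ⟨A, hA⟩ := hf.2 T hT
  exact ⟨fun _ => affGrad A, continuous_const, fun x hx => gradient_of_mem_interior T hA hx⟩

theorem elemContinuous_elemResidual (hu : M.IsP1 u) (hf : M.IsP1 f) :
    ElemContinuous M (elemResidual P u f) := fun T hT => by
  obtain ⟨A, hA, hA'⟩ := ((elemContinuous_const (P.Gc / P.eps)).sub
    ((elemContinuous_coef hu).mul (elemContinuous_of_isP1 hf))) T hT
  exact ⟨A, hA, fun x hx => by rw [elemResidual_eq hf hT hx]; exact hA' hx⟩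

end ElemContinuous

/-! ### The Cauchy-Schwarz inequality for the energy -/

section Energy

variable {α : Type*} [MeasurableSpace α] {μ : Measure α} {c w ψ : α → ℝ} {G H : α → Plane}

theorem integrable_mul_mul (hc : MemLp c ⊤ μ) (hw : MemLp w 2 μ) (hψ : MemLp ψ 2 μ) :
    Integrable (fun x => c x * w x * ψ x) μ :=
  (MemLp.mul' (r := 2) (p := ⊤) (q := 2) hw hc).integrable_mul hψ

theorem integrable_inner (hG : MemLp G 2 μ) (hH : MemLp H 2 μ) :
    Integrable (fun x => ⟪G x, H x⟫) μ := by
  refine (hG.norm.integrable_mul hH.norm).mono (hG.1.inner hH.1) (Eventually.of_forall fun x => ?_)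
  simpa using norm_inner_le_norm (𝕜 := ℝ) (G x) (H x)

/-- The energy of w + s ψ is a nonnegative quadratic polynomial in s, so its discriminant is not
positive. The reaction and the gradient part are treated together, which keeps the constant 1. -/
theorem energy_cauchy_schwarz (hc : MemLp c ⊤ μ) (hc0 : ∀ x, 0 ≤ c x) {k : ℝ} (hk : 0 ≤ k)
    (hw : MemLp w 2 μ) (hψ : MemLp ψ 2 μ) (hG : MemLp G 2 μ) (hH : MemLp H 2 μ) :
    |(∫ x, c x * w x * ψ x ∂μ) + k * ∫ x, ⟪G x, H x⟫ ∂μ| ≤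
      √(k * (∫ x, ‖G x‖ ^ 2 ∂μ) + ∫ x, c x * w x ^ 2 ∂μ) *
        √(k * (∫ x, ‖H x‖ ^ 2 ∂μ) + ∫ x, c x * ψ x ^ 2 ∂μ) := by
  have nonneg : ∀ (w : α → ℝ) (G : α → Plane),
      0 ≤ k * (∫ x, ‖G x‖ ^ 2 ∂μ) + ∫ x, c x * w x ^ 2 ∂μ := fun w G =>
    add_nonneg (mul_nonneg hk (integral_nonneg fun x => by positivity))
      (integral_nonneg fun x => mul_nonneg (hc0 x) (sq_nonneg _))
  set B := (∫ x, c x * w x * ψ x ∂μ) + k * ∫ x, ⟪G x, H x⟫ ∂μ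
  set Q := k * (∫ x, ‖G x‖ ^ 2 ∂μ) + ∫ x, c x * w x ^ 2 ∂μ with hQ
  set R := k * (∫ x, ‖H x‖ ^ 2 ∂μ) + ∫ x, c x * ψ x ^ 2 ∂μ with hR
  have hdisc : discrim R (2 * B) Q ≤ 0 := by
    refine discrim_le_zero fun s => ?_
    have h := nonneg (fun x => w x + s * ψ x) (fun x => G x + s • H x)
    have e1 : ∫ x, ‖G x + s • H x‖ ^ 2 ∂μ =
        (∫ x, ‖G x‖ ^ 2 ∂μ) + (2 * s * (∫ x, ⟪G x, H x⟫ ∂μ) + s ^ 2 * ∫ x, ‖H x‖ ^ 2 ∂μ) := by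
      have : ∀ x, ‖G x + s • H x‖ ^ 2 = ‖G x‖ ^ 2 + (2 * s * ⟪G x, H x⟫ + s ^ 2 * ‖H x‖ ^ 2) := by
        intro x
        rw [norm_add_sq_real, inner_smul_right, norm_smul, mul_pow, Real.norm_eq_abs, sq_abs]
        ring
      have i1 := hG.integrable_norm_pow two_ne_zero
      have i2 := (integrable_inner hG hH).const_mul (2 * s)
      have i3 := (hH.integrable_norm_pow two_ne_zero).const_mul (s ^ 2)
      have i23 := i2.add i3
      simp only [Pi.add_def] at i23
      simp_rw [this]
      rw [integral_add i1 i23, integral_add i2 i3, integral_const_mul, integral_const_mul]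
    have e2 : ∫ x, c x * (w x + s * ψ x) ^ 2 ∂μ =
        (∫ x, c x * w x ^ 2 ∂μ) +
          (2 * s * (∫ x, c x * w x * ψ x ∂μ) + s ^ 2 * ∫ x, c x * ψ x ^ 2 ∂μ) := by
      have : ∀ x, c x * (w x + s * ψ x) ^ 2 =
          c x * w x ^ 2 + (2 * s * (c x * w x * ψ x) + s ^ 2 * (c x * ψ x ^ 2)) := fun x => by ring
      have i1 : Integrable (fun x => c x * w x ^ 2) μ := by
        simpa only [pow_two, mul_assoc] using integrable_mul_mul hc hw hw
      have i2 := (integrable_mul_mul hc hw hψ).const_mul (2 * s)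
      have i3 : Integrable (fun x => s ^ 2 * (c x * ψ x ^ 2)) μ := by
        refine Integrable.const_mul ?_ (s ^ 2)
        simpa only [pow_two, mul_assoc] using integrable_mul_mul hc hψ hψ
      have i23 := i2.add i3
      simp only [Pi.add_def] at i23
      simp_rw [this]
      rw [integral_add i1 i23, integral_add i2 i3, integral_const_mul, integral_const_mul]
    rw [e1, e2] at h
    have : R * (s * s) + 2 * B * s + Q = k * ((∫ x, ‖G x‖ ^ 2 ∂μ) +
        (2 * s * (∫ x, ⟪G x, H x⟫ ∂μ) + s ^ 2 * ∫ x, ‖H x‖ ^ 2 ∂μ)) +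
        ((∫ x, c x * w x ^ 2 ∂μ) +
          (2 * s * (∫ x, c x * w x * ψ x ∂μ) + s ^ 2 * ∫ x, c x * ψ x ^ 2 ∂μ)) := by
      rw [hQ, hR]; simp only [B]; ring
    rw [this]
    exact h
  rw [← Real.sqrt_mul (nonneg w G)]
  refine Real.abs_le_sqrt ?_
  rw [discrim] at hdisc
  nlinarith

theorem abs_integral_mul_le (hw : MemLp w 2 μ) (hψ : MemLp ψ 2 μ) :
    |∫ x, w x * ψ x ∂μ| ≤ √(∫ x, w x ^ 2 ∂μ) * √(∫ x, ψ x ^ 2 ∂μ) := by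
  have h0 : MemLp (fun _ : α => (0 : Plane)) 2 μ := MemLp.zero'
  have h := energy_cauchy_schwarz (c := fun _ => 1) (k := 0) (memLp_top_const 1) (fun _ => zero_le_one)
    le_rfl hw hψ h0 h0
  simpa using h

end Energy

/-! ### Cut-off test functions -/

section Cutoff

variable {D U : Set Plane} {z n : Plane} {l t : ℝ} {x : Plane}

/-- Truncation to D is harmless away from the part of the frontier of D in the box: near every other
point the truncated bump is either the smooth bump or zero. -/
theorem indicator_ridge_eventuallyEq (hl : 0 < l) (ht : 0 < t)
    (hx : x ∈ box z n l t → x ∉ frontier D) :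
    D.indicator (ridge z n l t) =ᶠ[𝓝 x] ridge z n l t ∧ x ∈ interior D ∨
      D.indicator (ridge z n l t) =ᶠ[𝓝 x] (fun _ => 0) ∧ D.indicator (ridge z n l t) x = 0 ∧
        D.indicator (ridgeGrad z n l t) x = 0 := by
  by_cases hb : x ∈ box z n l t
  · by_cases hi : x ∈ interior D
    · left
      refine ⟨?_, hi⟩
      filter_upwards [isOpen_interior.mem_nhds hi] with y hy
      exact indicator_of_mem (interior_subset hy) _
    · right
      have hxD : x ∉ closure D := fun h => hx hb ⟨h, hi⟩
      have hxD' : x ∉ D := fun h => hxD (subset_closure h)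
      refine ⟨?_, indicator_of_notMem hxD' _, indicator_of_notMem hxD' _⟩
      filter_upwards [isClosed_closure.isOpen_compl.mem_nhds hxD] with y hy
      exact indicator_of_notMem (fun h => hy (subset_closure h)) _
  · right
    refine ⟨?_, ?_, ?_⟩
    · filter_upwards [(isClosed_box z n l t).isOpen_compl.mem_nhds hb] with y hy
      exact indicator_apply_eq_zero.2 fun _ => ridge_eq_zero hl ht hy
    · exact indicator_apply_eq_zero.2 fun _ => ridge_eq_zero hl ht hb
    · exact indicator_apply_eq_zero.2 fun _ => ridgeGrad_eq_zero hl ht hb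

theorem continuousAt_indicator_ridge (hl : 0 < l) (ht : 0 < t)
    (hx : x ∈ box z n l t → x ∉ frontier D) : ContinuousAt (D.indicator (ridge z n l t)) x := by
  rcases indicator_ridge_eventuallyEq hl ht hx with ⟨h, -⟩ | ⟨h, -, -⟩
  · exact ((contDiff_ridge z n l t).continuous.continuousAt).congr h.symm
  · exact (continuousAt_const (y := (0 : ℝ))).congr h.symm

theorem hasFDerivAt_indicator_ridge (hl : 0 < l) (ht : 0 < t)
    (hx : x ∈ box z n l t → x ∉ frontier D) :
    HasFDerivAt (D.indicator (ridge z n l t))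
      (innerSL ℝ (D.indicator (ridgeGrad z n l t) x)) x := by
  rcases indicator_ridge_eventuallyEq hl ht hx with ⟨h, hi⟩ | ⟨h, -, h0⟩
  · rw [indicator_of_mem (interior_subset hi)]
    have := (hasGradientAt_ridge z n l t x).hasFDerivAt
    exact HasFDerivAt.congr_of_eventuallyEq this h
  · rw [h0, map_zero]
    exact (hasFDerivAt_const (0 : ℝ) x).congr_of_eventuallyEq h

theorem hasCompactSupport_ridgeGrad (hn : ‖n‖ = 1) (hl : 0 < l) (ht : 0 < t) (htl : t ≤ l) :
    HasCompactSupport (ridgeGrad z n l t) :=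
  HasCompactSupport.intro ((isCompact_closedBall z (2 * l)).of_isClosed_subset (isClosed_box z n l t)
    (box_subset_closedBall z hn htl)) fun _ hx => ridgeGrad_eq_zero hl ht hx

/-- The truncated bump may jump across the frontier of D outside U, but it is classically
differentiable on U, where η is supported. So the integration by parts formula in the plane applies.
This allows bumps that do not vanish on the boundary of Ω. -/
theorem isWeakGradient_indicator_ridge (hn : ‖n‖ = 1) (hl : 0 < l) (ht : 0 < t) (htl : t ≤ l)
    (hD : IsClosed D) (hfr : ∀ x ∈ box z n l t, x ∈ U → x ∉ frontier D) :
    IsWeakGradient U (D.indicator (ridge z n l t)) (D.indicator (ridgeGrad z n l t)) := by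
  intro η hη hηs hηU w
  have hcη : Continuous η := hη.continuous
  have hcη' : Continuous fun x => fderiv ℝ η x w :=
    (hη.continuous_fderiv (by simp)).clm_apply continuous_const
  have hcψ := (contDiff_ridge z n l t).continuous
  have hcG := continuous_ridgeGrad z n l t
  have hsψ := hasCompactSupport_ridge (z := z) hn hl ht htl
  have hsG := hasCompactSupport_ridgeGrad (z := z) hn hl ht htl
  have hU : ∀ x, x ∉ U → x ∉ tsupport η := fun x hx h => hx (hηU h)
  rw [setIntegral_eq_integral_of_forall_compl_eq_zero (f := fun x =>
      D.indicator (ridge z n l t) x * fderiv ℝ η x w),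
    setIntegral_eq_integral_of_forall_compl_eq_zero (f := fun x =>
      ⟪D.indicator (ridgeGrad z n l t) x, w⟫ * η x)]
  · have e1 : (fun x => ⟪D.indicator (ridgeGrad z n l t) x, w⟫ * η x) =
        D.indicator fun x => ⟪ridgeGrad z n l t x, w⟫ * η x := by
      ext x; by_cases hx : x ∈ D <;> simp [hx]
    have e2 : (fun x => D.indicator (ridge z n l t) x * fderiv ℝ η x w) =
        D.indicator fun x => ridge z n l t x * fderiv ℝ η x w := by
      ext x; by_cases hx : x ∈ D <;> simp [hx]
    have e3 : (fun x => D.indicator (ridge z n l t) x * η x) =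
        D.indicator fun x => ridge z n l t x * η x := by
      ext x; by_cases hx : x ∈ D <;> simp [hx]
    refine integral_bilinear_hasFDerivAt_right_eq_neg_left_of_integrable
      (B := ContinuousLinearMap.mul ℝ ℝ) (f := D.indicator (ridge z n l t))
      (f' := fun x => innerSL ℝ (D.indicator (ridgeGrad z n l t) x)) (g := η) (g' := fderiv ℝ η)
      (v := w) ?_ ?_ ?_ ?_ ?_
    · change Integrable fun x => ⟪D.indicator (ridgeGrad z n l t) x, w⟫ * η x
      rw [e1]
      refine Integrable.indicator ?_ hD.measurableSet
      exact ((hcG.inner continuous_const).mul hcη).integrable_of_hasCompactSupport hηs.mul_left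
    · change Integrable fun x => D.indicator (ridge z n l t) x * fderiv ℝ η x w
      rw [e2]
      refine Integrable.indicator ?_ hD.measurableSet
      exact (hcψ.mul hcη').integrable_of_hasCompactSupport hsψ.mul_right
    · change Integrable fun x => D.indicator (ridge z n l t) x * η x
      rw [e3]
      refine Integrable.indicator ?_ hD.measurableSet
      exact (hcψ.mul hcη).integrable_of_hasCompactSupport hsψ.mul_right
    · exact fun x hx => hasFDerivAt_indicator_ridge hl ht fun hb => hfr x hb (hηU hx)
    · exact fun x _ => (hη.differentiable (by simp)).differentiableAt.hasFDerivAt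
  · intro x hx
    rw [image_eq_zero_of_notMem_tsupport (hU x hx), mul_zero]
  · intro x hx
    rw [fderiv_of_notMem_tsupport ℝ (hU x hx)]
    simp

/-- The bump `ridge`, restricted to the closed set `D`, as a Sobolev function. -/
def cutoffTest (Ω : Set Plane) (hn : ‖n‖ = 1) (hl : 0 < l) (ht : 0 < t) (htl : t ≤ l)
    (hD : IsClosed D) (hfr : ∀ x ∈ box z n l t, x ∈ Ω → x ∉ frontier D) : H1 Ω where
  toFun := D.indicator (ridge z n l t)
  grad := D.indicator (ridgeGrad z n l t)
  memLp_toFun := (((contDiff_ridge z n l t).continuous.memLp_of_hasCompactSupport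
    (hasCompactSupport_ridge hn hl ht htl)).indicator hD.measurableSet).restrict Ω
  memLp_grad := (((continuous_ridgeGrad z n l t).memLp_of_hasCompactSupport
    (hasCompactSupport_ridgeGrad hn hl ht htl)).indicator hD.measurableSet).restrict Ω
  weak := isWeakGradient_indicator_ridge hn hl ht htl hD hfr

/-- By continuity the values on a small disc lie in a closed ball around ψ(x); that ball is convex,
so it contains their mean. -/
theorem trace_eq_of_continuousAt {Ω : Set Plane} (hΩ : IsOpen Ω) (ψ : H1 Ω) (hx : x ∈ Ω)
    (hc : ContinuousAt ψ.toFun x) : ψ.trace x = ψ.toFun x := by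
  refine Tendsto.limUnder_eq ?_
  rw [Metric.tendsto_nhds]
  intro ε hε
  obtain ⟨δ, hδ, hball⟩ := Metric.eventually_nhds_iff_ball.1
    (hc.eventually (Metric.closedBall_mem_nhds (ψ.toFun x) (half_pos hε)))
  filter_upwards [Ioo_mem_nhdsGT hδ] with ρ hρ
  have hmem := (convex_closedBall (ψ.toFun x) (ε / 2)).set_average_mem Metric.isClosed_closedBall
    (μ := volume) (t := Metric.ball x ρ ∩ Ω) (f := ψ.toFun) ?_ ?_ ?_ ?_
  · exact (Metric.mem_closedBall.1 hmem).trans_lt (by linarith)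
  · exact ((Metric.isOpen_ball.inter hΩ).measure_pos volume
      ⟨x, Metric.mem_ball_self hρ.1, hx⟩).ne'
  · exact ((measure_mono inter_subset_left).trans_lt Metric.isBounded_ball.measure_lt_top).ne
  · refine ae_restrict_of_forall_mem
      (Metric.isOpen_ball.measurableSet.inter hΩ.measurableSet) fun y hy => ?_
    exact hball y (Metric.ball_subset_ball hρ.2.le hy.1)
  · have h1 : MemLp ψ.toFun 2 (volume.restrict (Metric.ball x ρ ∩ Ω)) :=
      ψ.memLp_toFun.mono_measure (Measure.restrict_mono inter_subset_right le_rfl)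
    have : IsFiniteMeasure (volume.restrict (Metric.ball x ρ ∩ Ω)) :=
      ⟨by
        rw [Measure.restrict_apply_univ]
        exact (measure_mono inter_subset_left).trans_lt Metric.isBounded_ball.measure_lt_top⟩
    exact h1.integrable one_le_two

end Cutoff

/-! ### The residual equation tested with a local function -/

section Residual

variable {P : Params} {M : TriMesh} {u : Plane → Plane} {φ : Plane → Plane → ℝ}
  {χ φh : Plane → ℝ} {φhat : H1 M.domain} {p : Plane}

/-- Scaling by 1/4 towards q maps the coordinate λ of q to 3/4 + λ/4. A function supported where all
coordinates are below 3/4 therefore vanishes on all small patches. -/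
theorem exists_of_mem_smallPatch {q x : Plane} (hx : x ∈ M.smallPatch q) :
    x ∈ M.domain ∧ ∃ S ∈ M.elems, x ∈ carrier S ∧ ∃ k, 3 / 4 ≤ bary S k x := by
  have hS : ∀ x ∈ M.smallPatch q, ∃ S ∈ M.elems, x ∈ carrier S ∧ ∃ k, 3 / 4 ≤ bary S k x := by
    rintro _ ⟨y, hy, rfl⟩
    obtain ⟨S, hS, hyS⟩ := mem_iUnion₂.1 (interior_subset hy)
    obtain ⟨hSM, k, rfl⟩ := mem_star.1 hS
    have hb : ∀ i, bary S i (AffineMap.homothety (S.points k) (1 / 4 : ℝ) y) =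
        (if i = k then 1 else 0) + 1 / 4 * (bary S i y - if i = k then 1 else 0) := by
      intro i
      rw [AffineMap.homothety_eq_lineMap, bary_lineMap, bary_points]
    have hc := (mem_carrier_iff S).1 hyS
    refine ⟨S, hSM, (mem_carrier_iff S).2 fun i => ?_, k, ?_⟩
    · rw [hb]
      have := hc i
      split_ifs <;> linarith
    · rw [hb, if_pos rfl]
      have := hc k
      linarith
  refine ⟨?_, hS x hx⟩
  have ho : IsOpen (M.smallPatch q) :=
    (AffineMap.homothety_isOpenMap q (1 / 4 : ℝ) (by norm_num)) _ isOpen_patch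
  refine interior_maximal (fun y hy => ?_) ho hx
  obtain ⟨S, hSM, hyS, -⟩ := hS y hy
  exact mem_iUnion₂.2 ⟨S, hSM, hyS⟩

open Classical in
/-- The part of the partition of unity that does not belong to full-contact nodes, where the
contribution of a node `q` is only counted on `A q`. -/
def freeWeight (P : Params) (M : TriMesh) (u : Plane → Plane) (φ : Plane → Plane → ℝ)
    (χ φh : Plane → ℝ) (A : Plane → Set Plane) (x : Plane) : ℝ :=
  1 - ∑ q ∈ M.nodes.filter (IsFullContact P M u χ φh), (A q).indicator (φ q) x

/-- As p is not a full-contact node, φ_p is among the summands of the partition of unity that are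
not subtracted. The sets A may be arbitrary because truncating the nonnegative φ_q only increases
the weight; A is `M.patch` for volume terms and `M.innerSides` for side terms. -/
theorem freeWeight_bounds (hφ : M.IsNodalBasis φ) (hp : p ∈ M.nodes)
    (hpf : ¬ IsFullContact P M u χ φh p) (A : Plane → Set Plane) {T : Affine.Triangle ℝ Plane}
    (hT : T ∈ M.elems) {x : Plane} (hx : x ∈ carrier T) :
    φ p x ≤ freeWeight P M u φ χ φh A x ∧ freeWeight P M u φ χ φh A x ≤ 1 := by
  classical
  have hnn : ∀ q ∈ M.nodes, 0 ≤ φ q x := fun q hq => nodalBasis_nonneg hφ hq hT hx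
  have hind : ∀ q ∈ M.nodes, 0 ≤ (A q).indicator (φ q) x ∧ (A q).indicator (φ q) x ≤ φ q x := by
    intro q hq
    by_cases h : x ∈ A q
    · rw [indicator_of_mem h]; exact ⟨hnn q hq, le_rfl⟩
    · rw [indicator_of_notMem h]; exact ⟨le_rfl, hnn q hq⟩
  rw [freeWeight]
  constructor
  · have h1 : ∑ q ∈ M.nodes.filter (IsFullContact P M u χ φh), (A q).indicator (φ q) x ≤
        ∑ q ∈ M.nodes.erase p, φ q x := by
      refine (Finset.sum_le_sum fun q hq => (hind q (Finset.mem_filter.1 hq).1).2).trans ?_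
      refine Finset.sum_le_sum_of_subset_of_nonneg (fun q hq => ?_) fun q hq _ =>
        hnn q (Finset.mem_of_mem_erase hq)
      rw [Finset.mem_filter] at hq
      exact Finset.mem_erase.2 ⟨fun h => hpf (h ▸ hq.2), hq.1⟩
    have h2 := sum_nodalBasis hφ hT hx
    rw [← Finset.sum_erase_add _ _ hp] at h2
    linarith
  · rw [sub_le_self_iff]
    exact Finset.sum_nonneg fun q hq => (hind q (Finset.mem_filter.1 hq).1).1

/-- A test function of zero energy needs no separate treatment: in `ℝ≥0∞` a positive number divided
by 0 is ⊤, so a finite dual norm forces F ψ = 0 there. -/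
theorem abs_le_localDualNorm {F : H1 M.domain → ℝ} {ψ : H1 M.domain} (hψ : IsLocalTest M p ψ)
    (htop : localDualNorm P M u p F ≠ ⊤) :
    |F ψ| ≤ (localDualNorm P M u p F).toReal * energyNorm P u M.domain ψ.toFun ψ.grad := by
  have h1 : ENNReal.ofReal |F ψ| / ENNReal.ofReal (energyNorm P u M.domain ψ.toFun ψ.grad) ≤
      localDualNorm P M u p F :=
    le_iSup₂ (f := fun (ψ : H1 M.domain) (_ : IsLocalTest M p ψ) =>
      ENNReal.ofReal |F ψ| / ENNReal.ofReal (energyNorm P u M.domain ψ.toFun ψ.grad)) ψ hψ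
  rw [ENNReal.div_le_iff_le_mul (Or.inr htop) (Or.inl ENNReal.ofReal_ne_top),
    ← ENNReal.ofReal_toReal htop, ← ENNReal.ofReal_mul ENNReal.toReal_nonneg] at h1
  exact (ENNReal.ofReal_le_ofReal_iff (mul_nonneg ENNReal.toReal_nonneg (Real.sqrt_nonneg _))).1 h1

open Classical in
-- The residual identity combined with the Cauchy-Schwarz inequality on ω_p and the definition of
-- the dual norm. The hypothesis `hsmall` removes the semi-contact nodes; the volume terms of the
-- full-contact nodes are absorbed in the weight, while their side terms are kept to be combined
-- with the gradient term later.
theorem abs_residual_le (hu : M.IsP1 u) (hφ : M.IsNodalBasis φ) (hφh : M.IsP1 φh)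
    (htop : localError P M u φ χ φh φhat p ≠ ⊤) (ψ : H1 M.domain) (hψ : IsLocalTest M p ψ)
    (h0 : ∀ x ∈ M.domain, x ∉ M.patch p → ψ.toFun x = 0 ∧ ψ.grad x = 0)
    (hsmall : ∀ q, ∀ x ∈ M.smallPatch q, ψ.toFun x = 0) :
    |(∫ x in M.domain, elemResidual P u φh x * ψ.toFun x * freeWeight P M u φ χ φh M.patch x)
        - P.Gc * P.eps * (∫ x in M.domain, ⟪(∇ φh) x, ψ.grad x⟫)
        - ∑ q ∈ M.nodes.filter (IsFullContact P M u χ φh),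
            ∫ x in M.innerSides q, P.Gc * P.eps * M.jump φh x * ψ.trace x * φ q x ∂μH[1]|
      ≤ (localError P M u φ χ φh φhat p).toReal *
          energyNorm P u M.domain ψ.toFun ψ.grad := by
  set μ := volume.restrict M.domain with hμ
  have hcoef : MemLp (coef P u) ⊤ μ := (elemContinuous_coef hu).memLp_top
  have hφh2 : MemLp φh 2 μ := (elemContinuous_of_isP1 hφh).memLp_top.mono_exponent le_top
  have hgrad2 : MemLp (∇ φh) 2 μ := (elemContinuous_gradient hφh).memLp_top.mono_exponent le_top
  have hr : MemLp (elemResidual P u φh) ⊤ μ := (elemContinuous_elemResidual hu hφh).memLp_top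
  have h1 : MemLp (fun _ : Plane => (1 : ℝ)) 2 μ := memLp_const 1
  have hψ2 := ψ.memLp_toFun
  have hDψ2 := ψ.memLp_grad
  set F : H1 M.domain → ℝ := fun ψ => force P M u φhat ψ - quasiForce P M u φ χ φh ψ with hF
  have hsemi : ∀ q, semiPart P M u (φ q) φh q ψ = 0 := by
    intro q
    have hw : wmean M (φ q) q ψ.toFun = 0 := by
      rw [wmean, setIntegral_eq_zero_of_forall_eq_zero, zero_div]
      intro x hx
      rw [hsmall q x hx, zero_mul]
    simp [semiPart, hw]
  -- the volume terms of the full-contact nodes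
  have hfull : ∀ q ∈ M.nodes, ∫ x in M.patch q, elemResidual P u φh x * ψ.toFun x * φ q x =
      ∫ x, elemResidual P u φh x * ψ.toFun x * (M.patch q).indicator (φ q) x ∂μ := by
    intro q _
    have e : (fun x => elemResidual P u φh x * ψ.toFun x * (M.patch q).indicator (φ q) x) =
        (M.patch q).indicator fun x => elemResidual P u φh x * ψ.toFun x * φ q x := by
      ext x; by_cases hx : x ∈ M.patch q <;> simp [hx]
    rw [e, setIntegral_indicator isOpen_patch.measurableSet,
      inter_eq_self_of_subset_right patch_subset_domain]
  have hφq : ∀ q ∈ M.nodes, Integrable (fun x => elemResidual P u φh x * ψ.toFun x *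
      (M.patch q).indicator (φ q) x) μ := fun q hq =>
    integrable_mul_mul hr hψ2 ((((elemContinuous_of_isP1 (hφ q hq).1).memLp_top.mono_exponent
      le_top).indicator isOpen_patch.measurableSet))
  have hrψ : Integrable (fun x => elemResidual P u φh x * ψ.toFun x) μ := by
    simpa using integrable_mul_mul hr hψ2 h1
  have hW : ∫ x, elemResidual P u φh x * ψ.toFun x * freeWeight P M u φ χ φh M.patch x ∂μ =
      (∫ x, elemResidual P u φh x * ψ.toFun x ∂μ) -
        ∑ q ∈ M.nodes.filter (IsFullContact P M u χ φh),
          ∫ x in M.patch q, elemResidual P u φh x * ψ.toFun x * φ q x := by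
    rw [Finset.sum_congr rfl fun q hq => hfull q (Finset.mem_filter.1 hq).1,
      ← integral_finsetSum _ fun q hq => hφq q (Finset.mem_filter.1 hq).1,
      ← integral_sub hrψ (integrable_finsetSum _ fun q hq => hφq q (Finset.mem_filter.1 hq).1)]
    refine integral_congr_ae (Eventually.of_forall fun x => ?_)
    simp only [freeWeight, mul_sub, mul_one, Finset.mul_sum]
  -- the linear residual
  have hload : ∫ x, elemResidual P u φh x * ψ.toFun x ∂μ =
      load P M ψ.toFun - ∫ x, coef P u x * φh x * ψ.toFun x ∂μ := by
    have i1 : Integrable (fun x => P.Gc / P.eps * ψ.toFun x) μ := by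
      simpa using (hψ2.integrable one_le_two).const_mul (P.Gc / P.eps)
    rw [load, ← integral_sub i1 (integrable_mul_mul hcoef hφh2 hψ2)]
    refine integral_congr_ae ?_
    filter_upwards [ae_domain_mem] with x hx
    obtain ⟨T, hT, hxT⟩ := hx
    rw [elemResidual_eq hφh hT hxT]
    ring
  -- This is ⟨R − Λ̃_h, ψ⟩ = ⟨Λ̂ − Λ̃_h, ψ⟩ + a(φ̂ − φ_h, ψ): the load and a(φ̂, ψ) in the
  -- definition of Λ̂ cancel.
  have hid : (∫ x, elemResidual P u φh x * ψ.toFun x * freeWeight P M u φ χ φh M.patch x ∂μ)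
        - P.Gc * P.eps * (∫ x, ⟪(∇ φh) x, ψ.grad x⟫ ∂μ)
        - ∑ q ∈ M.nodes.filter (IsFullContact P M u χ φh),
            ∫ x in M.innerSides q, P.Gc * P.eps * M.jump φh x * ψ.trace x * φ q x ∂μH[1] =
      F ψ + ((∫ x, coef P u x * (φhat.toFun x - φh x) * ψ.toFun x ∂μ) +
        P.Gc * P.eps * ∫ x, ⟪φhat.grad x - (∇ φh) x, ψ.grad x⟫ ∂μ) := by
    have e1 : ∫ x, coef P u x * (φhat.toFun x - φh x) * ψ.toFun x ∂μ =
        (∫ x, coef P u x * φhat.toFun x * ψ.toFun x ∂μ) -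
          ∫ x, coef P u x * φh x * ψ.toFun x ∂μ := by
      rw [← integral_sub (integrable_mul_mul hcoef φhat.memLp_toFun hψ2)
        (integrable_mul_mul hcoef hφh2 hψ2)]
      congr 1; ext x; ring
    have e2 : ∫ x, ⟪φhat.grad x - (∇ φh) x, ψ.grad x⟫ ∂μ =
        (∫ x, ⟪φhat.grad x, ψ.grad x⟫ ∂μ) - ∫ x, ⟪(∇ φh) x, ψ.grad x⟫ ∂μ := by
      rw [← integral_sub (integrable_inner φhat.memLp_grad hDψ2) (integrable_inner hgrad2 hDψ2)]
      congr 1; ext x; rw [inner_sub_left]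
    rw [hW, hload, e1, e2, hF]
    simp only [force, quasiForce, hsemi, Finset.sum_const_zero, zero_add, fullPart, form,
      Finset.sum_add_distrib]
    ring
  have hpatch : ∀ f : Plane → ℝ, (∀ x ∈ M.domain, x ∉ M.patch p → f x = 0) →
      ∫ x, f x ∂μ = ∫ x in M.patch p, f x := fun f hf =>
    setIntegral_eq_of_subset_of_forall_sdiff_eq_zero isOpen_domain.measurableSet patch_subset_domain
      fun x hx => hf x hx.1 hx.2
  have hcs : |(∫ x, coef P u x * (φhat.toFun x - φh x) * ψ.toFun x ∂μ) +
        P.Gc * P.eps * ∫ x, ⟪φhat.grad x - (∇ φh) x, ψ.grad x⟫ ∂μ| ≤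
      energyNorm P u (M.patch p) (φhat.toFun - φh) (φhat.grad - ∇ φh) *
        energyNorm P u M.domain ψ.toFun ψ.grad := by
    rw [hpatch _ fun x hx hxp => by rw [(h0 x hx hxp).1, mul_zero],
      hpatch _ fun x hx hxp => by rw [(h0 x hx hxp).2, inner_zero_right]]
    have hle : volume.restrict (M.patch p) ≤ μ := Measure.restrict_mono patch_subset_domain le_rfl
    have h := energy_cauchy_schwarz (μ := volume.restrict (M.patch p)) (k := P.Gc * P.eps)
      (hcoef.mono_measure hle) (fun x => (coef_pos P u x).le)
      (mul_pos P.Gc_pos P.eps_pos).le ((φhat.memLp_toFun.sub hφh2).mono_measure hle)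
      (hψ2.mono_measure hle) ((φhat.memLp_grad.sub hgrad2).mono_measure hle)
      (hDψ2.mono_measure hle)
    refine h.trans (le_of_eq ?_)
    rw [energyNorm, energyNorm]
    congr 2
    rw [← hpatch (fun x => ‖ψ.grad x‖ ^ 2) fun x hx hxp => by simp [(h0 x hx hxp).2],
      ← hpatch (fun x => coef P u x * ψ.toFun x ^ 2) fun x hx hxp => by simp [(h0 x hx hxp).1]]
  have htop' : localDualNorm P M u p F ≠ ⊤ := fun h => htop (by
    rw [localError, ← hF, h, add_top])
  have hE : (localError P M u φ χ φh φhat p).toReal =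
      energyNorm P u (M.patch p) (φhat.toFun - φh) (φhat.grad - ∇ φh) +
        (localDualNorm P M u p F).toReal := by
    rw [localError, ENNReal.toReal_add ENNReal.ofReal_ne_top htop',
      ENNReal.toReal_ofReal (show 0 ≤ energyNorm P u _ _ _ from Real.sqrt_nonneg _)]
  rw [hid, hE, add_mul, add_comm (energyNorm P u (M.patch p) _ _ * _)]
  exact (abs_add_le _ _).trans (add_le_add (abs_le_localDualNorm hψ htop') hcs)

end Residual

/-! ### Testing with cut-off functions on a patch -/

section CutoffEstimate

variable {P : Params} {M : TriMesh} {u : Plane → Plane} {φ : Plane → Plane → ℝ}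
  {χ φh : Plane → ℝ} {φhat : H1 M.domain} {p z n : Plane} {l t : ℝ}

theorem measurableSet_innerSides (q : Plane) : MeasurableSet (M.innerSides q) :=
  isOpen_patch.measurableSet.inter
    (Finset.measurableSet_biUnion _ fun _ _ => isClosed_frontier.measurableSet)

theorem notMem_innerSides_of_mem_interior {T : Affine.Triangle ℝ Plane} (hT : T ∈ M.elems)
    {x : Plane} (hx : x ∈ interior (carrier T)) (q : Plane) : x ∉ M.innerSides q := by
  rintro ⟨-, h⟩
  obtain ⟨S, hS, hxS⟩ := mem_iUnion₂.1 h
  rcases eq_or_ne S T with rfl | hne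
  · exact hxS.2 hx
  · exact notMem_of_mem_interior (mem_star.1 hS).1 hT hne hx ((isClosed_carrier S).frontier_subset hxS)

open Classical in
-- The residual estimate for a truncated bump. Here `hfr` makes it weakly differentiable in Ω,
-- `hint` gives the zero boundary values required at an interior node, and `havoid` keeps it off the
-- small patches. The energy is bounded by the suprema of its density times 4 l t, the area of the
-- box.
theorem cutoff_residual_le (hu : M.IsP1 u) (hφ : M.IsNodalBasis φ) (hφh : M.IsP1 φh)
    (htop : localError P M u φ χ φh φhat p ≠ ⊤) (hn : ‖n‖ = 1) (hl : 0 < l) (ht : 0 < t)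
    (htl : t ≤ l) {s : Finset (Affine.Triangle ℝ Plane)} (hs : s ⊆ M.star p)
    (hfr : ∀ x ∈ box z n l t, x ∈ M.domain → x ∉ frontier (⋃ T ∈ s, carrier T))
    (hint : p ∈ M.domain → box z n l t ⊆ interior (⋃ T ∈ s, carrier T))
    (havoid : ∀ T ∈ s, ∀ x ∈ box z n l t, x ∈ carrier T → ∀ i, bary T i x < 3 / 4) {cmax : ℝ}
    (hcmax : ∀ T ∈ s, ∀ x ∈ interior (carrier T), coef P u x ≤ cmax) :
    |(∫ x in M.domain, elemResidual P u φh x * (⋃ T ∈ s, carrier T).indicator (ridge z n l t) x *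
          freeWeight P M u φ χ φh M.patch x)
        - P.Gc * P.eps *
          (∫ x in M.domain, ⟪(∇ φh) x, (⋃ T ∈ s, carrier T).indicator (ridgeGrad z n l t) x⟫)
        - ∑ q ∈ M.nodes.filter (IsFullContact P M u χ φh),
            ∫ x in M.innerSides q, P.Gc * P.eps * M.jump φh x *
              (⋃ T ∈ s, carrier T).indicator (ridge z n l t) x * φ q x ∂μH[1]|
      ≤ (localError P M u φ χ φh φhat p).toReal *
          √(P.Gc * P.eps * ((2 * bumpSlope / t) ^ 2 * (4 * (l * t))) + cmax * (4 * (l * t))) := by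
  set D : Set Plane := ⋃ T ∈ s, carrier T with hDdef
  have hD : IsClosed D := isClosed_union s
  have hsM : s ⊆ M.elems := fun T hT => (mem_star.1 (hs hT)).1
  set ψ : H1 M.domain := cutoffTest M.domain hn hl ht htl hD hfr with hψ
  have hzero : ∀ x, x ∉ box z n l t → ψ.toFun x = 0 ∧ ψ.grad x = 0 := fun x hx =>
    ⟨indicator_apply_eq_zero.2 fun _ => ridge_eq_zero hl ht hx,
      indicator_apply_eq_zero.2 fun _ => ridgeGrad_eq_zero hl ht hx⟩
  have hzeroD : ∀ x, x ∉ D → ψ.toFun x = 0 ∧ ψ.grad x = 0 := fun x hx =>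
    ⟨indicator_of_notMem hx _, indicator_of_notMem hx _⟩
  have hmemint : ∀ x ∈ box z n l t, x ∈ M.domain → x ∈ D → x ∈ interior D := fun x hx hxΩ hxD => by
    by_contra h
    exact hfr x hx hxΩ ⟨subset_closure hxD, h⟩
  have hDpatch : interior D ⊆ M.patch p :=
    interior_mono (biUnion_subset_biUnion_left fun T hT => hs hT)
  have h0 : ∀ x ∈ M.domain, x ∉ M.patch p → ψ.toFun x = 0 ∧ ψ.grad x = 0 := by
    intro x hx hxp
    by_cases hb : x ∈ box z n l t
    · by_cases hxD : x ∈ D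
      · exact (hxp (hDpatch (hmemint x hb hx hxD))).elim
      · exact hzeroD x hxD
    · exact hzero x hb
  have hloc : IsLocalTest M p ψ := by
    refine ⟨ae_restrict_of_forall_mem (isOpen_domain.measurableSet.diff isOpen_patch.measurableSet)
      fun x hx => (h0 x hx.1 hx.2).1, fun hp => ?_⟩
    have hb := hint hp
    -- At an interior node the box lies in ω_p, so extending the bump by zero from Ω changes
    -- nothing.
    have hΩ : ∀ {V : Type} [Zero V] (f : Plane → V), (∀ x, x ∉ box z n l t → f x = 0) →
        M.domain.indicator (D.indicator f) = D.indicator f := by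
      intro V _ f hf
      ext x
      by_cases hx : x ∈ box z n l t
      · rw [indicator_of_mem (patch_subset_domain (hDpatch (hb hx)))]
      · by_cases hxΩ : x ∈ M.domain
        · rw [indicator_of_mem hxΩ]
        · rw [indicator_of_notMem hxΩ, eq_comm]
          exact indicator_apply_eq_zero.2 fun _ => hf x hx
    have e1 : M.domain.indicator ψ.toFun = D.indicator (ridge z n l t) :=
      hΩ _ fun x hx => ridge_eq_zero hl ht hx
    have e2 : M.domain.indicator ψ.grad = D.indicator (ridgeGrad z n l t) :=
      hΩ _ fun x hx => ridgeGrad_eq_zero hl ht hx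
    rw [H1.ZeroBoundary, e1, e2]
    exact isWeakGradient_indicator_ridge hn hl ht htl hD fun x hx _ h => h.2 (hb hx)
  have hsmall : ∀ q, ∀ x ∈ M.smallPatch q, ψ.toFun x = 0 := by
    intro q x hx
    by_contra hne
    have hb : x ∈ box z n l t := by_contra fun h => hne (hzero x h).1
    have hxD : x ∈ D := by_contra fun h => hne (hzeroD x h).1
    obtain ⟨hxΩ, S, hS, hxS, k, hk⟩ := exists_of_mem_smallPatch hx
    have hev : ∀ᶠ y in 𝓝 x, ∃ T ∈ s, y ∈ carrier T := by
      filter_upwards [mem_interior_iff_mem_nhds.1 (hmemint x hb hxΩ hxD)] with y hy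
      simpa [hDdef] using hy
    exact absurd (havoid S (eq_or_eq_of_eventually hsM hev hS hxS) x hb hxS k) (not_lt.2 hk)
  have htrace : ∀ q, ∫ x in M.innerSides q, P.Gc * P.eps * M.jump φh x * ψ.trace x * φ q x ∂μH[1] =
      ∫ x in M.innerSides q, P.Gc * P.eps * M.jump φh x * D.indicator (ridge z n l t) x *
        φ q x ∂μH[1] := fun q =>
    setIntegral_congr_fun (measurableSet_innerSides q) fun x hx => by
      have hxΩ : x ∈ M.domain := patch_subset_domain hx.1
      rw [trace_eq_of_continuousAt isOpen_domain ψ hxΩ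
        (continuousAt_indicator_ridge hl ht fun hb => hfr x hb hxΩ)]
      rfl
  have hmain := abs_residual_le hu hφ hφh htop ψ hloc h0 hsmall
  simp only [htrace] at hmain
  refine hmain.trans ?_
  gcongr
  rw [energyNorm]
  have hP : 0 ≤ P.Gc * P.eps := (mul_pos P.Gc_pos P.eps_pos).le
  have hA := one_le_bumpSlope
  have hmeas : MeasurableSet (⋃ T ∈ M.elems, interior (carrier T)) :=
    M.elems.measurableSet_biUnion fun T _ => isOpen_interior.measurableSet
  -- For empty s the number `cmax` could be negative, but then ψ = 0.
  rcases s.eq_empty_or_nonempty with hse | ⟨T₀, hT₀⟩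
  · have : ∀ x, x ∉ D := by simp [hDdef, hse]
    have e1 : ψ.toFun = 0 := by ext x; exact (hzeroD x (this x)).1
    have e2 : ψ.grad = 0 := by ext1 x; exact (hzeroD x (this x)).2
    rw [e1, e2]
    simp
  have hcmax0 : 0 ≤ cmax := by
    obtain ⟨x, hx⟩ := interior_nonempty T₀
    exact (coef_pos P u x).le.trans (hcmax T₀ hT₀ x hx)
  refine Real.sqrt_le_sqrt (add_le_add (mul_le_mul_of_nonneg_left ?_ hP) ?_)
  · refine (le_abs_self _).trans (abs_setIntegral_le_box z hn hl.le ht.le (by positivity) _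
      isOpen_domain.measurableSet (fun x _ _ => ?_) fun x _ hx => ?_)
    · rw [abs_of_nonneg (sq_nonneg _)]
      gcongr
      exact (norm_indicator_le_norm_self _ x).trans (norm_ridgeGrad_le hn ht htl x)
    · rw [(hzero x hx).2]; simp
  · rw [restrict_domain]
    refine (le_abs_self _).trans (abs_setIntegral_le_box z hn hl.le ht.le hcmax0 _
      hmeas (fun x hx _ => ?_) fun x _ hx => ?_)
    · rw [abs_of_nonneg (mul_nonneg (coef_pos P u x).le (sq_nonneg _))]
      by_cases hxD : x ∈ D
      · obtain ⟨T, hT, hxT⟩ := mem_iUnion₂.1 hx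
        obtain ⟨S, hS, hxS⟩ := mem_iUnion₂.1 hxD
        have hST : S = T := by
          by_contra hne
          exact notMem_of_mem_interior (hsM hS) hT hne hxT hxS
        have h1 : ψ.toFun x = ridge z n l t x := indicator_of_mem hxD _
        rw [h1]
        have h2 := ridge_nonneg z n l t x
        have h3 := ridge_le_one z n l t x
        have h4 := hcmax S hS x (hST ▸ hxT)
        calc coef P u x * ridge z n l t x ^ 2 ≤ cmax * 1 := by
              gcongr
              exact pow_le_one₀ h2 h3
          _ = cmax := mul_one _
      · rw [(hzeroD x hxD).1]; simpa using hcmax0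
    · rw [(hzero x hx).1]; simp

theorem memLp_freeWeight (hφ : M.IsNodalBasis φ) {A : Plane → Set Plane}
    (hA : ∀ q, MeasurableSet (A q)) :
    MemLp (freeWeight P M u φ χ φh A) ⊤ (volume.restrict M.domain) := by
  classical
  refine MemLp.sub (memLp_const 1) (memLp_finsetSum _ fun q hq => ?_)
  exact ((elemContinuous_of_isP1 (hφ q (Finset.mem_filter.1 hq).1).1).memLp_top).indicator (hA q)

/-- The contribution of the element residual is controlled by its norm on the patch. -/
theorem abs_volume_term_le (hu : M.IsP1 u) (hφ : M.IsNodalBasis φ) (hφh : M.IsP1 φh)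
    (hp : p ∈ M.nodes) (hpf : ¬ IsFullContact P M u χ φh p) (hn : ‖n‖ = 1) (hl : 0 < l)
    (ht : 0 < t) (htl : t ≤ l) {D : Set Plane} (hD : MeasurableSet D)
    (h0 : ∀ x ∈ M.domain, x ∉ M.patch p → D.indicator (ridge z n l t) x = 0) :
    |∫ x in M.domain, elemResidual P u φh x * D.indicator (ridge z n l t) x *
        freeWeight P M u φ χ φh M.patch x| ≤
      √(∫ x in M.patch p, elemResidual P u φh x ^ 2) * √(4 * (l * t)) := by
  have hle : volume.restrict (M.patch p) ≤ volume.restrict M.domain :=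
    Measure.restrict_mono patch_subset_domain le_rfl
  rw [setIntegral_eq_of_subset_of_forall_sdiff_eq_zero isOpen_domain.measurableSet
    (patch_subset_domain (p := p)) fun x hx => by rw [h0 x hx.1 hx.2, mul_zero, zero_mul]]
  have hr : MemLp (elemResidual P u φh) 2 (volume.restrict (M.patch p)) :=
    ((elemContinuous_elemResidual hu hφh).memLp_top.mono_exponent le_top).mono_measure hle
  have hψ : MemLp (D.indicator (ridge z n l t)) 2 (volume.restrict M.domain) :=
    (((contDiff_ridge z n l t).continuous.memLp_of_hasCompactSupport
      (hasCompactSupport_ridge hn hl ht htl)).indicator hD).restrict M.domain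
  have hψW : MemLp (fun x => D.indicator (ridge z n l t) x * freeWeight P M u φ χ φh M.patch x) 2
      (volume.restrict (M.patch p)) :=
    (MemLp.mul' (r := 2) (p := 2) (q := ⊤)
      (memLp_freeWeight hφ fun q => isOpen_patch.measurableSet) hψ).mono_measure hle
  simp_rw [mul_assoc]
  refine (abs_integral_mul_le hr hψW).trans ?_
  gcongr
  rw [restrict_patch, ← one_mul (4 * (l * t))]
  refine (le_abs_self _).trans (abs_setIntegral_le_box z hn hl.le ht.le zero_le_one _
    (Finset.measurableSet_biUnion _ fun T _ => isOpen_interior.measurableSet)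
    (fun x hx _ => ?_) fun x _ hx => ?_)
  · obtain ⟨T, hT, hxT⟩ := mem_iUnion₂.1 hx
    have hTM := (mem_star.1 hT).1
    obtain ⟨hW1, hW2⟩ := freeWeight_bounds (P := P) (u := u) (χ := χ) (φh := φh) hφ hp hpf M.patch
      hTM (interior_subset hxT)
    have hW0 := (nodalBasis_nonneg hφ hp hTM (interior_subset hxT)).trans hW1
    have h1 : 0 ≤ D.indicator (ridge z n l t) x := indicator_nonneg (fun y _ => ridge_nonneg z n l t y) x
    have h2 : D.indicator (ridge z n l t) x ≤ 1 :=
      indicator_le' (fun y _ => ridge_le_one z n l t y) (fun _ _ => zero_le_one) x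
    rw [abs_of_nonneg (sq_nonneg _)]
    exact pow_le_one₀ (mul_nonneg h1 hW0) (mul_le_one₀ h2 hW0 hW2)
  · rw [indicator_apply_eq_zero.2 fun _ => ridge_eq_zero hl ht hx]
    simp

end CutoffEstimate

/-! ### Local residual estimates -/

section Cases

variable {P : Params} {M : TriMesh} {u : Plane → Plane} {φ : Plane → Plane → ℝ}
  {χ φh : Plane → ℝ} {φhat : H1 M.domain} {p z : Plane} {l t : ℝ}
  {S T : Affine.Triangle ℝ Plane} {i i' k k' : Fin 3} {A B : Plane →ᵃ[ℝ] ℝ}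

theorem volume_line {n : Plane} (hn : ‖n‖ = 1) (z : Plane) :
    volume {x : Plane | ⟪n, x - z⟫ = 0} = 0 := by
  have hm : MeasurableSet {x : Plane | ⟪n, x - z⟫ = 0} :=
    (isClosed_singleton.preimage (f := fun x : Plane => ⟪n, x - z⟫) (by fun_prop)).measurableSet
  have hpre : frame z hn ⁻¹' {x | ⟪n, x - z⟫ = 0} = univ ×ˢ {0} := by
    ext ⟨a, b⟩
    simp [inner_frame]
  rw [← (measurePreserving_frame z hn).measure_preimage hm.nullMeasurableSet, hpre,
    Measure.volume_eq_prod, Measure.prod_prod, Real.volume_singleton, mul_zero]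

theorem integrable_inner_ridgeGrad {n : Plane} (hn : ‖n‖ = 1) (hl : 0 < l) (ht : 0 < t)
    (htl : t ≤ l) (g : Plane) : Integrable fun x => ⟪g, ridgeGrad z n l t x⟫ :=
  (continuous_const.inner (continuous_ridgeGrad z n l t)).integrable_of_hasCompactSupport
    ((hasCompactSupport_ridgeGrad hn hl ht htl).comp_left (inner_zero_right g))

/-- Estimate of an element residual of constant sign on a box inside an element. -/
theorem volume_residual_le (hu : M.IsP1 u) (hφ : M.IsNodalBasis φ) (hφh : M.IsP1 φh)
    (htop : localError P M u φ χ φh φhat p ≠ ⊤) (hp : p ∈ M.nodes)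
    (hpf : ¬ IsFullContact P M u χ φh p) (hT : T ∈ M.star p) (hk : T.points k = p) {n : Plane}
    (hn : ‖n‖ = 1) (hl : 0 < l)
    (hbox : ∀ x ∈ box z n l l, ∀ i, 1 / 4 < bary T i x ∧ bary T i x < 3 / 4) {cmax : ℝ}
    (hcmax : ∀ x ∈ interior (carrier T), coef P u x ≤ cmax) {s m : ℝ} (hs : |s| = 1) (hm : 0 ≤ m)
    (hsign : ∀ x ∈ box z n l l, m ≤ s * elemResidual P u φh x) :
    m / 4 * (l * l) ≤ (localError P M u φ χ φh φhat p).toReal *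
      √(P.Gc * P.eps * ((2 * bumpSlope / l) ^ 2 * (4 * (l * l))) + cmax * (4 * (l * l))) := by
  classical
  have hTM := (mem_star.1 hT).1
  have hboxT : box z n l l ⊆ interior (carrier T) := fun x hx =>
    (mem_interior_iff T).2 fun i => by linarith [(hbox x hx i).1]
  have hDeq : (⋃ S ∈ ({T} : Finset (Affine.Triangle ℝ Plane)), carrier S) = carrier T := by simp
  have hest := cutoff_residual_le (φhat := φhat) (χ := χ) (s := {T}) (cmax := cmax) hu hφ hφh htop
    hn hl hl le_rfl (by simpa using hT) (by
      rw [hDeq]; exact fun x hx _ h => h.2 (hboxT hx)) (by rw [hDeq]; exact fun _ => hboxT)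
    (by simpa using fun x hx _ i => (hbox x hx i).2) (by simpa using hcmax)
  rw [hDeq] at hest
  have hboxΩ : box z n l l ⊆ M.domain := hboxT.trans (interior_subset_domain hTM)
  have hridge : (carrier T).indicator (ridge z n l l) = ridge z n l l := by
    ext x
    by_cases hx : x ∈ carrier T
    · exact indicator_of_mem hx _
    · rw [indicator_of_notMem hx, ridge_eq_zero hl hl fun h => hx (interior_subset (hboxT h))]
  have hridgeGrad : (carrier T).indicator (ridgeGrad z n l l) = ridgeGrad z n l l := by
    ext1 x
    by_cases hx : x ∈ carrier T
    · exact indicator_of_mem hx _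
    · rw [indicator_of_notMem hx, ridgeGrad_eq_zero hl hl fun h => hx (interior_subset (hboxT h))]
  rw [hridge, hridgeGrad] at hest
  obtain ⟨A, hA⟩ := hφh.2 T hTM
  -- The gradient of φ_h is constant on the support of the bump, so only the residual term is left;
  -- the sides are not met either.
  have hgrad : ∫ x in M.domain, ⟪(∇ φh) x, ridgeGrad z n l l x⟫ = 0 := by
    have e : ∀ x, ⟪(∇ φh) x, ridgeGrad z n l l x⟫ = ⟪affGrad A, ridgeGrad z n l l x⟫ := by
      intro x
      by_cases hx : x ∈ box z n l l
      · rw [gradient_of_mem_interior T hA (hboxT hx)]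
      · rw [ridgeGrad_eq_zero hl hl hx, inner_zero_right, inner_zero_right]
    simp_rw [e]
    rw [setIntegral_eq_integral_of_forall_compl_eq_zero fun x hx => by
      rw [ridgeGrad_eq_zero hl hl fun h => hx (hboxΩ h), inner_zero_right]]
    have h := setIntegral_inner_ridgeGrad (z := z) hn hl hl (affGrad A) univ
    simp only [mem_univ, ofPred_true, setIntegral_univ, integral_deriv_cut hl, mul_zero] at h
    exact h
  have hside : ∀ q, ∫ x in M.innerSides q, P.Gc * P.eps * M.jump φh x * ridge z n l l x *
      φ q x ∂μH[1] = 0 := fun q => setIntegral_eq_zero_of_forall_eq_zero fun x hx => by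
    rw [ridge_eq_zero hl hl fun h => notMem_innerSides_of_mem_interior hTM (hboxT h) q hx]
    ring
  rw [hgrad, mul_zero, sub_zero, Finset.sum_congr rfl fun q _ => hside q, Finset.sum_const_zero,
    sub_zero] at hest
  refine le_trans ?_ hest
  set I := ∫ x in M.domain, elemResidual P u φh x * ridge z n l l x *
    freeWeight P M u φ χ φh M.patch x
  -- The factor 1/4 is the lower bound of the weight by the coordinate of p, and l · l bounds the
  -- integral of the bump from below.
  have hI : m / 4 * (l * l) ≤ s * I := by
    rw [← integral_const_mul]
    have hridgeInt : Integrable (ridge z n l l) :=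
      (contDiff_ridge z n l l).continuous.integrable_of_hasCompactSupport
        (hasCompactSupport_ridge hn hl hl le_rfl)
    have hridge2 : MemLp (ridge z n l l) 2 (volume.restrict M.domain) :=
      ((contDiff_ridge z n l l).continuous.memLp_of_hasCompactSupport
        (hasCompactSupport_ridge hn hl hl le_rfl)).restrict M.domain
    have h1 : m / 4 * (l * l) ≤ ∫ x in M.domain, m / 4 * ridge z n l l x := by
      rw [integral_const_mul, setIntegral_eq_integral_of_forall_compl_eq_zero fun x hx =>
        ridge_eq_zero hl hl fun h => hx (hboxΩ h)]
      gcongr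
      exact le_integral_ridge hn hl hl
    refine h1.trans (setIntegral_mono_on (hridgeInt.integrableOn.const_mul _) ?_
      isOpen_domain.measurableSet fun x _ => ?_)
    · exact (integrable_mul_mul (elemContinuous_elemResidual hu hφh).memLp_top hridge2
        ((memLp_freeWeight hφ fun q => isOpen_patch.measurableSet).mono_exponent le_top)).const_mul s
    · by_cases hx : x ∈ box z n l l
      · have hxT := interior_subset (hboxT hx)
        have h2 := hsign x hx
        have h3 := (freeWeight_bounds (P := P) (u := u) (χ := χ) (φh := φh) hφ hp hpf M.patch
          hTM hxT).1
        have h4 := bary_le_nodalBasis hφ hp hTM hk hxT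
        have h5 := (hbox x hx k).1
        have h6 := ridge_nonneg z n l l x
        have h7 : m * (1 / 4) ≤ s * elemResidual P u φh x * freeWeight P M u φ χ φh M.patch x :=
          mul_le_mul h2 (by linarith) (by norm_num) (hm.trans h2)
        calc m / 4 * ridge z n l l x = m * (1 / 4) * ridge z n l l x := by ring
          _ ≤ s * elemResidual P u φh x * freeWeight P M u φ χ φh M.patch x * ridge z n l l x := by
            gcongr
          _ = _ := by ring
      · rw [ridge_eq_zero hl hl hx]; simp
  calc m / 4 * (l * l) ≤ |s * I| := hI.trans (le_abs_self _)
    _ = |I| := by rw [abs_mul, hs, one_mul]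

/-- Estimate of the jump across the common side of two elements. -/
theorem jump_residual_le (hu : M.IsP1 u) (hφ : M.IsNodalBasis φ) (hφh : M.IsP1 φh)
    (htop : localError P M u φ χ φh φhat p ≠ ⊤) (hp : p ∈ M.nodes)
    (hpf : ¬ IsFullContact P M u χ φh p) (hT : T ∈ M.star p) (hS : S ∈ M.star p) (hne : T ≠ S)
    (hk : T.points k = p) (hki : k ≠ i) (hzT : OnSide T i z) (hzS : OnSide S i' z)
    (hA : EqOn φh A (carrier T)) (hB : EqOn φh B (carrier S)) (ht : 0 < t) (htl : t ≤ l)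
    (hboxT : ∀ x ∈ box z (outerNormal T i) l t,
      (∀ j, j ≠ i → 1 / 4 < bary T j x) ∧ ∀ j, bary T j x < 3 / 4)
    (hboxS : ∀ x ∈ box z (outerNormal T i) l t,
      (∀ j, j ≠ i' → 1 / 4 < bary S j x) ∧ ∀ j, bary S j x < 3 / 4) {cmax : ℝ}
    (hcT : ∀ x ∈ interior (carrier T), coef P u x ≤ cmax)
    (hcS : ∀ x ∈ interior (carrier S), coef P u x ≤ cmax) :
    P.Gc * P.eps * |⟪affGrad A, outerNormal T i⟫ - ⟪affGrad B, outerNormal T i⟫| * (l / 4) ≤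
      (localError P M u φ χ φh φhat p).toReal *
        √(P.Gc * P.eps * ((2 * bumpSlope / t) ^ 2 * (4 * (l * t))) + cmax * (4 * (l * t))) +
      √(∫ x in M.patch p, elemResidual P u φh x ^ 2) * √(4 * (l * t)) := by
  classical
  set n := outerNormal T i with hndef
  have hn : ‖n‖ = 1 := norm_outerNormal T i
  have hl : 0 < l := ht.trans_le htl
  have hTM := (mem_star.1 hT).1
  have hSM := (mem_star.1 hS).1
  have hnS : outerNormal S i' = -n := hzT.outerNormal_eq_neg hTM hSM hne hzS
  have hiT : ∀ x, T.height i * bary T i x = - ⟪n, x - z⟫ := fun x => by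
    rw [hndef, inner_outerNormal_eq, hzT.1]; ring
  have hiS : ∀ x, S.height i' * bary S i' x = ⟪n, x - z⟫ := fun x => by
    have := inner_outerNormal_eq S i' x z
    rw [hnS, inner_neg_left, hzS.1] at this
    linarith
  have hhT := T.height_pos i
  have hhS := S.height_pos i'
  -- position of the points of the box
  have hTint : ∀ x ∈ box z n l t, ⟪n, x - z⟫ < 0 → x ∈ interior (carrier T) := by
    intro x hx h
    rw [mem_interior_iff]
    intro j
    rcases eq_or_ne j i with rfl | hj
    · exact pos_of_mul_pos_right (by rw [hiT]; linarith) hhT.le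
    · linarith [(hboxT x hx).1 j hj]
  have hSint : ∀ x ∈ box z n l t, 0 < ⟪n, x - z⟫ → x ∈ interior (carrier S) := by
    intro x hx h
    rw [mem_interior_iff]
    intro j
    rcases eq_or_ne j i' with rfl | hj
    · exact pos_of_mul_pos_right (by rw [hiS]; linarith) hhS.le
    · linarith [(hboxS x hx).1 j hj]
  have hline : ∀ x ∈ box z n l t, ⟪n, x - z⟫ = 0 → OnSide T i x ∧ OnSide S i' x := by
    intro x hx h
    refine ⟨⟨?_, fun j hj => by linarith [(hboxT x hx).1 j hj]⟩,
      ⟨?_, fun j hj => by linarith [(hboxS x hx).1 j hj]⟩⟩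
    · have := hiT x
      rw [h, neg_zero, mul_eq_zero] at this
      exact this.resolve_left hhT.ne'
    · have := hiS x
      rw [h, mul_eq_zero] at this
      exact this.resolve_left hhS.ne'
  set D : Set Plane := ⋃ R ∈ ({T, S} : Finset (Affine.Triangle ℝ Plane)), carrier R with hDdef
  have hTD : interior (carrier T) ⊆ interior D :=
    interior_mono (subset_biUnion_of_mem (u := fun R => carrier R)
      (show T ∈ ({T, S} : Finset (Affine.Triangle ℝ Plane)) by simp))
  have hSD : interior (carrier S) ⊆ interior D :=
    interior_mono (subset_biUnion_of_mem (u := fun R => carrier R)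
      (show S ∈ ({T, S} : Finset (Affine.Triangle ℝ Plane)) by simp))
  have hboxD : box z n l t ⊆ interior D := by
    intro x hx
    rcases lt_trichotomy ⟪n, x - z⟫ 0 with h | h | h
    · exact hTD (hTint x hx h)
    · obtain ⟨h1, h2⟩ := hline x hx h
      rw [mem_interior_iff_mem_nhds]
      filter_upwards [h1.eventually_mem_or hTM hSM hne h2] with y hy
      simpa [hDdef] using hy
    · exact hSD (hSint x hx h)
  have hsub : ({T, S} : Finset (Affine.Triangle ℝ Plane)) ⊆ M.star p := by
    simp [Finset.insert_subset_iff, hT, hS]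
  have hDpatch : interior D ⊆ M.patch p :=
    interior_mono (biUnion_subset_biUnion_left fun R hR => hsub hR)
  have hboxΩ : box z n l t ⊆ M.domain := (hboxD.trans hDpatch).trans patch_subset_domain
  have hest := cutoff_residual_le (φhat := φhat) (χ := χ) (s := {T, S}) (cmax := cmax) hu hφ hφh
    htop hn hl ht htl hsub (fun x hx _ h => h.2 (hboxD hx)) (fun _ => hboxD)
    (by simpa using ⟨fun x hx _ j => (hboxT x hx).2 j, fun x hx _ j => (hboxS x hx).2 j⟩)
    (by simpa using ⟨hcT, hcS⟩)
  have hvol := abs_volume_term_le (χ := χ) (z := z) (D := D) hu hφ hφh hp hpf hn hl ht htl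
    (isClosed_union _).measurableSet fun x _ hx => indicator_apply_eq_zero.2 fun _ =>
      ridge_eq_zero hl ht fun h => hx (hDpatch (hboxD h))
  rw [← hDdef] at hest
  have hridge : D.indicator (ridge z n l t) = ridge z n l t := by
    ext x
    by_cases hx : x ∈ D
    · exact indicator_of_mem hx _
    · rw [indicator_of_notMem hx, ridge_eq_zero hl ht fun h => hx (interior_subset (hboxD h))]
  have hridgeGrad : D.indicator (ridgeGrad z n l t) = ridgeGrad z n l t := by
    ext1 x
    by_cases hx : x ∈ D
    · exact indicator_of_mem hx _
    · rw [indicator_of_notMem hx, ridgeGrad_eq_zero hl ht fun h => hx (interior_subset (hboxD h))]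
  rw [hridge, hridgeGrad] at hest
  rw [hridge] at hvol
  set κ := ⟪affGrad A, n⟫ - ⟪affGrad B, n⟫ with hκ
  -- the gradient term
  have hgrad : ∫ x in M.domain, ⟪(∇ φh) x, ridgeGrad z n l t x⟫ = (∫ a, cut l a) * κ := by
    rw [setIntegral_eq_integral_of_forall_compl_eq_zero fun x hx => by
      rw [ridgeGrad_eq_zero hl ht fun h => hx (hboxΩ h), inner_zero_right]]
    have hae : (fun x => ⟪(∇ φh) x, ridgeGrad z n l t x⟫) =ᵐ[volume] fun x =>
        {x | ⟪n, x - z⟫ ∈ Iio (0 : ℝ)}.indicator (fun x => ⟪affGrad A, ridgeGrad z n l t x⟫) x +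
        {x | ⟪n, x - z⟫ ∈ Ioi (0 : ℝ)}.indicator (fun x => ⟪affGrad B, ridgeGrad z n l t x⟫) x := by
      have h0 : ∀ᵐ x : Plane, ⟪n, x - z⟫ ≠ 0 := by
        rw [ae_iff]; simpa using volume_line hn z
      filter_upwards [h0] with x hx
      by_cases hb : x ∈ box z n l t
      · rcases lt_or_gt_of_ne hx with h | h
        · rw [indicator_of_mem (by exact h), indicator_of_notMem (by exact h.not_gt), add_zero,
            gradient_of_mem_interior T hA (hTint x hb h)]
        · rw [indicator_of_notMem (by exact h.not_gt), indicator_of_mem (by exact h), zero_add,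
            gradient_of_mem_interior S hB (hSint x hb h)]
      · have h1 := ridgeGrad_eq_zero hl ht hb
        rw [indicator_apply_eq_zero.2 fun _ => by rw [h1, inner_zero_right],
          indicator_apply_eq_zero.2 fun _ => by rw [h1, inner_zero_right], h1, inner_zero_right,
          add_zero]
    have hm : ∀ J : Set ℝ, MeasurableSet J → MeasurableSet {x : Plane | ⟪n, x - z⟫ ∈ J} :=
      fun J hJ => hJ.preimage (by fun_prop : Continuous fun x : Plane => ⟪n, x - z⟫).measurable
    rw [integral_congr_ae hae, integral_add
      ((integrable_inner_ridgeGrad hn hl ht htl _).indicator (hm _ measurableSet_Iio))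
      ((integrable_inner_ridgeGrad hn hl ht htl _).indicator (hm _ measurableSet_Ioi)),
      integral_indicator (hm _ measurableSet_Iio), integral_indicator (hm _ measurableSet_Ioi),
      setIntegral_inner_ridgeGrad hn hl ht, setIntegral_inner_ridgeGrad hn hl ht,
      integral_Iio_deriv_cut ht, integral_Ioi_deriv_cut ht, hκ]
    ring
  -- the terms on the sides
  have hbox_line : ∀ a, a ∈ Icc (-l) l → z + a • rot n ∈ box z n l t ∧
      ⟪n, z + a • rot n - z⟫ = 0 := by
    intro a ha
    have h := frame_apply z hn (a, 0)
    simp only [zero_smul, add_zero] at h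
    rw [← h, inner_frame]
    refine ⟨⟨?_, ?_⟩, rfl⟩
    · rwa [inner_rot_frame]
    · rw [inner_frame]; exact ⟨by linarith, ht.le⟩
  have hcut0 : ∀ a, a ∉ Icc (-l) l → cut l a = 0 := fun a ha =>
    cut_eq_zero hl (by by_contra! h; exact ha (abs_le.1 h.le))
  have hside : ∀ q, ∫ x in M.innerSides q, P.Gc * P.eps * M.jump φh x * ridge z n l t x *
      φ q x ∂μH[1] = -(P.Gc * P.eps * κ) *
        ∫ a, cut l a * (M.innerSides q).indicator (φ q) (z + a • rot n) := by
    intro q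
    rw [setIntegral_hausdorff_line hn (z := z) (measurableSet_innerSides q), ← integral_const_mul]
    · congr 1
      ext a
      by_cases hq : z + a • rot n ∈ M.innerSides q
      · rw [indicator_of_mem hq, indicator_of_mem hq, ridge_line hn]
        by_cases ha : a ∈ Icc (-l) l
        · obtain ⟨h1, h2⟩ := hbox_line a ha
          obtain ⟨h3, h4⟩ := hline _ h1 h2
          rw [TriMesh.jump, h3.normalFlux_eq hTM hSM hne h4 hA hB]
          ring
        · rw [hcut0 a ha]; ring
      · rw [indicator_of_notMem hq, indicator_of_notMem hq]; ring
    · intro x hx hx0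
      rw [ridge_eq_zero hl ht fun hb => ?_]
      · ring
      rcases lt_or_gt_of_ne hx0 with h | h
      · exact notMem_innerSides_of_mem_interior hTM (hTint x hb h) q hx
      · exact notMem_innerSides_of_mem_interior hSM (hSint x hb h) q hx
  have hcarT : ∀ a ∈ Icc (-l) l, z + a • rot n ∈ carrier T := fun a ha =>
    (hline _ (hbox_line a ha).1 (hbox_line a ha).2).1.mem_carrier
  have hint : ∀ q ∈ M.nodes, Integrable fun a =>
      cut l a * (M.innerSides q).indicator (φ q) (z + a • rot n) := by
    intro q hq
    obtain ⟨C, hC⟩ := (hφ q hq).1.2 T hTM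
    have hcont : Continuous fun a : ℝ => z + a • rot n := by fun_prop
    have e : (fun a => cut l a * (M.innerSides q).indicator (φ q) (z + a • rot n)) =
        ((fun a : ℝ => z + a • rot n) ⁻¹' M.innerSides q).indicator
          fun a => cut l a * C (z + a • rot n) := by
      ext a
      by_cases ha : a ∈ Icc (-l) l
      · by_cases hq : z + a • rot n ∈ M.innerSides q
        · rw [indicator_of_mem hq, indicator_of_mem (by exact hq), hC (hcarT a ha)]
        · rw [indicator_of_notMem hq, indicator_of_notMem (by exact hq), mul_zero]
      · rw [hcut0 a ha, zero_mul, eq_comm]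
        exact indicator_apply_eq_zero.2 fun _ => by rw [hcut0 a ha, zero_mul]
    rw [e]
    refine Integrable.indicator ?_ ((measurableSet_innerSides q).preimage hcont.measurable)
    exact ((contDiff_cut l).continuous.mul ((continuous_affineMap C).comp hcont)
      ).integrable_of_hasCompactSupport (hasCompactSupport_cut hl).mul_right
  -- The gradient term contributes −G_c ε κ ∫ cut, where −κ is the jump, and each full-contact node
  -- removes its share φ_q of it. Together they give −G_c ε κ J, and J ≥ l / 4 as the weight is at
  -- least 1/4 along the segment.
  set J := ∫ a, cut l a * freeWeight P M u φ χ φh M.innerSides (z + a • rot n) with hJ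
  have hJint : Integrable fun a => cut l a *
      freeWeight P M u φ χ φh M.innerSides (z + a • rot n) := by
    simp only [freeWeight, mul_sub, mul_one, Finset.mul_sum]
    exact (integrable_cut hl).sub (integrable_finsetSum _ fun q hq =>
      hint q (Finset.mem_filter.1 hq).1)
  have hJeq : J = (∫ a, cut l a) - ∑ q ∈ M.nodes.filter (IsFullContact P M u χ φh),
      ∫ a, cut l a * (M.innerSides q).indicator (φ q) (z + a • rot n) := by
    rw [hJ, ← integral_finsetSum _ fun q hq => hint q (Finset.mem_filter.1 hq).1,
      ← integral_sub (integrable_cut hl) (integrable_finsetSum _ fun q hq =>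
        hint q (Finset.mem_filter.1 hq).1)]
    simp only [freeWeight, mul_sub, mul_one, Finset.mul_sum]
  have hJge : l / 4 ≤ J := by
    have h1 : l / 4 ≤ ∫ a, 1 / 4 * cut l a := by
      rw [integral_const_mul]
      linarith [le_integral_cut hl]
    refine h1.trans (integral_mono ((integrable_cut hl).const_mul _) hJint fun a => ?_)
    by_cases ha : a ∈ Icc (-l) l
    · have h2 := (freeWeight_bounds (P := P) (u := u) (χ := χ) (φh := φh) hφ hp hpf M.innerSides
          hTM (hcarT a ha)).1
      have h3 := bary_le_nodalBasis hφ hp hTM hk (hcarT a ha)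
      have h4 := (hboxT _ (hbox_line a ha).1).1 k hki
      have h5 := cut_nonneg l a
      simp only
      nlinarith
    · simp only [hcut0 a ha]; simp
  rw [hgrad, Finset.sum_congr rfl fun q _ => hside q, ← Finset.mul_sum] at hest
  set I := ∫ x in M.domain, elemResidual P u φh x * ridge z n l t x *
    freeWeight P M u φ χ φh M.patch x
  have hI : I - P.Gc * P.eps * ((∫ a, cut l a) * κ) - -(P.Gc * P.eps * κ) *
      ∑ q ∈ M.nodes.filter (IsFullContact P M u χ φh),
        ∫ a, cut l a * (M.innerSides q).indicator (φ q) (z + a • rot n) =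
      I - P.Gc * P.eps * κ * J := by
    rw [hJeq]; ring
  rw [hI] at hest
  have hP : 0 < P.Gc * P.eps := mul_pos P.Gc_pos P.eps_pos
  have h1 : P.Gc * P.eps * |κ| * (l / 4) ≤ |P.Gc * P.eps * κ * J| := by
    rw [abs_mul, abs_mul, abs_of_pos hP]
    gcongr
    exact hJge.trans (le_abs_self _)
  have h2 := abs_sub_abs_le_abs_sub (P.Gc * P.eps * κ * J) I
  rw [abs_sub_comm] at h2
  linarith

/-- Estimate of the normal derivative on a boundary side. -/
theorem boundary_residual_le (hu : M.IsP1 u) (hφ : M.IsNodalBasis φ) (hφh : M.IsP1 φh)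
    (htop : localError P M u φ χ φh φhat p ≠ ⊤) (hp : p ∈ M.nodes)
    (hpf : ¬ IsFullContact P M u χ φh p) (hpΩ : p ∉ M.domain) (hT : T ∈ M.star p)
    (hzT : OnSide T i z) (hA : EqOn φh A (carrier T)) (ht : 0 < t) (htl : t ≤ l)
    (hboxT : ∀ x ∈ box z (outerNormal T i) l t,
      (∀ j, j ≠ i → 1 / 4 < bary T j x) ∧ ∀ j, bary T j x < 3 / 4)
    (hboxΩ : ∀ x ∈ box z (outerNormal T i) l t, OnSide T i x → x ∉ M.domain) {cmax : ℝ}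
    (hcT : ∀ x ∈ interior (carrier T), coef P u x ≤ cmax) :
    P.Gc * P.eps * |⟪affGrad A, outerNormal T i⟫| * (l / 4) ≤
      (localError P M u φ χ φh φhat p).toReal *
        √(P.Gc * P.eps * ((2 * bumpSlope / t) ^ 2 * (4 * (l * t))) + cmax * (4 * (l * t))) +
      √(∫ x in M.patch p, elemResidual P u φh x ^ 2) * √(4 * (l * t)) := by
  classical
  set n := outerNormal T i with hndef
  have hn : ‖n‖ = 1 := norm_outerNormal T i
  have hl : 0 < l := ht.trans_le htl
  have hTM := (mem_star.1 hT).1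
  have hiT : ∀ x, T.height i * bary T i x = - ⟪n, x - z⟫ := fun x => by
    rw [hndef, inner_outerNormal_eq, hzT.1]; ring
  have hhT := T.height_pos i
  have hTint : ∀ x ∈ box z n l t, ⟪n, x - z⟫ < 0 → x ∈ interior (carrier T) := by
    intro x hx h
    rw [mem_interior_iff]
    intro j
    rcases eq_or_ne j i with rfl | hj
    · exact pos_of_mul_pos_right (by rw [hiT]; linarith) hhT.le
    · linarith [(hboxT x hx).1 j hj]
  have hTnot : ∀ x, 0 < ⟪n, x - z⟫ → x ∉ carrier T := by
    intro x h hx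
    have := mul_nonneg hhT.le ((mem_carrier_iff T).1 hx i)
    rw [hiT] at this
    linarith
  have hline : ∀ x ∈ box z n l t, ⟪n, x - z⟫ = 0 → OnSide T i x := by
    intro x hx h
    refine ⟨?_, fun j hj => by linarith [(hboxT x hx).1 j hj]⟩
    have := hiT x
    rw [h, neg_zero, mul_eq_zero] at this
    exact this.resolve_left hhT.ne'
  -- in the domain, the part of the box in the closed element is in the open element
  have hmem : ∀ x ∈ box z n l t, x ∈ M.domain → x ∈ carrier T → x ∈ interior (carrier T) := by
    intro x hx hxΩ hxT
    rcases lt_trichotomy ⟪n, x - z⟫ 0 with h | h | h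
    · exact hTint x hx h
    · exact (hboxΩ x hx (hline x hx h) hxΩ).elim
    · exact (hTnot x h hxT).elim
  have hDeq : (⋃ R ∈ ({T} : Finset (Affine.Triangle ℝ Plane)), carrier R) = carrier T := by simp
  have hest := cutoff_residual_le (φhat := φhat) (χ := χ) (s := {T}) (cmax := cmax) hu hφ hφh htop
    hn hl ht htl (by simpa using hT) (by
      rw [hDeq]
      exact fun x hx hxΩ h => h.2 (hmem x hx hxΩ ((isClosed_carrier T).frontier_subset h)))
    (fun h => (hpΩ h).elim) (by simpa using fun x hx _ j => (hboxT x hx).2 j) (by simpa using hcT)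
  rw [hDeq] at hest
  have hvol := abs_volume_term_le (χ := χ) (z := z) hu hφ hφh hp hpf hn hl ht htl
    (isClosed_carrier T).measurableSet fun x hxΩ hx => indicator_apply_eq_zero.2 fun hxT =>
      ridge_eq_zero hl ht fun hb => hx (interior_subset_patch hT (hmem x hb hxΩ hxT))
  -- Inside Ω the truncated bump lives on the open element, so no interior side sees it.
  have hside : ∀ q, ∫ x in M.innerSides q, P.Gc * P.eps * M.jump φh x *
      (carrier T).indicator (ridge z n l t) x * φ q x ∂μH[1] = 0 := fun q =>
    setIntegral_eq_zero_of_forall_eq_zero fun x hx => by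
      rw [indicator_apply_eq_zero.2 fun hxT => ridge_eq_zero hl ht fun hb =>
        notMem_innerSides_of_mem_interior hTM
          (hmem x hb (patch_subset_domain hx.1) hxT) q hx]
      ring
  -- Truncation leaves only the half of the box in T, hence a one-sided normal derivative. No
  -- full-contact term interferes, so no lower bound of the weight is needed.
  have hgrad : ∫ x in M.domain, ⟪(∇ φh) x, (carrier T).indicator (ridgeGrad z n l t) x⟫ =
      (∫ a, cut l a) * ⟪affGrad A, n⟫ := by
    rw [← integral_indicator isOpen_domain.measurableSet]
    have hae : (M.domain.indicator fun x =>
        ⟪(∇ φh) x, (carrier T).indicator (ridgeGrad z n l t) x⟫) =ᵐ[volume]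
        {x | ⟪n, x - z⟫ ∈ Iio (0 : ℝ)}.indicator fun x => ⟪affGrad A, ridgeGrad z n l t x⟫ := by
      have h0 : ∀ᵐ x : Plane, ⟪n, x - z⟫ ≠ 0 := by
        rw [ae_iff]; simpa using volume_line hn z
      filter_upwards [h0] with x hx
      by_cases hb : x ∈ box z n l t
      · rcases lt_or_gt_of_ne hx with h | h
        · have hxT := hTint x hb h
          rw [indicator_of_mem (interior_subset_domain hTM hxT),
            indicator_of_mem (interior_subset hxT), indicator_of_mem (by exact h),
            gradient_of_mem_interior T hA hxT]
        · rw [indicator_of_notMem (s := {x | ⟪n, x - z⟫ ∈ Iio (0 : ℝ)}) (by exact h.not_gt)]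
          exact indicator_apply_eq_zero.2 fun _ => by
            rw [indicator_of_notMem (hTnot x h), inner_zero_right]
      · have h1 := ridgeGrad_eq_zero hl ht hb
        rw [indicator_apply_eq_zero.2 fun _ => by
            rw [indicator_apply_eq_zero.2 fun _ => h1, inner_zero_right],
          indicator_apply_eq_zero.2 fun _ => by rw [h1, inner_zero_right]]
    have hm : MeasurableSet {x : Plane | ⟪n, x - z⟫ ∈ Iio (0 : ℝ)} :=
      measurableSet_Iio.preimage (by fun_prop : Continuous fun x : Plane => ⟪n, x - z⟫).measurable
    rw [integral_congr_ae hae, integral_indicator hm, setIntegral_inner_ridgeGrad hn hl ht,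
      integral_Iio_deriv_cut ht, mul_one]
  rw [hgrad, Finset.sum_congr rfl fun q _ => hside q, Finset.sum_const_zero, sub_zero] at hest
  have hP : 0 < P.Gc * P.eps := mul_pos P.Gc_pos P.eps_pos
  have hcl := le_integral_cut hl
  have h1 : P.Gc * P.eps * |⟪affGrad A, n⟫| * (l / 4) ≤
      |P.Gc * P.eps * ((∫ a, cut l a) * ⟪affGrad A, n⟫)| := by
    rw [abs_mul (P.Gc * P.eps), abs_mul (∫ a, cut l a), abs_of_pos hP, mul_comm |∫ a, cut l a|,
      ← mul_assoc]
    gcongr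
    exact (by linarith : l / 4 ≤ ∫ a, cut l a).trans (le_abs_self _)
  have h2 := abs_sub_abs_le_abs_sub (P.Gc * P.eps * ((∫ a, cut l a) * ⟪affGrad A, n⟫))
    (∫ x in M.domain, elemResidual P u φh x * (carrier T).indicator (ridge z n l t) x *
      freeWeight P M u φ χ φh M.patch x)
  rw [abs_sub_comm] at h2
  linarith

end Cases

/-! ### The weights and the size of the boxes -/

section Weight

variable {P : Params} {M : TriMesh} {u : Plane → Plane} {p : Plane} {σ K : ℝ}

theorem openElems_nonempty (hp : p ∈ M.nodes) : (M.openElems p).Nonempty := by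
  obtain ⟨T, hT⟩ := star_nonempty hp
  obtain ⟨x, hx⟩ := interior_nonempty T
  exact ⟨x, mem_iUnion₂.2 ⟨T, hT, hx⟩⟩

theorem Gc_div_eps_le_alpha (hp : p ∈ M.nodes) : P.Gc / P.eps ≤ alpha P M u p :=
  le_csInf ((openElems_nonempty hp).image _) (by rintro _ ⟨x, -, rfl⟩; exact le_coef P u x)

theorem alpha_pos (hp : p ∈ M.nodes) : 0 < alpha P M u p :=
  (Gc_div_eps_pos P).trans_le (Gc_div_eps_le_alpha hp)

theorem weight_pos (hp : p ∈ M.nodes) : 0 < weight P M u p :=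
  lt_min (div_pos (patchDiam_pos hp) (Real.sqrt_pos.2 (mul_pos P.Gc_pos P.eps_pos)))
    (Real.rpow_pos_of_pos (alpha_pos hp) _)

theorem weight_mul_sqrt_le : weight P M u p * √(P.Gc * P.eps) ≤ M.patchDiam p :=
  (le_div_iff₀ (Real.sqrt_pos.2 (mul_pos P.Gc_pos P.eps_pos))).1 (min_le_left _ _)

theorem weight_sq_mul_le (hp : p ∈ M.nodes) :
    weight P M u p ^ 2 * (P.Gc * P.eps) ≤ M.patchDiam p ^ 2 := by
  have h := pow_le_pow_left₀ (by have := weight_pos (P := P) (u := u) hp; positivity)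
    (weight_mul_sqrt_le (P := P) (M := M) (u := u) (p := p)) 2
  rwa [mul_pow, Real.sq_sqrt (mul_pos P.Gc_pos P.eps_pos).le] at h

theorem weight_sq_mul_alpha_le (hp : p ∈ M.nodes) :
    weight P M u p ^ 2 * alpha P M u p ≤ 1 := by
  have ha := alpha_pos (P := P) (u := u) hp
  have h := pow_le_pow_left₀ (weight_pos (P := P) (u := u) hp).le
    (min_le_right _ _ : weight P M u p ≤ alpha P M u p ^ (-(1 / 2) : ℝ)) 2
  rw [← Real.rpow_mul_natCast ha.le] at h
  norm_num at h
  rw [Real.rpow_neg_one] at h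
  calc _ ≤ (alpha P M u p)⁻¹ * alpha P M u p := by gcongr
    _ = 1 := inv_mul_cancel₀ ha.ne'

/-- The geometric mean of m² G_c ε ≤ h² and m² G_c / ε ≤ 1; this is how ε drops out of the
oscillation condition. -/
theorem weight_sq_mul_Gc_le (hp : p ∈ M.nodes) :
    weight P M u p ^ 2 * P.Gc ≤ M.patchDiam p := by
  have hG := P.Gc_pos
  have he := P.eps_pos
  have hw := weight_pos (P := P) (u := u) hp
  have hh := patchDiam_pos hp
  have h1 := weight_sq_mul_le (P := P) (u := u) hp
  have h2 : weight P M u p ^ 2 * (P.Gc / P.eps) ≤ 1 :=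
    (mul_le_mul_of_nonneg_left (Gc_div_eps_le_alpha hp) (sq_nonneg _)).trans
      (weight_sq_mul_alpha_le hp)
  refine (sq_le_sq₀ (by positivity) hh.le).1 ?_
  calc (weight P M u p ^ 2 * P.Gc) ^ 2
      = weight P M u p ^ 2 * (P.Gc * P.eps) * (weight P M u p ^ 2 * (P.Gc / P.eps)) := by
        field_simp
    _ ≤ M.patchDiam p ^ 2 * 1 := by gcongr
    _ = M.patchDiam p ^ 2 := mul_one _

/-- An upper bound of the reaction coefficient on the patch of `p`. -/
def coefBound (P : Params) (M : TriMesh) (u : Plane → Plane) (K : ℝ) (p : Plane) : ℝ :=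
  alpha P M u p + K * P.Gc / M.patchDiam p

theorem nonneg_of_oscillation_le (hp : p ∈ M.nodes) (hK : ∀ x ∈ M.openElems p,
    ∀ y ∈ M.openElems p, M.patchDiam p *
      ((1 - P.kappa) * (energyDensity P u x - energyDensity P u y)) ≤ K * P.Gc) : 0 ≤ K := by
  obtain ⟨x, hx⟩ := openElems_nonempty hp
  have h := hK x hx x hx
  rw [sub_self, mul_zero, mul_zero] at h
  exact nonneg_of_mul_nonneg_left h P.Gc_pos

theorem coef_le_coefBound (hp : p ∈ M.nodes) (hK : ∀ x ∈ M.openElems p,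
    ∀ y ∈ M.openElems p, M.patchDiam p *
      ((1 - P.kappa) * (energyDensity P u x - energyDensity P u y)) ≤ K * P.Gc)
    {x : Plane} (hx : x ∈ M.openElems p) : coef P u x ≤ coefBound P M u K p := by
  rw [coefBound, ← sub_le_iff_le_add]
  refine le_csInf ((openElems_nonempty hp).image _) ?_
  rintro _ ⟨y, hy, rfl⟩
  have h := hK x hx y hy
  rw [← le_div_iff₀' (patchDiam_pos hp)] at h
  simp only [coef]
  linarith

/-- The term with α_p contributes at most 1 by the choice of the weight, and the oscillation term at
most K. -/
theorem weight_sq_mul_coefBound_le (hp : p ∈ M.nodes) (hK : 0 ≤ K) :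
    weight P M u p ^ 2 * coefBound P M u K p ≤ 1 + K := by
  have h1 := weight_sq_mul_alpha_le (P := P) (u := u) hp
  have h2 := weight_sq_mul_Gc_le (P := P) (u := u) hp
  rw [← div_le_one (patchDiam_pos hp)] at h2
  rw [coefBound, mul_add]
  have : weight P M u p ^ 2 * (K * P.Gc / M.patchDiam p) =
    K * (weight P M u p ^ 2 * P.Gc / M.patchDiam p) := by ring
  rw [this]
  nlinarith

/-- The size of the boxes carrying the test functions, relative to the diameter of the patch. -/
def boxRatio (σ : ℝ) : ℝ := 1 / (200 * σ * patchRatio σ)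

theorem one_le_patchRatio (hσ : 2 ≤ σ) : 1 ≤ patchRatio σ := by
  have := one_le_pow₀ (M₀ := ℝ) (by linarith : 1 ≤ σ) (n := ⌈σ ^ 2⌉₊)
  rw [patchRatio]
  linarith

theorem boxRatio_pos (hσ : 2 ≤ σ) : 0 < boxRatio σ := by
  have := one_le_patchRatio hσ
  rw [boxRatio]
  positivity

theorem boxRatio_le_one (hσ : 2 ≤ σ) : boxRatio σ ≤ 1 := by
  have := one_le_patchRatio hσ
  rw [boxRatio, div_le_one (by positivity)]
  nlinarith

theorem two_le_of_mem_nodes (hσ : 0 < σ) (hM : M.ShapeRegular σ) (hp : p ∈ M.nodes) : 2 ≤ σ := by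
  obtain ⟨T, hT⟩ := star_nonempty hp
  exact two_le_of_shapeRegular T hσ (hM T (mem_star.1 hT).1)

/-- With `boxRatio` the box lies within distance diam T / (100 σ) of its centre, for every element T
of the patch. The coordinates then move by at most 1/200, so bounds at the centre persist on the
box. -/
theorem dist_le_of_mem_box (hσ : 0 < σ) (hM : M.ShapeRegular σ) (hp : p ∈ M.nodes)
    {T : Affine.Triangle ℝ Plane} (hT : T ∈ M.star p) {z n x : Plane} (hn : ‖n‖ = 1) {t : ℝ}
    (ht : t ≤ boxRatio σ * M.patchDiam p) (hx : x ∈ box z n (boxRatio σ * M.patchDiam p) t) :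
    σ / (2 * Metric.diam (carrier T)) * dist x z ≤ 1 / 200 := by
  have hd := diam_carrier_pos T
  have hr := one_le_patchRatio (two_le_of_mem_nodes hσ hM hp)
  have h1 : dist x z ≤ 2 * (boxRatio σ * M.patchDiam p) := box_subset_closedBall z hn ht hx
  have h2 := patchDiam_le hσ hM hp hT
  have h3 : 2 * (boxRatio σ * M.patchDiam p) ≤ Metric.diam (carrier T) / (100 * σ) := by
    calc 2 * (boxRatio σ * M.patchDiam p)
        ≤ 2 * (boxRatio σ * (patchRatio σ * Metric.diam (carrier T))) := by
          have := boxRatio_pos (two_le_of_mem_nodes hσ hM hp)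
          gcongr
      _ = Metric.diam (carrier T) / (100 * σ) := by
          rw [boxRatio]
          field_simp
          norm_num
  calc σ / (2 * Metric.diam (carrier T)) * dist x z
      ≤ σ / (2 * Metric.diam (carrier T)) * (Metric.diam (carrier T) / (100 * σ)) := by
        gcongr
        exact h1.trans h3
    _ = 1 / 200 := by field_simp; norm_num

theorem abs_bary_sub_le_of_mem_box (hσ : 0 < σ) (hM : M.ShapeRegular σ) (hp : p ∈ M.nodes)
    {T : Affine.Triangle ℝ Plane} (hT : T ∈ M.star p) {z n x : Plane} (hn : ‖n‖ = 1) {t : ℝ}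
    (ht : t ≤ boxRatio σ * M.patchDiam p) (hx : x ∈ box z n (boxRatio σ * M.patchDiam p) t)
    (i : Fin 3) : |bary T i x - bary T i z| ≤ 1 / 200 :=
  (abs_bary_sub_le T hσ (hM T (mem_star.1 hT).1) i x z).trans
    (dist_le_of_mem_box hσ hM hp hT hn ht hx)

end Weight

/-! ### The element residuals -/

section ElementResidual

variable {P : Params} {M : TriMesh} {u : Plane → Plane} {φ : Plane → Plane → ℝ}
  {χ φh : Plane → ℝ} {φhat : H1 M.domain} {p : Plane} {σ K : ℝ} {T : Affine.Triangle ℝ Plane}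

theorem abs_affineMap_sub_le (hσ : 0 < σ)
    (h : ∃ c, Metric.ball c (Metric.diam (carrier T) / σ) ⊆ carrier T) {A : Plane →ᵃ[ℝ] ℝ}
    {b : ℝ} (hb : ∀ i, |A (T.points i)| ≤ b) (x y : Plane) :
    |A x - A y| ≤ 3 * b * (σ / (2 * Metric.diam (carrier T)) * dist x y) := by
  rw [affine_eq_sum_bary T A x, affine_eq_sum_bary T A y, ← Finset.sum_sub_distrib]
  refine (Finset.abs_sum_le_sum_abs _ _).trans ?_
  calc ∑ i, |bary T i x • A (T.points i) - bary T i y • A (T.points i)|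
      ≤ ∑ _i : Fin 3, σ / (2 * Metric.diam (carrier T)) * dist x y * b := by
        refine Finset.sum_le_sum fun i _ => ?_
        rw [← sub_smul, smul_eq_mul, abs_mul]
        exact mul_le_mul (abs_bary_sub_le T hσ h i x y) (hb i) (abs_nonneg _)
          ((abs_nonneg _).trans (abs_bary_sub_le T hσ h i x y))
    _ = _ := by rw [Finset.sum_const, Finset.card_univ, Fintype.card_fin]; ring

theorem abs_affineMap_le {A : Plane →ᵃ[ℝ] ℝ} {b : ℝ} (hb : ∀ i, |A (T.points i)| ≤ b) {x : Plane}
    (hx : x ∈ carrier T) : |A x| ≤ b := by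
  rw [affine_eq_sum_bary T A x]
  refine (Finset.abs_sum_le_sum_abs _ _).trans ?_
  calc ∑ i, |bary T i x • A (T.points i)| ≤ ∑ i, bary T i x * b := by
        refine Finset.sum_le_sum fun i _ => ?_
        have h0 := (mem_carrier_iff T).1 hx i
        rw [smul_eq_mul, abs_mul, abs_of_nonneg h0]
        gcongr
        exact hb i
    _ = b := by rw [← Finset.sum_mul, sum_bary, one_mul]

/-- An affine function attains a fixed fraction of its maximum well inside of the triangle. -/
theorem exists_large_value (T : Affine.Triangle ℝ Plane) (A : Plane →ᵃ[ℝ] ℝ) :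
    ∃ b, 0 ≤ b ∧ (∀ i, |A (T.points i)| ≤ b) ∧ ∃ z, b / 32 ≤ |A z| ∧
      ∀ i, 7 / 24 ≤ bary T i z ∧ bary T i z ≤ 5 / 12 := by
  obtain ⟨j, hj⟩ := Finite.exists_max fun i => |A (T.points i)|
  obtain ⟨c, hc⟩ := exists_bary T (fun _ => 1 / 3) (by simp)
  refine ⟨|A (T.points j)|, abs_nonneg _, hj, ?_⟩
  -- If the value at the centroid is below b / 32, the point 1/8 of the way to the extremal vertex
  -- has value at least b / 8 − (7/8)(b / 32) > b / 32. Its coordinates are 5/12 and 7/24.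
  by_cases h : |A (T.points j)| / 32 ≤ |A c|
  · exact ⟨c, h, fun i => by rw [hc]; norm_num⟩
  · refine ⟨AffineMap.lineMap c (T.points j) (1 / 8 : ℝ), ?_, fun i => ?_⟩
    · rw [AffineMap.apply_lineMap, AffineMap.lineMap_apply_ring]
      have h1 := abs_sub_abs_le_abs_sub (1 / 8 * A (T.points j)) (-((1 - 1 / 8) * A c))
      rw [abs_neg, abs_mul, abs_mul, sub_neg_eq_add, add_comm (1 / 8 * _)] at h1
      norm_num at h1 h ⊢
      linarith [abs_nonneg (A (T.points j))]
    · rw [bary_lineMap, hc, bary_points]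
      split_ifs <;> norm_num

end ElementResidual

/-! ### The bound for `eta1`, element by element -/

section ElementEstimate

variable {P : Params} {M : TriMesh} {u : Plane → Plane} {φ : Plane → Plane → ℝ}
  {χ φh : Plane → ℝ} {φhat : H1 M.domain} {p : Plane} {σ K : ℝ} {T : Affine.Triangle ℝ Plane}

theorem volume_carrier_le (T : Affine.Triangle ℝ Plane) :
    (volume (carrier T)).toReal ≤ 4 * Metric.diam (carrier T) ^ 2 := by
  have hd := Metric.diam_nonneg (s := carrier T)
  have hsub : carrier T ⊆ Metric.closedBall (T.points 0) (Metric.diam (carrier T)) := fun x hx =>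
    dist_le_diam_carrier T hx (points_mem_carrier T 0)
  have h := measure_mono (μ := volume) hsub
  rw [EuclideanSpace.volume_closedBall_fin_two] at h
  have h2 := ENNReal.toReal_mono (by finiteness) h
  rw [ENNReal.toReal_mul, ENNReal.toReal_pow, ENNReal.toReal_ofReal hd] at h2
  refine h2.trans ?_
  rw [mul_comm]
  gcongr
  rw [ENNReal.toReal_ofReal Real.pi_pos.le]
  exact Real.pi_le_four

theorem exists_elemResidual_eq (hu : M.IsP1 u) (hφh : M.IsP1 φh) (hT : T ∈ M.elems) :
    ∃ A : Plane →ᵃ[ℝ] ℝ, EqOn (elemResidual P u φh) A (interior (carrier T)) := by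
  obtain ⟨c, hc⟩ := exists_coef_eq (P := P) hu hT
  obtain ⟨A, hA⟩ := hφh.2 T hT
  refine ⟨AffineMap.const ℝ Plane (P.Gc / P.eps) - c • A, fun x hx => ?_⟩
  rw [elemResidual_eq hφh hT hx, hc x hx, hA (interior_subset hx)]
  simp

/-- The energy of a scaled test function on a square box. -/
def energyFactor (K : ℝ) : ℝ := 16 * bumpSlope ^ 2 + 4 * (1 + K)

theorem energyFactor_pos (hK : 0 ≤ K) : 0 < energyFactor K := by
  have := one_le_bumpSlope
  rw [energyFactor]
  positivity

/-- The residual is affine on T with vertex values bounded by b and is of size b on a square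
comparable to T. Testing there bounds b by the local error, and b² times the area bounds the
integral over T. -/
theorem weight_sq_mul_setIntegral_elemResidual_le (hσ : 0 < σ) (hM : M.ShapeRegular σ)
    (hu : M.IsP1 u) (hφ : M.IsNodalBasis φ) (hφh : M.IsP1 φh)
    (htop : localError P M u φ χ φh φhat p ≠ ⊤) (hp : p ∈ M.nodes)
    (hpf : ¬ IsFullContact P M u χ φh p) (hK : 0 ≤ K)
    (hcoef : ∀ x ∈ M.openElems p, coef P u x ≤ coefBound P M u K p) (hT : T ∈ M.star p) :
    weight P M u p ^ 2 * ∫ x in interior (carrier T), elemResidual P u φh x ^ 2 ≤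
      2 ^ 18 * energyFactor K / boxRatio σ ^ 4 *
        (localError P M u φ χ φh φhat p).toReal ^ 2 := by
  obtain ⟨hTM, k, hk⟩ := mem_star.1 hT
  obtain ⟨A, hA⟩ := exists_elemResidual_eq (P := P) hu hφh hTM
  obtain ⟨b, hb0, hb, z, hz, hzb⟩ := exists_large_value T A
  have h2σ := two_le_of_mem_nodes hσ hM hp
  have hκ := boxRatio_pos h2σ
  have hκ1 := boxRatio_le_one h2σ
  have hh := patchDiam_pos hp
  have hw := weight_pos (P := P) (u := u) hp
  have hn := norm_outerNormal T 0
  set E := (localError P M u φ χ φh φhat p).toReal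
  set h := M.patchDiam p
  set κ := boxRatio σ
  set w := weight P M u p
  obtain ⟨s, hs, hsz⟩ : ∃ s : ℝ, |s| = 1 ∧ s * A z = |A z| := by
    rcases abs_cases (A z) with ⟨h, -⟩ | ⟨h, -⟩
    · exact ⟨1, by simp, by rw [h, one_mul]⟩
    · exact ⟨-1, by simp, by rw [h, neg_one_mul]⟩
  have hbox : ∀ x ∈ box z (outerNormal T 0) (κ * h) (κ * h), ∀ i,
      1 / 4 < bary T i x ∧ bary T i x < 3 / 4 := fun x hx i => by
    have h1 := abs_le.1 (abs_bary_sub_le_of_mem_box hσ hM hp hT hn le_rfl hx i)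
    have h2 := hzb i
    constructor <;> linarith
  -- On the box the residual has the sign s and size at least b / 32 − 3 b / 200 ≥ b / 64.
  have hest := volume_residual_le (φhat := φhat) (cmax := coefBound P M u K p) (m := b / 64) hu hφ
    hφh htop hp hpf hT hk hn (mul_pos hκ hh) hbox
    (fun x hx => hcoef x (mem_iUnion₂.2 ⟨T, hT, hx⟩)) hs (by positivity) (fun x hx => by
      rw [hA ((mem_interior_iff T).2 fun i => by linarith [(hbox x hx i).1])]
      have h1 := abs_affineMap_sub_le hσ (hM T hTM) hb x z
      have h2 := dist_le_of_mem_box hσ hM hp hT hn le_rfl hx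
      have h3 : |s * A x - s * A z| ≤ 3 * b * (1 / 200) := by
        rw [← mul_sub, abs_mul, hs, one_mul]
        exact h1.trans (by gcongr)
      rw [hsz] at h3
      linarith [(abs_le.1 h3).1])
  have hE : 0 ≤ E := ENNReal.toReal_nonneg
  have hc : 0 ≤ coefBound P M u K p := by
    obtain ⟨x, hx⟩ := openElems_nonempty hp
    exact (coef_pos P u x).le.trans (hcoef x hx)
  have hPc : 0 < P.Gc * P.eps := mul_pos P.Gc_pos P.eps_pos
  have hsq := pow_le_pow_left₀ (by positivity) hest 2
  rw [mul_pow E, Real.sq_sqrt (by positivity)] at hsq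
  have hw1 := weight_sq_mul_le (P := P) (u := u) hp
  have hw2 := weight_sq_mul_coefBound_le (P := P) (u := u) hp hK
  have henergy : w ^ 2 * (P.Gc * P.eps * ((2 * bumpSlope / (κ * h)) ^ 2 *
      (4 * (κ * h * (κ * h)))) + coefBound P M u K p * (4 * (κ * h * (κ * h)))) ≤
      energyFactor K * h ^ 2 := by
    calc _ = 16 * bumpSlope ^ 2 * (w ^ 2 * (P.Gc * P.eps)) +
          4 * κ ^ 2 * (w ^ 2 * coefBound P M u K p) * h ^ 2 := by
          field_simp
          ring
      _ ≤ 16 * bumpSlope ^ 2 * h ^ 2 + 4 * 1 ^ 2 * (1 + K) * h ^ 2 := by gcongr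
      _ = energyFactor K * h ^ 2 := by rw [energyFactor]; ring
  have hb2 : w ^ 2 * b ^ 2 * h ^ 2 ≤ 2 ^ 16 * energyFactor K / κ ^ 4 * E ^ 2 := by
    have h1 : w ^ 2 * (b / 64 / 4 * (κ * h * (κ * h))) ^ 2 ≤ E ^ 2 * (energyFactor K * h ^ 2) :=
      (mul_le_mul_of_nonneg_left hsq (sq_nonneg w)).trans (by
        rw [mul_left_comm]
        gcongr)
    have h2 : w ^ 2 * b ^ 2 * h ^ 2 * (κ ^ 4 * h ^ 2 / 2 ^ 16) ≤
        2 ^ 16 * energyFactor K / κ ^ 4 * E ^ 2 * (κ ^ 4 * h ^ 2 / 2 ^ 16) := by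
      convert h1 using 1
      · ring
      · field_simp
    exact le_of_mul_le_mul_right h2 (by positivity)
  have hint : ∫ x in interior (carrier T), elemResidual P u φh x ^ 2 ≤ b ^ 2 * (4 * h ^ 2) := by
    have hvol : volume (interior (carrier T)) < ⊤ :=
      (measure_mono interior_subset).trans_lt (isCompact_carrier T).measure_lt_top
    have h1 := norm_setIntegral_le_of_norm_le_const (C := b ^ 2)
      (f := fun x => elemResidual P u φh x ^ 2) hvol (fun x hx => by
        rw [hA hx, norm_pow, Real.norm_eq_abs]
        gcongr
        exact abs_affineMap_le hb (interior_subset hx))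
    refine (le_abs_self _).trans (h1.trans ?_)
    gcongr
    refine (ENNReal.toReal_mono (isCompact_carrier T).measure_lt_top.ne
      (measure_mono interior_subset)).trans ((volume_carrier_le T).trans ?_)
    have := diam_le_patchDiam hT
    have := Metric.diam_nonneg (s := carrier T)
    gcongr
  calc w ^ 2 * ∫ x in interior (carrier T), elemResidual P u φh x ^ 2
      ≤ w ^ 2 * (b ^ 2 * (4 * h ^ 2)) := by gcongr
    _ = 4 * (w ^ 2 * b ^ 2 * h ^ 2) := by ring
    _ ≤ 4 * (2 ^ 16 * energyFactor K / κ ^ 4 * E ^ 2) := by gcongr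
    _ = _ := by ring

/-- The constant in the bound of the square of `η_{1,p}`. -/
def volumeConst (σ K : ℝ) : ℝ := σ ^ 2 * (2 ^ 18 * energyFactor K / boxRatio σ ^ 4)

theorem volumeConst_nonneg (hσ : 2 ≤ σ) (hK : 0 ≤ K) : 0 ≤ volumeConst σ K := by
  have := energyFactor_pos hK
  have := boxRatio_pos hσ
  rw [volumeConst]
  positivity

theorem weight_sq_mul_patchIntegral_elemResidual_le (hσ : 0 < σ) (hM : M.ShapeRegular σ)
    (hu : M.IsP1 u) (hφ : M.IsNodalBasis φ) (hφh : M.IsP1 φh)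
    (htop : localError P M u φ χ φh φhat p ≠ ⊤) (hp : p ∈ M.nodes)
    (hpf : ¬ IsFullContact P M u χ φh p) (hK : 0 ≤ K)
    (hcoef : ∀ x ∈ M.openElems p, coef P u x ≤ coefBound P M u K p) :
    weight P M u p ^ 2 * ∫ x in M.patch p, elemResidual P u φh x ^ 2 ≤
      volumeConst σ K * (localError P M u φ χ φh φhat p).toReal ^ 2 := by
  have hint : ∀ T ∈ M.star p,
      IntegrableOn (fun x => elemResidual P u φh x ^ 2) (interior (carrier T)) := fun T hT => by
    obtain ⟨A, hA⟩ := exists_elemResidual_eq (P := P) hu hφh (mem_star.1 hT).1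
    have hcont : Continuous fun x => A x ^ 2 := (continuous_affineMap A).pow 2
    exact ((hcont.continuousOn.integrableOn_compact (isCompact_carrier T)).mono_set
      interior_subset).congr_fun (fun x hx => by simp only [hA hx])
      isOpen_interior.measurableSet
  rw [restrict_patch, TriMesh.openElems, integral_biUnion_finset _
    (fun T _ => isOpen_interior.measurableSet)
    (fun S hS T hT hne => M.disjoint_interior S (mem_star.1 hS).1 T (mem_star.1 hT).1 hne) hint,
    Finset.mul_sum]
  refine (Finset.sum_le_card_nsmul _ _ _ fun T hT => weight_sq_mul_setIntegral_elemResidual_le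
    hσ hM hu hφ hφh htop hp hpf hK hcoef hT).trans ?_
  rw [nsmul_eq_mul, volumeConst, mul_assoc]
  have := energyFactor_pos hK
  have := boxRatio_pos (two_le_of_mem_nodes hσ hM hp)
  gcongr
  exact card_star_le hσ hM

end ElementEstimate

/-! ### The fluxes through the sides -/

/-- The estimate passes through the lower Lebesgue integral, so neither measurability of the sets Q
i nor integrability of f has to be established. -/
theorem mul_setIntegral_le_of_cover {α ι : Type*} [MeasurableSpace α] {μ : Measure α}
    {I : Finset ι} {Q : ι → Set α} {s : Set α} {f : α → ℝ} {B c d : ℝ}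
    (hs : μ (s \ ⋃ i ∈ I, Q i) = 0) (hf : ∀ x, 0 ≤ f x) (hc : 0 ≤ c) (hd : 0 ≤ d)
    (hQ : ∀ i ∈ I, ∃ b, 0 ≤ b ∧ (∀ x ∈ Q i, f x ≤ b) ∧ μ (Q i) ≤ ENNReal.ofReal d ∧
      c * (b * d) ≤ B) : c * ∫ x in s, f x ∂μ ≤ I.card * B := by
  choose! b hb0 hb hμ hB using hQ
  have h1 : ∫⁻ x in s, ENNReal.ofReal (f x) ∂μ ≤
      ∑ i ∈ I, ENNReal.ofReal (b i * d) := by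
    calc ∫⁻ x in s, ENNReal.ofReal (f x) ∂μ
        ≤ ∫⁻ x in ⋃ i : I, Q i, ENNReal.ofReal (f x) ∂μ := by
          have hU : (⋃ i : I, Q i) = ⋃ i ∈ I, Q i := by ext x; simp
          rw [hU]
          exact lintegral_mono_set' (ae_le_set.2 hs)
      _ ≤ ∑' i : I, ∫⁻ x in Q i, ENNReal.ofReal (f x) ∂μ := lintegral_iUnion_le _ _
      _ = ∑ i ∈ I, ∫⁻ x in Q i, ENNReal.ofReal (f x) ∂μ := by
          rw [tsum_fintype]
          exact Finset.sum_coe_sort I fun i => ∫⁻ x in Q i, ENNReal.ofReal (f x) ∂μ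
      _ ≤ ∑ i ∈ I, ENNReal.ofReal (b i * d) := by
          refine Finset.sum_le_sum fun i hi => ?_
          refine (setLIntegral_mono measurable_const fun x hx =>
            ENNReal.ofReal_le_ofReal (hb i hi x hx)).trans ?_
          rw [setLIntegral_const, ENNReal.ofReal_mul (hb0 i hi)]
          gcongr
          exact hμ i hi
  have h2 : ∫ x in s, f x ∂μ ≤ ∑ i ∈ I, b i * d := by
    refine (Real.le_norm_self _).trans ((norm_integral_le_lintegral_norm _).trans ?_)
    simp_rw [Real.norm_eq_abs, abs_of_nonneg (hf _)]
    refine (ENNReal.toReal_mono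
      (ENNReal.sum_ne_top.2 fun _ _ => ENNReal.ofReal_ne_top) h1).trans_eq ?_
    rw [ENNReal.toReal_sum fun _ _ => ENNReal.ofReal_ne_top]
    exact Finset.sum_congr rfl fun i hi => ENNReal.toReal_ofReal (mul_nonneg (hb0 i hi) hd)
  calc c * ∫ x in s, f x ∂μ ≤ c * ∑ i ∈ I, b i * d := by gcongr
    _ = ∑ i ∈ I, c * (b i * d) := Finset.mul_sum _ _ _
    _ ≤ I.card * B := by
      rw [← nsmul_eq_mul]
      exact Finset.sum_le_card_nsmul _ _ _ hB

/-! ### Choice of the height of the bumps on sides -/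

section SideEstimate

variable {P : Params} {M : TriMesh} {u : Plane → Plane} {φ : Plane → Plane → ℝ}
  {χ φh : Plane → ℝ} {φhat : H1 M.domain} {p z : Plane} {σ K : ℝ}
  {S T : Affine.Triangle ℝ Plane} {i i' j j' k k' : Fin 3}

/-- The constant in the bounds of the flux through a side. -/
def sideConst (σ K : ℝ) : ℝ :=
  256 * (4 * bumpSlope ^ 2 / boxRatio σ ^ 2 + (1 + K) + volumeConst σ K)

theorem sideConst_nonneg (hσ : 2 ≤ σ) (hK : 0 ≤ K) : 0 ≤ sideConst σ K := by
  have := volumeConst_nonneg hσ hK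
  rw [sideConst]
  positivity

/-- Here s stands for √(G_c ε) and the height of the box is t = κ w s with κ = `boxRatio σ`. Then s²
/ t² = 1 / (κ w)², so gradient energy, reaction energy and the already bounded element residual are
all of order w⁻² times the area a of the box. Dividing by the length of the box leaves w / s as the
weight of the flux, the square of the weight in `eta2` and `eta3`. -/
theorem flux_le_of_residual_le (hσ : 2 ≤ σ) (hK : 0 ≤ K) {w s h E F R c : ℝ} (hw : 0 < w)
    (hs : 0 < s) (hh : 0 < h) (hF : 0 ≤ F) (hR : 0 ≤ R) (hc : 0 ≤ c)
    (hwc : w ^ 2 * c ≤ 1 + K) (hwR : w ^ 2 * R ≤ volumeConst σ K * E ^ 2)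
    (hest : F * (boxRatio σ * h / 4) ≤
      E * √(s ^ 2 * ((2 * bumpSlope / (boxRatio σ * (w * s))) ^ 2 *
        (4 * (boxRatio σ * h * (boxRatio σ * (w * s))))) +
        c * (4 * (boxRatio σ * h * (boxRatio σ * (w * s))))) +
      √R * √(4 * (boxRatio σ * h * (boxRatio σ * (w * s))))) :
    w / s * (F ^ 2 * (2 * h)) ≤ sideConst σ K * E ^ 2 := by
  have hκ := boxRatio_pos hσ
  set κ := boxRatio σ
  set b := bumpSlope
  set V := volumeConst σ K
  have hV : 0 ≤ V := volumeConst_nonneg hσ hK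
  set a := 4 * (κ * h * (κ * (w * s))) with ha
  have ha0 : 0 < a := by positivity
  have hsq := pow_le_pow_left₀ (by positivity) hest 2
  have h2 := hsq.trans (add_sq_le (a := E * √(s ^ 2 * ((2 * b / (κ * (w * s))) ^ 2 * a) + c * a))
    (b := √R * √a))
  rw [mul_pow E, mul_pow √R, Real.sq_sqrt (by positivity), Real.sq_sqrt hR,
    Real.sq_sqrt ha0.le] at h2
  have h3 : w ^ 2 * (F * (κ * h / 4)) ^ 2 ≤
      2 * a * E ^ 2 * (4 * b ^ 2 / κ ^ 2 + (1 + K) + V) := by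
    calc w ^ 2 * (F * (κ * h / 4)) ^ 2
        ≤ w ^ 2 * (2 * (E ^ 2 * (s ^ 2 * ((2 * b / (κ * (w * s))) ^ 2 * a) + c * a) + R * a)) := by
          gcongr
      _ = 2 * a * E ^ 2 * (4 * b ^ 2 / κ ^ 2 + w ^ 2 * c) + 2 * a * (w ^ 2 * R) := by
          field_simp
          ring
      _ ≤ 2 * a * E ^ 2 * (4 * b ^ 2 / κ ^ 2 + (1 + K)) + 2 * a * (V * E ^ 2) := by gcongr
      _ = _ := by ring
  have h4 : w / s * (F ^ 2 * (2 * h)) * (w * s * (κ ^ 2 * h / 32)) ≤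
      sideConst σ K * E ^ 2 * (w * s * (κ ^ 2 * h / 32)) := by
    convert h3 using 1
    · field_simp
      ring
    · rw [sideConst, ha]
      ring
  exact le_of_mul_le_mul_right h4 (by positivity)

end SideEstimate

/-! ### Covering the interior and boundary sides of a patch -/

section SideIntegrals

variable {P : Params} {M : TriMesh} {u : Plane → Plane} {φ : Plane → Plane → ℝ}
  {χ φh : Plane → ℝ} {φhat : H1 M.domain} {p y z : Plane} {σ K : ℝ}
  {S T : Affine.Triangle ℝ Plane} {i i' j j' k k' : Fin 3}

/-- The common part of two sides. -/
def interface (T : Affine.Triangle ℝ Plane) (i : Fin 3) (S : Affine.Triangle ℝ Plane)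
    (i' : Fin 3) : Set Plane := {x | OnSide T i x ∧ OnSide S i' x}

theorem hausdorff_onSide_le (hT : T ∈ M.star p) {s : Set Plane} (hz : OnSide T i z)
    (hs : ∀ x ∈ s, OnSide T i x) : μH[1] s ≤ ENNReal.ofReal (2 * M.patchDiam p) := by
  refine hausdorff_line_le (z := z) (norm_outerNormal T i) fun x hx => ⟨?_, ?_⟩
  · rw [inner_outerNormal_eq, (hs x hx).1, hz.1]
    simp
  · exact (dist_le_diam_carrier T (hs x hx).mem_carrier hz.mem_carrier).trans
      (diam_le_patchDiam hT)

/-- The weighted square of a flux is controlled by the local error once the flux satisfies the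
residual estimate on boxes of every admissible height. -/
theorem flux_square_le (hσ : 0 < σ) (hM : M.ShapeRegular σ) (hu : M.IsP1 u)
    (hφ : M.IsNodalBasis φ) (hφh : M.IsP1 φh) (htop : localError P M u φ χ φh φhat p ≠ ⊤)
    (hp : p ∈ M.nodes) (hpf : ¬ IsFullContact P M u χ φh p) (hK : 0 ≤ K)
    (hcoef : ∀ x ∈ M.openElems p, coef P u x ≤ coefBound P M u K p) {f : ℝ}
    (hest : ∀ t, 0 < t → t ≤ boxRatio σ * M.patchDiam p →
      P.Gc * P.eps * |f| * (boxRatio σ * M.patchDiam p / 4) ≤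
      (localError P M u φ χ φh φhat p).toReal *
        √(P.Gc * P.eps * ((2 * bumpSlope / t) ^ 2 * (4 * (boxRatio σ * M.patchDiam p * t))) +
          coefBound P M u K p * (4 * (boxRatio σ * M.patchDiam p * t))) +
      √(∫ x in M.patch p, elemResidual P u φh x ^ 2) *
        √(4 * (boxRatio σ * M.patchDiam p * t))) :
    weight P M u p / √(P.Gc * P.eps) * ((P.Gc * P.eps * f) ^ 2 * (2 * M.patchDiam p)) ≤
      sideConst σ K * (localError P M u φ χ φh φhat p).toReal ^ 2 := by
  have hPc : 0 < P.Gc * P.eps := mul_pos P.Gc_pos P.eps_pos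
  have h2σ := two_le_of_mem_nodes hσ hM hp
  have hκ := boxRatio_pos h2σ
  have hw := weight_pos (P := P) (u := u) hp
  have hs := Real.sqrt_pos.2 hPc
  have hc : 0 ≤ coefBound P M u K p := by
    obtain ⟨x, hx⟩ := openElems_nonempty hp
    exact (coef_pos P u x).le.trans (hcoef x hx)
  have h := flux_le_of_residual_le (c := coefBound P M u K p)
    (E := (localError P M u φ χ φh φhat p).toReal) (F := P.Gc * P.eps * |f|)
    (R := ∫ x in M.patch p, elemResidual P u φh x ^ 2) h2σ hK hw hs
    (patchDiam_pos hp) (by positivity) (integral_nonneg fun _ => sq_nonneg _) hc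
    (weight_sq_mul_coefBound_le hp hK)
    (weight_sq_mul_patchIntegral_elemResidual_le hσ hM hu hφ hφh htop hp hpf hK hcoef)
    (by
      rw [Real.sq_sqrt hPc.le]
      refine hest _ (by positivity) ?_
      have := weight_mul_sqrt_le (P := P) (M := M) (u := u) (p := p)
      gcongr)
  rwa [mul_pow _ |f|, sq_abs, ← mul_pow] at h

/-- The side of T is at most as long as that of S, so the bump is centred on the side of T and fits
into both elements. The jump is constant on the interface, hence one bump controls all of it. -/
theorem interface_flux_le_of_short (hσ : 0 < σ) (hM : M.ShapeRegular σ) (hu : M.IsP1 u)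
    (hφ : M.IsNodalBasis φ) (hφh : M.IsP1 φh) (htop : localError P M u φ χ φh φhat p ≠ ⊤)
    (hp : p ∈ M.nodes) (hpf : ¬ IsFullContact P M u χ φh p) (hK : 0 ≤ K)
    (hcoef : ∀ x ∈ M.openElems p, coef P u x ≤ coefBound P M u K p)
    (hT : T ∈ M.star p) (hS : S ∈ M.star p) (hne : T ≠ S) (hk : T.points k = p)
    (hk' : S.points k' = p) (hik : i ≠ k) (hij : i ≠ j) (hjk : j ≠ k) (hik' : i' ≠ k')
    (hij' : i' ≠ j') (hjk' : j' ≠ k') {s : ℝ} (hs : s = 1 / 2 ∨ s = 1)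
    (hsq : T.points j - p = s • (S.points j' - p)) :
    ∃ b, 0 ≤ b ∧ (∀ x ∈ interface T i S i', (P.Gc * P.eps * M.jump φh x) ^ 2 ≤ b) ∧
      μH[1] (interface T i S i') ≤ ENNReal.ofReal (2 * M.patchDiam p) ∧
      weight P M u p / √(P.Gc * P.eps) * (b * (2 * M.patchDiam p)) ≤
        sideConst σ K * (localError P M u φ χ φh φhat p).toReal ^ 2 := by
  have hTM := (mem_star.1 hT).1
  have hSM := (mem_star.1 hS).1
  obtain ⟨A, hA⟩ := hφh.2 T hTM
  obtain ⟨B, hB⟩ := hφh.2 S hSM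
  have hκh : 0 < boxRatio σ * M.patchDiam p :=
    mul_pos (boxRatio_pos (two_le_of_mem_nodes hσ hM hp)) (patchDiam_pos hp)
  -- The point at 5/8 serves both cases: along the side of S it lies at 5/8 or 5/16. So in both
  -- elements the two nonzero coordinates are in [5/16, 11/16], and with the margin 1/200 they stay
  -- between 1/4 and 3/4 on the box. The midpoint of the side of T would fail in the second case,
  -- giving 1/4.
  set z : Plane := AffineMap.lineMap p (T.points j) (5 / 8 : ℝ) with hz
  have hzS : z = AffineMap.lineMap p (S.points j') (5 / 8 * s) := by
    rw [hz, AffineMap.lineMap_apply, AffineMap.lineMap_apply, vsub_eq_sub, vsub_eq_sub, hsq,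
      smul_smul]
  have hbT : ∀ a, bary T a z = (if a = k then 1 else 0) +
      5 / 8 * ((if a = j then 1 else 0) - if a = k then 1 else 0) := fun a => by
    rw [hz, bary_lineMap, ← hk, bary_points, bary_points]
  have hbS : ∀ a, bary S a z = (if a = k' then 1 else 0) +
      5 / 8 * s * ((if a = j' then 1 else 0) - if a = k' then 1 else 0) := fun a => by
    rw [hzS, bary_lineMap, ← hk', bary_points, bary_points]
  have hcases : ∀ {a b c : Fin 3}, a ≠ c → a ≠ b → b ≠ c → ∀ d, d ≠ a → d = b ∨ d = c := by
    decide
  have hT0 : bary T i z = 0 := by rw [hbT, if_neg hik, if_neg hij]; norm_num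
  have hT1 : ∀ a, a ≠ i → 5 / 16 ≤ bary T a z ∧ bary T a z ≤ 11 / 16 := fun a ha => by
    rcases hcases hik hij hjk a ha with rfl | rfl
    · rw [hbT, if_neg hjk, if_pos rfl]; norm_num
    · rw [hbT, if_pos rfl, if_neg hjk.symm]; norm_num
  have hS0 : bary S i' z = 0 := by rw [hbS, if_neg hik', if_neg hij']; norm_num
  have hS1 : ∀ a, a ≠ i' → 5 / 16 ≤ bary S a z ∧ bary S a z ≤ 11 / 16 := fun a ha => by
    rcases hcases hik' hij' hjk' a ha with rfl | rfl
    · rw [hbS, if_neg hjk', if_pos rfl]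
      rcases hs with rfl | rfl <;> norm_num
    · rw [hbS, if_pos rfl, if_neg hjk'.symm]
      rcases hs with rfl | rfl <;> norm_num
  have hzT' : OnSide T i z := ⟨hT0, fun a ha => by linarith [(hT1 a ha).1]⟩
  have hzS' : OnSide S i' z := ⟨hS0, fun a ha => by linarith [(hS1 a ha).1]⟩
  have hbox : ∀ {R : Affine.Triangle ℝ Plane} {m : Fin 3}, R ∈ M.star p → bary R m z = 0 →
      (∀ a, a ≠ m → 5 / 16 ≤ bary R a z ∧ bary R a z ≤ 11 / 16) → ∀ t,
      t ≤ boxRatio σ * M.patchDiam p →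
      ∀ x ∈ box z (outerNormal T i) (boxRatio σ * M.patchDiam p) t,
        (∀ a, a ≠ m → 1 / 4 < bary R a x) ∧ ∀ a, bary R a x < 3 / 4 := by
    intro R m hR h0 h1 t ht x hx
    have h2 := fun a => abs_le.1
      (abs_bary_sub_le_of_mem_box hσ hM hp hR (norm_outerNormal T i) ht hx a)
    refine ⟨fun a ha => by linarith [(h1 a ha).1, (h2 a).1], fun a => ?_⟩
    rcases eq_or_ne a m with rfl | ha
    · linarith [(h2 a).2]
    · linarith [(h1 a ha).2, (h2 a).2]
  refine ⟨(P.Gc * P.eps * (⟪affGrad A, outerNormal T i⟫ - ⟪affGrad B, outerNormal T i⟫)) ^ 2,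
    sq_nonneg _, fun x hx => ?_, hausdorff_onSide_le hT hzT' fun x hx => hx.1,
    flux_square_le hσ hM hu hφ hφh htop hp hpf hK hcoef fun t ht htl => ?_⟩
  · rw [TriMesh.jump, hx.1.normalFlux_eq hTM hSM hne hx.2 hA hB, mul_neg, neg_sq]
  · exact jump_residual_le hu hφ hφh htop hp hpf hT hS hne hk hik.symm hzT' hzS' hA hB ht htl
      (hbox hT hT0 hT1 t htl) (hbox hS hS0 hS1 t htl)
      (fun x hx => hcoef x (mem_iUnion₂.2 ⟨T, hT, hx⟩))
      fun x hx => hcoef x (mem_iUnion₂.2 ⟨S, hS, hx⟩)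

theorem interface_flux_le (hσ : 0 < σ) (hM : M.ShapeRegular σ) (hu : M.IsP1 u)
    (hφ : M.IsNodalBasis φ) (hφh : M.IsP1 φh) (htop : localError P M u φ χ φh φhat p ≠ ⊤)
    (hp : p ∈ M.nodes) (hpf : ¬ IsFullContact P M u χ φh p) (hK : 0 ≤ K)
    (hcoef : ∀ x ∈ M.openElems p, coef P u x ≤ coefBound P M u K p)
    (hT : T ∈ M.star p) (hS : S ∈ M.star p) (hne : T ≠ S) (i i' : Fin 3) :
    ∃ b, 0 ≤ b ∧ (∀ x ∈ interface T i S i', (P.Gc * P.eps * M.jump φh x) ^ 2 ≤ b) ∧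
      μH[1] (interface T i S i') ≤ ENNReal.ofReal (2 * M.patchDiam p) ∧
      weight P M u p / √(P.Gc * P.eps) * (b * (2 * M.patchDiam p)) ≤
        sideConst σ K * (localError P M u φ χ φh φhat p).toReal ^ 2 := by
  have h2σ := two_le_of_mem_nodes hσ hM hp
  have hside := sideConst_nonneg h2σ hK
  rcases (interface T i S i').eq_empty_or_nonempty with he | ⟨y, hyT, hyS⟩
  · refine ⟨0, le_rfl, by simp [he], by simp [he], ?_⟩
    rw [zero_mul, mul_zero]
    positivity
  obtain ⟨hTM, k, hk⟩ := mem_star.1 hT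
  obtain ⟨hSM, k', hk'⟩ := mem_star.1 hS
  have hyp : y ≠ p := by
    rintro rfl
    refine hyT.bary_ne_one k ?_
    rw [← hk, bary_self]
  obtain ⟨i₀, j, i₀', j', hik, hij, hjk, hik', hij', hjk', h0, h0', s, hs, hsq⟩ :=
    exists_radial_pair hTM hSM hne hk hk' hyp hyT.mem_carrier hyS.mem_carrier
  obtain rfl := hyT.bary_eq_zero_iff.1 h0
  obtain rfl := hyS.bary_eq_zero_iff.1 h0'
  -- If the side of T is the longer one, the roles of T and S are exchanged.
  by_cases hs2 : s = 2
  · have hsq' : S.points j' - p = (1 / 2 : ℝ) • (T.points j - p) := by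
      rw [hsq, hs2, smul_smul]
      norm_num
    have h := interface_flux_le_of_short hσ hM hu hφ hφh htop hp hpf hK hcoef hS hT hne.symm hk' hk
      hik' hij' hjk' hik hij hjk (Or.inl rfl) hsq'
    rwa [show interface S i₀' T i₀ = interface T i₀ S i₀' from Set.ext fun x => and_comm] at h
  · exact interface_flux_le_of_short hσ hM hu hφ hφh htop hp hpf hK hcoef hT hS hne hk hk'
      hik hij hjk hik' hij' hjk' (by tauto) hsq

/-- The part of a half of a side on the boundary of the domain. -/
def boundaryHalf (M : TriMesh) (T : Affine.Triangle ℝ Plane) (i a : Fin 3) : Set Plane :=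
  {x | OnSide T i x ∧ 1 / 2 < bary T a x ∧ x ∈ frontier M.domain}

theorem notMem_domain_of_mem_frontier (hx : p ∈ frontier M.domain) : p ∉ M.domain := fun h => by
  rw [isOpen_domain.frontier_eq] at hx
  exact hx.2 h

/-- A hanging node may separate a boundary half of a side from an interior half, so the halves are
treated separately: one boundary point in a half makes the entire half avoid Ω, by
`OnSide.mem_domain_of_half`. As p is not in Ω, bumps need not vanish on the boundary. -/
theorem boundary_flux_le (hσ : 0 < σ) (hM : M.ShapeRegular σ) (hu : M.IsP1 u)
    (hφ : M.IsNodalBasis φ) (hφh : M.IsP1 φh) (htop : localError P M u φ χ φh φhat p ≠ ⊤)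
    (hp : p ∈ M.nodes) (hpf : ¬ IsFullContact P M u χ φh p) (hK : 0 ≤ K)
    (hcoef : ∀ x ∈ M.openElems p, coef P u x ≤ coefBound P M u K p) (hpΩ : p ∉ M.domain)
    (hT : T ∈ M.star p) (i a : Fin 3) :
    ∃ b, 0 ≤ b ∧ (∀ x ∈ boundaryHalf M T i a, (P.Gc * P.eps * M.normalFlux φh x) ^ 2 ≤ b) ∧
      μH[1] (boundaryHalf M T i a) ≤ ENNReal.ofReal (2 * M.patchDiam p) ∧
      weight P M u p / √(P.Gc * P.eps) * (b * (2 * M.patchDiam p)) ≤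
        sideConst σ K * (localError P M u φ χ φh φhat p).toReal ^ 2 := by
  have h2σ := two_le_of_mem_nodes hσ hM hp
  have hside := sideConst_nonneg h2σ hK
  rcases (boundaryHalf M T i a).eq_empty_or_nonempty with he | ⟨y, hyT, hya, hyΩ⟩
  · refine ⟨0, le_rfl, by simp [he], by simp [he], ?_⟩
    rw [zero_mul, mul_zero]
    positivity
  have hTM := (mem_star.1 hT).1
  obtain ⟨A, hA⟩ := hφh.2 T hTM
  have hai : a ≠ i := by
    rintro rfl
    rw [hyT.1] at hya
    norm_num at hya
  -- The value 11/16 leaves room for 1/200 both above 1/2, to stay in the half of the vertex a, and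
  -- below 3/4, to avoid the small patches.
  obtain ⟨z, hz⟩ := exists_bary T (fun m => if m = i then 0 else if m = a then 11 / 16 else 5 / 16)
    (by revert hai; fin_cases i <;> fin_cases a <;> simp [Fin.sum_univ_three] <;> norm_num)
  have hz0 : bary T i z = 0 := by rw [hz, if_pos rfl]
  have hza : bary T a z = 11 / 16 := by rw [hz, if_neg hai, if_pos rfl]
  have hz1 : ∀ m, m ≠ i → 5 / 16 ≤ bary T m z ∧ bary T m z ≤ 11 / 16 := fun m hm => by
    rw [hz, if_neg hm]
    split_ifs <;> norm_num
  have hzT : OnSide T i z := ⟨hz0, fun m hm => by linarith [(hz1 m hm).1]⟩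
  have hclose : ∀ t, t ≤ boxRatio σ * M.patchDiam p →
      ∀ x ∈ box z (outerNormal T i) (boxRatio σ * M.patchDiam p) t, ∀ m,
        -(1 / 200) ≤ bary T m x - bary T m z ∧ bary T m x - bary T m z ≤ 1 / 200 :=
    fun t ht x hx m => abs_le.1
      (abs_bary_sub_le_of_mem_box hσ hM hp hT (norm_outerNormal T i) ht hx m)
  refine ⟨(P.Gc * P.eps * ⟪affGrad A, outerNormal T i⟫) ^ 2, sq_nonneg _, fun x hx => ?_,
    hausdorff_onSide_le hT hzT fun x hx => hx.1,
    flux_square_le hσ hM hu hφ hφh htop hp hpf hK hcoef fun t ht htl => ?_⟩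
  · obtain ⟨hxT, hxa, hxΩ⟩ := hx
    rw [hxT.normalFlux_eq_of_notMem hTM (fun S hS hne hxS => ?_) hA]
    obtain ⟨i', hi'⟩ := exists_onSide hxS (hxT.notMem_interior hTM hS)
      (hxT.notMem_vertices hTM (fun m l _ => ne_midpoint_of_half_lt hxa (hxT.bary_ne_one a) m l) hS)
    exact notMem_domain_of_mem_frontier hxΩ (hxT.mem_domain hTM hS hne.symm hi')
  · refine boundary_residual_le hu hφ hφh htop hp hpf hpΩ hT hzT hA ht htl (fun x hx => ?_)
      (fun x hx hxT hxΩ => ?_) fun x hx => hcoef x (mem_iUnion₂.2 ⟨T, hT, hx⟩)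
    · have h2 := hclose t htl x hx
      refine ⟨fun m hm => by linarith [(hz1 m hm).1, (h2 m).1], fun m => ?_⟩
      rcases eq_or_ne m i with rfl | hm
      · linarith [(h2 m).2]
      · linarith [(hz1 m hm).2, (h2 m).2]
    · refine notMem_domain_of_mem_frontier hyΩ (hyT.mem_domain_of_half hTM hxT hya ?_ hxΩ)
      linarith [(hclose t htl x hx a).1]

/-- The vertices and the midpoints of the sides of the elements. -/
def sideMidpoints (M : TriMesh) : Set Plane :=
  ⋃ T ∈ M.elems, ⋃ (j : Fin 3) (k : Fin 3), {midpoint ℝ (T.points j) (T.points k)}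

theorem hausdorff_sideMidpoints : μH[1] (sideMidpoints M) = 0 := by
  have : NullSingletonClass (μH[1] : Measure Plane) := Measure.nullSingletonClass_hausdorff _ one_pos
  refine Set.Finite.measure_zero ?_ _
  exact M.elems.finite_toSet.biUnion fun T _ => finite_iUnion fun j => finite_iUnion fun k =>
    finite_singleton _

theorem midpoint_mem_sideMidpoints (hT : T ∈ M.elems) (j k : Fin 3) :
    midpoint ℝ (T.points j) (T.points k) ∈ sideMidpoints M := by
  simp only [sideMidpoints, mem_iUnion]
  exact ⟨T, hT, j, k, rfl⟩

theorem point_mem_sideMidpoints (hT : T ∈ M.elems) (h : y ∈ range T.points) :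
    y ∈ sideMidpoints M := by
  obtain ⟨j, rfl⟩ := h
  simpa using midpoint_mem_sideMidpoints hT j j

/-- Apart from finitely many vertices and midpoints, an interior point of the patch on the boundary
of one element is relatively interior to a side of it and to a side of a second element of the star.
-/
theorem innerSides_subset (p : Plane) :
    M.innerSides p \ sideMidpoints M ⊆ ⋃ q ∈ (M.star p).offDiag ×ˢ (Finset.univ : Finset
      (Fin 3 × Fin 3)), interface q.1.1 q.2.1 q.1.2 q.2.2 := by
  rintro x ⟨⟨hxp, hx⟩, hxm⟩
  obtain ⟨T, hT, hxT⟩ := mem_iUnion₂.1 hx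
  have hTM := (mem_star.1 hT).1
  have hxT' : x ∈ carrier T ∧ x ∉ interior (carrier T) := by
    rwa [(isClosed_carrier T).frontier_eq] at hxT
  obtain ⟨i, hi⟩ := exists_onSide hxT'.1 hxT'.2 fun h => hxm (point_mem_sideMidpoints hTM h)
  obtain ⟨S, hS, hne, i', hi'⟩ := hi.exists_onSide_of_mem_interior
    (fun R hR => (mem_star.1 hR).1) hTM
    (fun j k _ h => hxm (h ▸ midpoint_mem_sideMidpoints hTM j k)) hxp
  refine mem_iUnion₂.2 ⟨((T, S), (i, i')), ?_, hi, hi'⟩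
  simp [hT, hS, hne.symm]

theorem boundarySides_subset (p : Plane) :
    M.boundarySides p \ sideMidpoints M ⊆ ⋃ q ∈ M.star p ×ˢ (Finset.univ : Finset
      (Fin 3 × Fin 3)), boundaryHalf M q.1 q.2.1 q.2.2 := by
  rintro x ⟨⟨hxΩ, hxp⟩, hxm⟩
  obtain ⟨T, hT, hxT⟩ := mem_iUnion₂.1 (closure_patch_subset (frontier_subset_closure hxp))
  have hTM := (mem_star.1 hT).1
  obtain ⟨i, hi⟩ := exists_onSide hxT
    (fun h => notMem_domain_of_mem_frontier hxΩ (interior_subset_domain hTM h))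
    fun h => hxm (point_mem_sideMidpoints hTM h)
  -- The two nonzero coordinates have sum 1, so if neither exceeds 1/2, the point is the excluded
  -- midpoint.
  obtain ⟨a, ha⟩ : ∃ a, 1 / 2 < bary T a x := by
    by_contra! hcon
    obtain ⟨a, b, hai, hbi, hab, huniv⟩ : ∃ a b, a ≠ i ∧ b ≠ i ∧ a ≠ b ∧
        (Finset.univ : Finset (Fin 3)) = {i, a, b} := by
      fin_cases i <;> decide
    have hsum := sum_bary T x
    rw [huniv, Finset.sum_insert (by simp [hai.symm, hbi.symm]), Finset.sum_pair hab, hi.1] at hsum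
    have h1 := hcon a
    have h2 := hcon b
    refine hxm ?_
    have hx : x = midpoint ℝ (T.points a) (T.points b) := bary_ext T fun m => by
      rw [AffineMap.map_midpoint, midpoint_eq_smul_add, bary_points, bary_points, smul_eq_mul,
        invOf_eq_inv]
      have hm : m ∈ ({i, a, b} : Finset (Fin 3)) := huniv ▸ Finset.mem_univ m
      simp only [Finset.mem_insert, Finset.mem_singleton] at hm
      rcases hm with rfl | rfl | rfl
      · rw [hi.1, if_neg hai.symm, if_neg hbi.symm]; norm_num
      · rw [if_pos rfl, if_neg hab]; linarith
      · rw [if_neg hab.symm, if_pos rfl]; linarith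
    exact hx ▸ midpoint_mem_sideMidpoints hTM a b
  refine mem_iUnion₂.2 ⟨(T, (i, a)), ?_, hi, ha, hxΩ⟩
  simp [hT]

end SideIntegrals

/-! ### The error estimators -/

section Estimators

variable {P : Params} {M : TriMesh} {u : Plane → Plane} {φ : Plane → Plane → ℝ}
  {χ φh : Plane → ℝ} {φhat : H1 M.domain} {p : Plane} {σ K : ℝ}

theorem le_sqrt_mul_of_sq_le {a c E : ℝ} (hE : 0 ≤ E) (h : a ^ 2 ≤ c * E ^ 2) : a ≤ √c * E := by
  rw [← Real.sqrt_sq hE, ← Real.sqrt_mul' _ (sq_nonneg E)]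
  exact Real.le_sqrt_of_sq_le h

theorem eta1_le (hσ : 0 < σ) (hM : M.ShapeRegular σ) (hu : M.IsP1 u)
    (hφ : M.IsNodalBasis φ) (hφh : M.IsP1 φh) (htop : localError P M u φ χ φh φhat p ≠ ⊤)
    (hp : p ∈ M.nodes) (hpf : ¬ IsFullContact P M u χ φh p) (hK : 0 ≤ K)
    (hcoef : ∀ x ∈ M.openElems p, coef P u x ≤ coefBound P M u K p) :
    eta1 P M u φh p ≤ √(volumeConst σ K) * (localError P M u φ χ φh φhat p).toReal := by
  refine le_sqrt_mul_of_sq_le ENNReal.toReal_nonneg ?_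
  rw [eta1, mul_pow, Real.sq_sqrt (integral_nonneg fun _ => sq_nonneg _)]
  exact weight_sq_mul_patchIntegral_elemResidual_le hσ hM hu hφ hφh htop hp hpf hK hcoef

theorem weighted_sqrt_sq {w a I : ℝ} (hw : 0 ≤ w) (ha : 0 < a) (hI : 0 ≤ I) :
    (w ^ (1 / 2 : ℝ) * a ^ (-(1 / 4) : ℝ) * √I) ^ 2 = w / √a * I := by
  rw [mul_pow, mul_pow, Real.sq_sqrt hI, ← Real.rpow_mul_natCast hw, ← Real.rpow_mul_natCast ha.le,
    Real.sqrt_eq_rpow, div_eq_mul_inv w, ← Real.rpow_neg ha.le]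
  norm_num

theorem eta2_le (hσ : 0 < σ) (hM : M.ShapeRegular σ) (hu : M.IsP1 u)
    (hφ : M.IsNodalBasis φ) (hφh : M.IsP1 φh) (htop : localError P M u φ χ φh φhat p ≠ ⊤)
    (hp : p ∈ M.nodes) (hpf : ¬ IsFullContact P M u χ φh p) (hK : 0 ≤ K)
    (hcoef : ∀ x ∈ M.openElems p, coef P u x ≤ coefBound P M u K p) :
    eta2 P M u φh p ≤ √(9 * σ ^ 4 * sideConst σ K) *
      (localError P M u φ χ φh φhat p).toReal := by
  classical
  have hw := (weight_pos (P := P) (u := u) hp).le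
  refine le_sqrt_mul_of_sq_le ENNReal.toReal_nonneg ?_
  rw [eta2, weighted_sqrt_sq hw (mul_pos P.Gc_pos P.eps_pos)
    (integral_nonneg fun _ => sq_nonneg _)]
  have hd := (patchDiam_pos hp).le
  refine (mul_setIntegral_le_of_cover
    (I := (M.star p).offDiag ×ˢ (Finset.univ : Finset (Fin 3 × Fin 3)))
    (Q := fun q => interface q.1.1 q.2.1 q.1.2 q.2.2) (d := 2 * M.patchDiam p)
    (B := sideConst σ K * (localError P M u φ χ φh φhat p).toReal ^ 2)
    (measure_mono_null (fun x hx => ?_) (hausdorff_sideMidpoints (M := M)))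
    (fun _ => sq_nonneg _) (by positivity) (by positivity) fun q hq => ?_).trans ?_
  · by_contra hxm
    exact hx.2 (innerSides_subset p ⟨hx.1, hxm⟩)
  · have h := Finset.mem_offDiag.1 (Finset.mem_product.1 hq).1
    exact interface_flux_le hσ hM hu hφ hφh htop hp hpf hK hcoef h.1 h.2.1 h.2.2 _ _
  · rw [← mul_assoc]
    have hs := sideConst_nonneg (two_le_of_mem_nodes hσ hM hp) hK
    gcongr
    have hc := card_star_le (p := p) hσ hM
    rw [Finset.card_product, Finset.offDiag_card, Finset.card_univ, Fintype.card_prod,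
      Fintype.card_fin]
    calc (((((M.star p).card * (M.star p).card - (M.star p).card) * (3 * 3) : ℕ)) : ℝ)
        ≤ (((M.star p).card * (M.star p).card * (3 * 3) : ℕ) : ℝ) :=
          Nat.cast_le.2 (Nat.mul_le_mul_right _ (Nat.sub_le _ _))
      _ = 9 * ((M.star p).card : ℝ) ^ 2 := by push_cast; ring
      _ ≤ 9 * (σ ^ 2) ^ 2 := by gcongr
      _ = 9 * σ ^ 4 := by ring

theorem eta3_le (hσ : 0 < σ) (hM : M.ShapeRegular σ) (hu : M.IsP1 u)
    (hφ : M.IsNodalBasis φ) (hφh : M.IsP1 φh) (htop : localError P M u φ χ φh φhat p ≠ ⊤)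
    (hp : p ∈ M.nodes) (hpf : ¬ IsFullContact P M u χ φh p) (hK : 0 ≤ K)
    (hcoef : ∀ x ∈ M.openElems p, coef P u x ≤ coefBound P M u K p)
    (hpΩ : p ∈ frontier M.domain) :
    eta3 P M u φh p ≤ √(9 * σ ^ 2 * sideConst σ K) *
      (localError P M u φ χ φh φhat p).toReal := by
  have hw := (weight_pos (P := P) (u := u) hp).le
  refine le_sqrt_mul_of_sq_le ENNReal.toReal_nonneg ?_
  rw [eta3, weighted_sqrt_sq hw (mul_pos P.Gc_pos P.eps_pos)
    (integral_nonneg fun _ => sq_nonneg _)]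
  have hd := (patchDiam_pos hp).le
  refine (mul_setIntegral_le_of_cover
    (I := M.star p ×ˢ (Finset.univ : Finset (Fin 3 × Fin 3)))
    (Q := fun q => boundaryHalf M q.1 q.2.1 q.2.2) (d := 2 * M.patchDiam p)
    (B := sideConst σ K * (localError P M u φ χ φh φhat p).toReal ^ 2)
    (measure_mono_null (fun x hx => ?_) (hausdorff_sideMidpoints (M := M)))
    (fun _ => sq_nonneg _) (by positivity) (by positivity) fun q hq => ?_).trans ?_
  · by_contra hxm
    exact hx.2 (boundarySides_subset p ⟨hx.1, hxm⟩)
  · exact boundary_flux_le hσ hM hu hφ hφh htop hp hpf hK hcoef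
      (notMem_domain_of_mem_frontier hpΩ) (Finset.mem_product.1 hq).1 _ _
  · rw [← mul_assoc]
    have hs := sideConst_nonneg (two_le_of_mem_nodes hσ hM hp) hK
    gcongr
    have hc := card_star_le (p := p) hσ hM
    rw [Finset.card_product, Finset.card_univ, Fintype.card_prod, Fintype.card_fin]
    push_cast
    linarith

theorem ofReal_le_ofReal_mul {a b c : ℝ} {E : ℝ≥0∞} (hE : E ≠ ⊤) (hb : 0 ≤ b) (hbc : b ≤ c)
    (h : a ≤ b * E.toReal) : ENNReal.ofReal a ≤ ENNReal.ofReal c * E := by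
  refine (ENNReal.ofReal_le_ofReal h).trans ?_
  rw [ENNReal.ofReal_mul hb, ENNReal.ofReal_toReal hE]
  gcongr

end Estimators

end PhaseField

end

/-! ### The efficiency theorem -/

open PhaseField in
theorem theorem2 (σ K : ℝ) (hσ : 0 < σ) :
    ∃ C : ℝ, 0 < C ∧
      ∀ (P : Params) (M : TriMesh) (u : Plane → Plane) (φ : Plane → Plane → ℝ)
        (φold φh : Plane → ℝ) (φhat : H1 M.domain) (p : Plane),
        M.ShapeRegular σ → M.IsP1 u → M.IsNodalBasis φ →
        IsDiscreteSolution P M u (M.interp φ φold) φh →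
        IsAuxSolution P M u (M.interp φ φold) φhat →
        p ∈ M.nodes → ¬ IsFullContact P M u (M.interp φ φold) φh p →
        (∀ x ∈ M.openElems p, ∀ y ∈ M.openElems p,
          M.patchDiam p * ((1 - P.kappa) * (energyDensity P u x - energyDensity P u y))
            ≤ K * P.Gc) →
        ENNReal.ofReal (eta1 P M u φh p) ≤
            ENNReal.ofReal C * localError P M u φ (M.interp φ φold) φh φhat p ∧
        ENNReal.ofReal (eta2 P M u φh p) ≤
            ENNReal.ofReal C * localError P M u φ (M.interp φ φold) φh φhat p ∧
        (p ∈ frontier M.domain →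
          ENNReal.ofReal (eta3 P M u φh p) ≤
            ENNReal.ofReal C * localError P M u φ (M.interp φ φold) φh φhat p) := by
  -- The sum dominates each of the three constants. The 1 makes it positive for every K; that K is
  -- nonnegative follows later from the oscillation hypothesis with x = y.
  refine ⟨1 + √(volumeConst σ K) + √(9 * σ ^ 4 * sideConst σ K) + √(9 * σ ^ 2 * sideConst σ K),
    by positivity, ?_⟩
  intro P M u φ φold φh φhat p hM hu hφ hdisc _ hp hpf hosc
  have h1 := Real.sqrt_nonneg (volumeConst σ K)
  have h2 := Real.sqrt_nonneg (9 * σ ^ 4 * sideConst σ K)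
  have h3 := Real.sqrt_nonneg (9 * σ ^ 2 * sideConst σ K)
  -- An infinite local error makes the claims trivial because C > 0; otherwise the estimates are
  -- carried out in ℝ.
  by_cases htop : localError P M u φ (M.interp φ φold) φh φhat p = ⊤
  · rw [htop, ENNReal.mul_top (by rw [Ne, ENNReal.ofReal_eq_zero, not_le]; positivity)]
    exact ⟨le_top, le_top, fun _ => le_top⟩
  have hK := nonneg_of_oscillation_le hp hosc
  have hcoef := fun x hx => coef_le_coefBound (x := x) hp hosc hx
  exact ⟨ofReal_le_ofReal_mul htop h1 (by linarith)
      (eta1_le hσ hM hu hφ hdisc.1 htop hp hpf hK hcoef),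
    ofReal_le_ofReal_mul htop h2 (by linarith)
      (eta2_le hσ hM hu hφ hdisc.1 htop hp hpf hK hcoef),
    fun hpΩ => ofReal_le_ofReal_mul htop h3 (by linarith)
      (eta3_le hσ hM hu hφ hdisc.1 htop hp hpf hK hcoef hpΩ)⟩
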